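/- **Calculus.** Fix a set of operation symbols. The types of $\lambda_{\mathrm{eff}}^{+}$ are given by: value types $A,B ::= A\to C \mid \prod_{i=1}^n A_i \mid A+B$ ($n\ge 0$); computation types $C ::= A!\Sigma$; signatures $\Sigma$, i.e. finite sets $\{\mathtt{op}:A_{\mathtt{op}}\rightarrowtriangle B_{\mathtt{op}}\}$ with at most one entry per operation symbol (the order is irrelevant). Terms are considered with their typing and up to renaming of bound variables. * Value terms $V,W$: variables, $\lambda x.M$, $\langle V_1,\dots,V_n\rangle$, $\pi_i V$, $\iota_1V$, $\iota_2V$. * Computation terms $M,N$: $V\,W$, $\mathtt{return}\,V$, $\mathtt{let}\ x=M\ \mathtt{in}\ N$, $\mathtt{op}(V)$, $\mathtt{handle}\ M\ \mathtt{with}\ H\ \mathtt{to}\ x.N$, $\mathtt{case}\ V\ \{\iota_1x\mapsto M;\ \iota_2y\mapsto N\}$. * Handlers $H$: finite sets of clauses $\mathtt{op}(x,k)\mapsto M_{\mathtt{op}}$. The typing rules for variables, functions, tuples, projections and injections are the usual ones. For the others: $\Gamma\vdash\mathtt{return}\,V:A!\Sigma$ if $\Gamma\vdash V:A$; $\mathtt{let}$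 requires $M:A!\Sigma$ and $N:B!\Sigma$ with the same $\Sigma$ and has type $B!\Sigma$; $\Gamma\vdash\mathtt{op}(V):B_{\mathtt{op}}!\Sigma$ if $(\mathtt{op}:A_{\mathtt{op}}\rightarrowtriangle B_{\mathtt{op}})\in\Sigma$ and $\Gamma\vdash V:A_{\mathtt{op}}$; $\Gamma\vdash H:\Sigma\Rightarrow C$ if $H$ has exactly one clause for each $\mathtt{op}\in\Sigma$, with $\Gamma,x:A_{\mathtt{op}},k:B_{\mathtt{op}}\to C\vdash M_{\mathtt{op}}:C$; $\Gamma\vdash\mathtt{handle}\ M\ \mathtt{with}\ H\ \mathtt{to}\ x.N:C$ if $\Gamma\vdash M:A!\Sigma$, $\Gamma\vdash H:\Sigma\Rightarrow C$ and $\Gamma,x:A\vdash N:C$; $\Gamma\vdash\mathtt{case}\ V\ \{\iota_1x\mapsto M;\iota_2y\mapsto N\}:C$ if $\Gamma\vdash V:A+B$, $\Gamma,x:A\vdash M:C$ and $\Gamma,y:B\vdash N:C$. **Equations.** The judgements $\Gamma\vdash V=W:A$, $\Gamma\vdash M=N:C$ and $\Gamma\vdash H=H':\Sigma\Rightarrow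 C$ are the least congruence on typed terms containing the $\beta$- and $\eta$-laws for functions and finite products, the laws $$\mathtt{let}\ x=\mathtt{return}\,V\ \mathtt{in}\ M=M[V/x],\qquad \mathtt{let}\ x=M\ \mathtt{in}\ \mathtt{return}\,x=M,$$ $$\mathtt{let}\ y=(\mathtt{let}\ x=M\ \mathtt{in}\ N)\ \mathtt{in}\ L=\mathtt{let}\ x=M\ \mathtt{in}\ \mathtt{let}\ y=N\ \mathtt{in}\ L,$$ $$\mathtt{handle}\ (\mathtt{return}\,V)\ \mathtt{with}\ H\ \mathtt{to}\ x.M=M[V/x],$$ $$\mathtt{handle}\ (\mathtt{let}\ x=L\ \mathtt{in}\ M)\ \mathtt{with}\ H\ \mathtt{to}\ y.N=\mathtt{handle}\ L\ \mathtt{with}\ H\ \mathtt{to}\ x.(\mathtt{handle}\ M\ \mathtt{with}\ H\ \mathtt{to}\ y.N),$$ $$\mathtt{handle}\ \mathtt{op}(V)\ \mathtt{with}\ H\ \mathtt{to}\ x.M=M_{\mathtt{op}}[V/x,\lambda x.M/k]\quad\text{for }(\mathtt{op}(x,k)\mapsto M_{\mathtt{op}})\in H,$$ and, for sums, $$\mathtt{case}\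 \iota_iV\ \{\iota_1x\mapsto M_1;\ \iota_2x\mapsto M_2\}=M_i[V/x]\quad(i=1,2),$$ $$\mathtt{case}\ V\ \{\iota_1y\mapsto M[\iota_1y/x];\ \iota_2z\mapsto M[\iota_2z/x]\}=M[V/x].$$ **Models.** A *semantic signature* $S$ in a category $\mathcal C$ is a partial function with finite domain from operation symbols to pairs of objects, written $S=\{\mathtt{op}:A_{\mathtt{op}}\rightarrowtriangle B_{\mathtt{op}}\}$. A *$\lambda_{\mathrm{eff}}$-model* consists of: a category $\mathcal C$ with chosen finite products; for each semantic signature $S$, a strong monad $T_S=(T_S,\eta,\mu,\mathrm{st})$ on $\mathcal C$ with Kleisli exponentials $Y\Rightarrow_SZ$, i.e. bijections $\mathcal C(X\times Y,T_SZ)\cong\mathcal C(X,Y\Rightarrow_SZ)$ natural in $X$, with evaluation $\mathrm{ev}:(Y\Rightarrow_SZ)\times Y\to T_SZ$; morphisms $[\![\mathtt{op}]\!]_S:A_{\mathtt{op}}\to T_SB_{\mathtt{op}}$ for $(\mathtt{op}:A_{\mathtt{op}}\rightarrowtriangle B_{\mathtt{op}})\in S$; and, for all $S,S'$ and all objects $X$,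 a morphism $$\mathbf{handle}_{S,S',X}:\mathcal H\times T_ST_{S'}X\to T_{S'}X,\qquad \mathcal H=\mathcal H_{S,S',X}=\prod_{\mathtt{op}\in S}\bigl((A_{\mathtt{op}}\times(B_{\mathtt{op}}\Rightarrow_{S'}X))\Rightarrow_{S'}X\bigr),$$ such that $\mathbf{handle}\circ(\mathrm{id}\times\eta)=\pi_2$, $\mathbf{handle}\circ(\mathrm{id}\times\mu)=\mathbf{handle}\circ(\mathrm{id}\times T_S\mathbf{handle})\circ\langle\pi_1,\mathrm{st}\rangle$ and, for each $\mathtt{op}\in S$, $\mathbf{handle}\circ(\mathrm{id}\times a_{\mathtt{op}})=\mathrm{ev}\circ(\pi_{\mathtt{op}}\times\mathrm{id})$, where $a_{\mathtt{op}}=T_S\mathrm{ev}\circ\mathrm{st}\circ\langle\pi_2,\pi_1\rangle\circ([\![\mathtt{op}]\!]_S\times\mathrm{id}):A_{\mathtt{op}}\times(B_{\mathtt{op}}\Rightarrow_{S'}X)\to T_ST_{S'}X$. A diagram $X_1\xrightarrow{\iota_1}P\xleftarrow{\iota_2}X_2$ is a *Kleisli binary coproduct* for $T$ if for all $Y$ and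 $f_i:X_i\to TY$ there is a unique $h:P\to TY$ with $h\circ\iota_i=f_i$ ($i=1,2$); it is *distributive* if moreover $Z\times X_1\to Z\times P\leftarrow Z\times X_2$ is a Kleisli binary coproduct for $T$, for every $Z$. A *$\lambda_{\mathrm{eff}}^{+}$-model* is a $\lambda_{\mathrm{eff}}$-model with, for all $X_1,X_2$, a (chosen) diagram $X_1\to X_1+X_2\leftarrow X_2$ that is a distributive Kleisli binary coproduct for every $T_S$ simultaneously. **Interpretation.** In a $\lambda_{\mathrm{eff}}^{+}$-model, $[\![A\to B!\Sigma]\!]=[\![A]\!]\Rightarrow_{[\![\Sigma]\!]}[\![B]\!]$; product types, sum types and contexts are interpreted by the chosen products, Kleisli coproducts and products; signatures are interpreted componentwise. Terms are interpreted by induction on typing as morphisms $[\![V]\!]:[\![\Gamma]\!]\to[\![A]\!]$, $[\![M]\!]:[\![\Gamma]\!]\to T_{[\![\Sigma]\!]}[\![A]\!]$ (for $M:A!\Sigma$) and $[\![H]\!]:[\![\Gamma]\!]\to\mathcal H_{[\![\Sigma]\!],[\![\Sigma']\!],[\![B]\!]}$ (for $H:\Sigma\Rightarrow B!\Sigma'$).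 The fragment without handlers and sums is interpreted as usual for fine-grain call-by-value, and $[\![\mathtt{op}(V)]\!]=[\![\mathtt{op}]\!]\circ[\![V]\!]$. Further, $[\![H]\!]$ is the tuple of the curried clauses, $[\![\mathtt{handle}\ M\ \mathtt{with}\ H\ \mathtt{to}\ x.N]\!]=\mathbf{handle}\circ\langle[\![H]\!],\,T[\![N]\!]\circ\mathrm{st}\circ\langle\mathrm{id},[\![M]\!]\rangle\rangle$ with $T=T_{[\![\Sigma]\!]}$ for $M:A!\Sigma$, $[\![\iota_iV]\!]=\iota_i\circ[\![V]\!]$, and $[\![\mathtt{case}\ V\ \{\iota_1x\mapsto M;\iota_2y\mapsto N\}]\!]=[[\![M]\!],[\![N]\!]]\circ\langle\mathrm{id},[\![V]\!]\rangle$, where $[f,g]:[\![\Gamma]\!]\times([\![A]\!]+[\![B]\!])\to T_{[\![\Sigma']\!]}[\![D]\!]$ (for $M,N:D!\Sigma'$) is the unique morphism restricting to $f$ and $g$. **Proposition.** $\lambda_{\mathrm{eff}}^{+}$ is sound and complete with respect to $\lambda_{\mathrm{eff}}^{+}$-models: 1. (Soundness) If $\Gamma\vdash V=W:A$ is derivable,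 then $[\![V]\!]=[\![W]\!]$ in every $\lambda_{\mathrm{eff}}^{+}$-model. Likewise, derivability of $\Gamma\vdash M=N:C$ or of $\Gamma\vdash H=H':\Sigma\Rightarrow C$ implies $[\![M]\!]=[\![N]\!]$ or $[\![H]\!]=[\![H']\!]$, respectively, in every $\lambda_{\mathrm{eff}}^{+}$-model. 2. (Completeness) If $\Gamma\vdash V:A$ and $\Gamma\vdash W:A$ satisfy $[\![V]\!]=[\![W]\!]$ in every (small) $\lambda_{\mathrm{eff}}^{+}$-model, then $\Gamma\vdash V=W:A$ is derivable. The same holds for pairs of computation terms of the same type, and for pairs of handlers of the same type. -/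

import Mathlib

open CategoryTheory MonoidalCategory CartesianMonoidalCategory Limits

universe w u v

namespace LambdaEff

/-! ## Signatures, types and contexts -/

/-- A signature over `α`: a partial function with finite domain from operation symbols to pairs
(argument, result) of elements of `α`.  `Sig Op (VTy Op)` is the type of syntactic signatures,
`Sig Op C` (for a category `C`) the type of semantic signatures in `C`.  Two signatures with the
same operations and the same arities are equal; there is no order on the operations. -/
structure Sig (Op : Type w) (α : Type u) where
  dom : Finset Op
  arg : {o // o ∈ dom} → α
  res : {o // o ∈ dom} → α

/-- Apply a function to all argument and result types of a signature. -/
def Sig.map {Op : Type w} {α : Type u} {β : Type v} (f : α → β) (S : Sig Op α) : Sig Op β :=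
  ⟨S.dom, fun o => f (S.arg o), fun o => f (S.res o)⟩

/-- Value types `A → B ! Σ`, `∏_{i<n} Aᵢ` and `A + B`.  In the constructor for function types the
signature `Σ` of the computation type `B ! Σ` is unbundled into its three components. -/
inductive VTy (Op : Type w) : Type w
  | arrow (A : VTy Op) (dom : Finset Op) (arg res : {o // o ∈ dom} → VTy Op) (B : VTy Op) : VTy Op
  | prod {n : ℕ} (A : Fin n → VTy Op) : VTy Op
  | sum (A B : VTy Op) : VTy Op

/-- Computation types `A ! Σ`. -/
structure CTy (Op : Type w) where
  val : VTy Op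
  sig : Sig Op (VTy Op)

/-- The function type `A → C`. -/
abbrev VTy.fn {Op : Type w} (A : VTy Op) (C : CTy Op) : VTy Op :=
  .arrow A C.sig.dom C.sig.arg C.sig.res C.val

/-- Typing contexts; `A :: Γ` is the context `Γ, x : A`. -/
abbrev Ctx (Op : Type w) := List (VTy Op)

section Calculus

variable {Op : Type w}

/-! ## Terms

Well-typed terms with de Bruijn indices: an element of `Val Γ A` is a derivation of
`Γ ⊢ V : A`, up to renaming of bound variables. -/

/-- `Var Γ A`: the variables `x` with `(x : A) ∈ Γ`. -/
inductive Var : Ctx Op → VTy Op → Type w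
  | zero {Γ : Ctx Op} {A : VTy Op} : Var (A :: Γ) A
  | succ {Γ : Ctx Op} {A B : VTy Op} : Var Γ A → Var (B :: Γ) A

mutual

/-- Value terms `Γ ⊢ V : A`. -/
inductive Val : Ctx Op → VTy Op → Type w
  | var {Γ : Ctx Op} {A : VTy Op} (x : Var Γ A) : Val Γ A
  | lam {Γ : Ctx Op} {A : VTy Op} {C : CTy Op} (M : Comp (A :: Γ) C) : Val Γ (A.fn C)
  | tuple {Γ : Ctx Op} {n : ℕ} {A : Fin n → VTy Op} (V : ∀ i, Val Γ (A i)) : Val Γ (.prod A)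
  | proj {Γ : Ctx Op} {n : ℕ} {A : Fin n → VTy Op} (i : Fin n) (V : Val Γ (.prod A)) : Val Γ (A i)
  | inl {Γ : Ctx Op} {A B : VTy Op} (V : Val Γ A) : Val Γ (.sum A B)
  | inr {Γ : Ctx Op} {A B : VTy Op} (V : Val Γ B) : Val Γ (.sum A B)

/-- Computation terms `Γ ⊢ M : C`.  In `handle M H N` (handle `M` with `H` to `x. N`), `H` gives for
each operation `op : A_op ↠ B_op` of the handled signature `Σ` a clause `op(x, k) ↦ M_op` with
`Γ, x : A_op, k : B_op → C ⊢ M_op : C`. -/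
inductive Comp : Ctx Op → CTy Op → Type w
  | app {Γ : Ctx Op} {A : VTy Op} {C : CTy Op} (V : Val Γ (A.fn C)) (W : Val Γ A) : Comp Γ C
  | ret {Γ : Ctx Op} {A : VTy Op} {S : Sig Op (VTy Op)} (V : Val Γ A) : Comp Γ ⟨A, S⟩
  | letin {Γ : Ctx Op} {A B : VTy Op} {S : Sig Op (VTy Op)} (M : Comp Γ ⟨A, S⟩)
      (N : Comp (A :: Γ) ⟨B, S⟩) : Comp Γ ⟨B, S⟩
  | op {Γ : Ctx Op} {S : Sig Op (VTy Op)} (o : {o // o ∈ S.dom}) (V : Val Γ (S.arg o)) :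
      Comp Γ ⟨S.res o, S⟩
  | handle {Γ : Ctx Op} {A : VTy Op} {S : Sig Op (VTy Op)} {C : CTy Op} (M : Comp Γ ⟨A, S⟩)
      (H : ∀ o : {o // o ∈ S.dom}, Comp ((S.res o).fn C :: S.arg o :: Γ) C)
      (N : Comp (A :: Γ) C) : Comp Γ C
  | case {Γ : Ctx Op} {A B : VTy Op} {C : CTy Op} (V : Val Γ (.sum A B))
      (M : Comp (A :: Γ) C) (N : Comp (B :: Γ) C) : Comp Γ C

end

/-- Handlers `Γ ⊢ H : Σ ⇒ C`: a finite set of clauses, one for each operation in `Σ`. -/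
abbrev Hdl (Γ : Ctx Op) (S : Sig Op (VTy Op)) (C : CTy Op) : Type w :=
  ∀ o : {o // o ∈ S.dom}, Comp ((S.res o).fn C :: S.arg o :: Γ) C

/-! ## Renaming and substitution -/

/-- Renamings of the variables in `Γ` by variables in `Δ`. -/
abbrev Ren (Γ Δ : Ctx Op) : Type w := ∀ ⦃A : VTy Op⦄, Var Γ A → Var Δ A

def Ren.lift {Γ Δ : Ctx Op} (ρ : Ren Γ Δ) (B : VTy Op) : Ren (B :: Γ) (B :: Δ)
  | _, .zero => .zero
  | _, .succ x => .succ (ρ x)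

mutual

def Val.rename : {Γ Δ : Ctx Op} → {A : VTy Op} → Ren Γ Δ → Val Γ A → Val Δ A
  | _, _, _, ρ, .var x => .var (ρ x)
  | _, _, _, ρ, .lam M => .lam (M.rename (ρ.lift _))
  | _, _, _, ρ, .tuple V => .tuple fun i => (V i).rename ρ
  | _, _, _, ρ, .proj (A := A) i V => .proj (A := A) i (V.rename ρ)
  | _, _, _, ρ, .inl V => .inl (V.rename ρ)
  | _, _, _, ρ, .inr V => .inr (V.rename ρ)

def Comp.rename : {Γ Δ : Ctx Op} → {C : CTy Op} → Ren Γ Δ → Comp Γ C → Comp Δ C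
  | _, _, _, ρ, .app V W => .app (V.rename ρ) (W.rename ρ)
  | _, _, _, ρ, .ret V => .ret (V.rename ρ)
  | _, _, _, ρ, .letin M N => .letin (M.rename ρ) (N.rename (ρ.lift _))
  | _, _, _, ρ, .op o V => .op o (V.rename ρ)
  | _, _, _, ρ, .handle M H N =>
      .handle (M.rename ρ) (fun o => (H o).rename ((ρ.lift _).lift _)) (N.rename (ρ.lift _))
  | _, _, _, ρ, .case V M N => .case (V.rename ρ) (M.rename (ρ.lift _)) (N.rename (ρ.lift _))

end

/-- Weakening of a value term from `Γ` to `Γ, x : B`. -/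
def Val.weaken {Γ : Ctx Op} {A : VTy Op} (V : Val Γ A) (B : VTy Op) : Val (B :: Γ) A :=
  V.rename fun _ x => .succ x

/-- Weakening of a handler from `Γ` to `Γ, x : B`. -/
def Hdl.weaken {Γ : Ctx Op} {S : Sig Op (VTy Op)} {C : CTy Op} (H : Hdl Γ S C) (B : VTy Op) :
    Hdl (B :: Γ) S C :=
  fun o => (H o).rename (Ren.lift (Ren.lift (fun _ x => .succ x) _) _)

/-- Weakening of a computation term from `Γ, y : A` to `Γ, x : B, y : A`. -/
def Comp.weakenUnder {Γ : Ctx Op} {A : VTy Op} {C : CTy Op} (M : Comp (A :: Γ) C) (B : VTy Op) :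
    Comp (A :: B :: Γ) C :=
  M.rename (Ren.lift (fun _ x => .succ x) A)

/-- Substitutions of value terms in context `Δ` for the variables in `Γ`. -/
abbrev Subst (Γ Δ : Ctx Op) : Type w := ∀ ⦃A : VTy Op⦄, Var Γ A → Val Δ A

def Subst.lift {Γ Δ : Ctx Op} (σ : Subst Γ Δ) (B : VTy Op) : Subst (B :: Γ) (B :: Δ)
  | _, .zero => .var .zero
  | _, .succ x => (σ x).weaken B

/-- The identity substitution. -/
def Subst.id (Γ : Ctx Op) : Subst Γ Γ := fun _ x => .var x

/-- Extend a substitution by a value term for the last variable. -/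
def Subst.cons {Γ Δ : Ctx Op} {B : VTy Op} (σ : Subst Γ Δ) (V : Val Δ B) : Subst (B :: Γ) Δ
  | _, .zero => V
  | _, .succ x => σ x

mutual

def Val.subst : {Γ Δ : Ctx Op} → {A : VTy Op} → Subst Γ Δ → Val Γ A → Val Δ A
  | _, _, _, σ, .var x => σ x
  | _, _, _, σ, .lam M => .lam (M.subst (σ.lift _))
  | _, _, _, σ, .tuple V => .tuple fun i => (V i).subst σ
  | _, _, _, σ, .proj (A := A) i V => .proj (A := A) i (V.subst σ)
  | _, _, _, σ, .inl V => .inl (V.subst σ)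
  | _, _, _, σ, .inr V => .inr (V.subst σ)

def Comp.subst : {Γ Δ : Ctx Op} → {C : CTy Op} → Subst Γ Δ → Comp Γ C → Comp Δ C
  | _, _, _, σ, .app V W => .app (V.subst σ) (W.subst σ)
  | _, _, _, σ, .ret V => .ret (V.subst σ)
  | _, _, _, σ, .letin M N => .letin (M.subst σ) (N.subst (σ.lift _))
  | _, _, _, σ, .op o V => .op o (V.subst σ)
  | _, _, _, σ, .handle M H N =>
      .handle (M.subst σ) (fun o => (H o).subst ((σ.lift _).lift _)) (N.subst (σ.lift _))
  | _, _, _, σ, .case V M N => .case (V.subst σ) (M.subst (σ.lift _)) (N.subst (σ.lift _))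

end

/-- `M[V/x]` for `Γ, x : A ⊢ M : C` and `Γ ⊢ V : A`. -/
def Comp.inst {Γ : Ctx Op} {A : VTy Op} {C : CTy Op} (M : Comp (A :: Γ) C) (V : Val Γ A) :
    Comp Γ C :=
  M.subst ((Subst.id Γ).cons V)

/-- `M[V/x, W/k]` for `Γ, x : A, k : B ⊢ M : C`, `Γ ⊢ V : A` and `Γ ⊢ W : B`. -/
def Comp.inst₂ {Γ : Ctx Op} {A B : VTy Op} {C : CTy Op} (M : Comp (B :: A :: Γ) C)
    (V : Val Γ A) (W : Val Γ B) : Comp Γ C :=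
  M.subst (((Subst.id Γ).cons V).cons W)

/-- `M[V/x]` for `Γ, x : A ⊢ M : C` and `Γ, y : B ⊢ V : A`, a term in context `Γ, y : B`. -/
def Comp.replace {Γ : Ctx Op} {A B : VTy Op} {C : CTy Op} (M : Comp (A :: Γ) C)
    (V : Val (B :: Γ) A) : Comp (B :: Γ) C :=
  M.subst (Subst.cons (fun _ x => .var (.succ x)) V)

/-! ## The equational theory -/

mutual

/-- Derivability of `Γ ⊢ V = W : A`. -/
inductive ValEq : {Γ : Ctx Op} → {A : VTy Op} → Val Γ A → Val Γ A → Prop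
  | refl {Γ : Ctx Op} {A : VTy Op} (V : Val Γ A) : ValEq V V
  | symm {Γ : Ctx Op} {A : VTy Op} {V W : Val Γ A} : ValEq V W → ValEq W V
  | trans {Γ : Ctx Op} {A : VTy Op} {U V W : Val Γ A} : ValEq U V → ValEq V W → ValEq U W
  | lam_congr {Γ : Ctx Op} {A : VTy Op} {C : CTy Op} {M M' : Comp (A :: Γ) C} :
      CompEq M M' → ValEq (.lam M) (.lam M')
  | tuple_congr {Γ : Ctx Op} {n : ℕ} {A : Fin n → VTy Op} {V V' : ∀ i, Val Γ (A i)} :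
      (∀ i, ValEq (V i) (V' i)) → ValEq (.tuple V) (.tuple V')
  | proj_congr {Γ : Ctx Op} {n : ℕ} {A : Fin n → VTy Op} (i : Fin n) {V V' : Val Γ (.prod A)} :
      ValEq V V' → ValEq (.proj i V) (.proj i V')
  | inl_congr {Γ : Ctx Op} {A B : VTy Op} {V V' : Val Γ A} :
      ValEq V V' → ValEq (.inl (B := B) V) (.inl V')
  | inr_congr {Γ : Ctx Op} {A B : VTy Op} {V V' : Val Γ B} :
      ValEq V V' → ValEq (.inr (A := A) V) (.inr V')
  | lam_eta {Γ : Ctx Op} {A : VTy Op} {C : CTy Op} (V : Val Γ (A.fn C)) :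
      ValEq V (.lam (.app (V.weaken A) (.var .zero)))
  | prod_beta {Γ : Ctx Op} {n : ℕ} {A : Fin n → VTy Op} (V : ∀ i, Val Γ (A i)) (i : Fin n) :
      ValEq (.proj i (.tuple V)) (V i)
  | prod_eta {Γ : Ctx Op} {n : ℕ} {A : Fin n → VTy Op} (V : Val Γ (.prod A)) :
      ValEq V (.tuple fun i => .proj i V)

/-- Derivability of `Γ ⊢ M = N : C`. -/
inductive CompEq : {Γ : Ctx Op} → {C : CTy Op} → Comp Γ C → Comp Γ C → Prop
  | refl {Γ : Ctx Op} {C : CTy Op} (M : Comp Γ C) : CompEq M M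
  | symm {Γ : Ctx Op} {C : CTy Op} {M N : Comp Γ C} : CompEq M N → CompEq N M
  | trans {Γ : Ctx Op} {C : CTy Op} {L M N : Comp Γ C} : CompEq L M → CompEq M N → CompEq L N
  | app_congr {Γ : Ctx Op} {A : VTy Op} {C : CTy Op} {V V' : Val Γ (A.fn C)} {W W' : Val Γ A} :
      ValEq V V' → ValEq W W' → CompEq (.app V W) (.app V' W')
  | ret_congr {Γ : Ctx Op} {A : VTy Op} {S : Sig Op (VTy Op)} {V V' : Val Γ A} :
      ValEq V V' → CompEq (.ret (S := S) V) (.ret V')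
  | letin_congr {Γ : Ctx Op} {A B : VTy Op} {S : Sig Op (VTy Op)} {M M' : Comp Γ ⟨A, S⟩}
      {N N' : Comp (A :: Γ) ⟨B, S⟩} :
      CompEq M M' → CompEq N N' → CompEq (.letin M N) (.letin M' N')
  | op_congr {Γ : Ctx Op} {S : Sig Op (VTy Op)} (o : {o // o ∈ S.dom}) {V V' : Val Γ (S.arg o)} :
      ValEq V V' → CompEq (.op o V) (.op o V')
  | handle_congr {Γ : Ctx Op} {A : VTy Op} {S : Sig Op (VTy Op)} {C : CTy Op}
      {M M' : Comp Γ ⟨A, S⟩} {H H' : Hdl Γ S C} {N N' : Comp (A :: Γ) C} :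
      CompEq M M' → HdlEq H H' → CompEq N N' → CompEq (.handle M H N) (.handle M' H' N')
  | case_congr {Γ : Ctx Op} {A B : VTy Op} {C : CTy Op} {V V' : Val Γ (.sum A B)}
      {M M' : Comp (A :: Γ) C} {N N' : Comp (B :: Γ) C} :
      ValEq V V' → CompEq M M' → CompEq N N' → CompEq (.case V M N) (.case V' M' N')
  | lam_beta {Γ : Ctx Op} {A : VTy Op} {C : CTy Op} (M : Comp (A :: Γ) C) (V : Val Γ A) :
      CompEq (.app (.lam M) V) (M.inst V)
  | ret_let {Γ : Ctx Op} {A B : VTy Op} {S : Sig Op (VTy Op)} (V : Val Γ A)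
      (M : Comp (A :: Γ) ⟨B, S⟩) : CompEq (.letin (.ret V) M) (M.inst V)
  | let_ret {Γ : Ctx Op} {A : VTy Op} {S : Sig Op (VTy Op)} (M : Comp Γ ⟨A, S⟩) :
      CompEq (.letin M (.ret (.var .zero))) M
  | let_let {Γ : Ctx Op} {A₁ A₂ A₃ : VTy Op} {S : Sig Op (VTy Op)} (M : Comp Γ ⟨A₁, S⟩)
      (N : Comp (A₁ :: Γ) ⟨A₂, S⟩) (L : Comp (A₂ :: Γ) ⟨A₃, S⟩) :
      CompEq (.letin (.letin M N) L) (.letin M (.letin N (L.weakenUnder A₁)))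
  | handle_ret {Γ : Ctx Op} {A : VTy Op} {S : Sig Op (VTy Op)} {C : CTy Op} (V : Val Γ A)
      (H : Hdl Γ S C) (M : Comp (A :: Γ) C) : CompEq (.handle (.ret V) H M) (M.inst V)
  | handle_let {Γ : Ctx Op} {A B : VTy Op} {S : Sig Op (VTy Op)} {C : CTy Op}
      (L : Comp Γ ⟨A, S⟩) (M : Comp (A :: Γ) ⟨B, S⟩) (H : Hdl Γ S C) (N : Comp (B :: Γ) C) :
      CompEq (.handle (.letin L M) H N)
        (.handle L H (.handle M (Hdl.weaken H A) (N.weakenUnder A)))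
  | handle_op {Γ : Ctx Op} {S : Sig Op (VTy Op)} {C : CTy Op} (o : {o // o ∈ S.dom})
      (V : Val Γ (S.arg o)) (H : Hdl Γ S C) (M : Comp (S.res o :: Γ) C) :
      CompEq (.handle (.op o V) H M) ((H o).inst₂ V (.lam M))
  | case_inl {Γ : Ctx Op} {A B : VTy Op} {C : CTy Op} (V : Val Γ A)
      (M : Comp (A :: Γ) C) (N : Comp (B :: Γ) C) : CompEq (.case (.inl V) M N) (M.inst V)
  | case_inr {Γ : Ctx Op} {A B : VTy Op} {C : CTy Op} (V : Val Γ B)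
      (M : Comp (A :: Γ) C) (N : Comp (B :: Γ) C) : CompEq (.case (.inr V) M N) (N.inst V)
  | case_eta {Γ : Ctx Op} {A B : VTy Op} {C : CTy Op} (V : Val Γ (.sum A B))
      (M : Comp (.sum A B :: Γ) C) :
      CompEq (.case V (M.replace (.inl (.var .zero))) (M.replace (.inr (.var .zero)))) (M.inst V)

/-- Derivability of `Γ ⊢ H = H' : Σ ⇒ C`. -/
inductive HdlEq : {Γ : Ctx Op} → {S : Sig Op (VTy Op)} → {C : CTy Op} →
    Hdl Γ S C → Hdl Γ S C → Prop
  | refl {Γ : Ctx Op} {S : Sig Op (VTy Op)} {C : CTy Op} (H : Hdl Γ S C) : HdlEq H H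
  | symm {Γ : Ctx Op} {S : Sig Op (VTy Op)} {C : CTy Op} {H H' : Hdl Γ S C} :
      HdlEq H H' → HdlEq H' H
  | trans {Γ : Ctx Op} {S : Sig Op (VTy Op)} {C : CTy Op} {H H' H'' : Hdl Γ S C} :
      HdlEq H H' → HdlEq H' H'' → HdlEq H H''
  | congr {Γ : Ctx Op} {S : Sig Op (VTy Op)} {C : CTy Op} {H H' : Hdl Γ S C} :
      (∀ o, CompEq (H o) (H' o)) → HdlEq H H'

end

end Calculus

/-! ## Models -/

section Models

/-- Strong monads on a cartesian category. -/
structure StrongMonad (C : Type u) [Category.{v} C] [CartesianMonoidalCategory C] extends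
    CategoryTheory.Monad C where
  st : ∀ X Y : C, X ⊗ obj Y ⟶ obj (X ⊗ Y)
  st_natural : ∀ {X X' Y Y' : C} (f : X ⟶ X') (g : Y ⟶ Y'),
    (f ⊗ₘ map g) ≫ st X' Y' = st X Y ≫ map (f ⊗ₘ g)
  st_leftUnitor : ∀ X : C, st (𝟙_ C) X ≫ map (λ_ X).hom = (λ_ (obj X)).hom
  st_associator : ∀ X Y Z : C,
    st (X ⊗ Y) Z ≫ map (α_ X Y Z).hom = (α_ X Y (obj Z)).hom ≫ (X ◁ st Y Z) ≫ st X (Y ⊗ Z)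
  st_unit : ∀ X Y : C, (X ◁ η.app Y) ≫ st X Y = η.app (X ⊗ Y)
  st_mult : ∀ X Y : C,
    (X ◁ μ.app Y) ≫ st X Y = st X (obj Y) ≫ map (st X Y) ≫ μ.app (X ⊗ Y)

/-- A Kleisli exponential `Y ⇒ Z` for `T`: an object representing `X ↦ C_T(J(X ⊗ Y), Z)`; the
hom-set `C_T(J(X ⊗ Y), Z)` of the Kleisli category is `C(X ⊗ Y, T Z)`. -/
structure KleisliExp {C : Type u} [Category.{v} C] [CartesianMonoidalCategory C]
    (T : StrongMonad C) (Y Z : C) where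
  pt : C
  curry : ∀ {X : C}, (X ⊗ Y ⟶ T.obj Z) ≃ (X ⟶ pt)
  curry_natural : ∀ {X X' : C} (f : X' ⟶ X) (g : X ⊗ Y ⟶ T.obj Z),
    curry ((f ▷ Y) ≫ g) = f ≫ curry g

/-- The evaluation morphism of a Kleisli exponential. -/
def KleisliExp.eval {C : Type u} [Category.{v} C] [CartesianMonoidalCategory C]
    {T : StrongMonad C} {Y Z : C} (E : KleisliExp T Y Z) : E.pt ⊗ Y ⟶ T.obj Z :=
  E.curry.symm (𝟙 E.pt)

/-- The diagram `X₁ ⟶ P ⟵ X₂` is a Kleisli binary coproduct for `T`. -/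
def IsKleisliCoprod {C : Type u} [Category.{v} C] [CartesianMonoidalCategory C]
    (T : StrongMonad C) {X₁ X₂ P : C} (i₁ : X₁ ⟶ P) (i₂ : X₂ ⟶ P) : Prop :=
  ∀ (Y : C) (f₁ : X₁ ⟶ T.obj Y) (f₂ : X₂ ⟶ T.obj Y),
    ∃! h : P ⟶ T.obj Y, i₁ ≫ h = f₁ ∧ i₂ ≫ h = f₂

/-- The diagram `X₁ ⟶ P ⟵ X₂` is a distributive Kleisli binary coproduct for `T`. -/
def IsDistribKleisliCoprod {C : Type u} [Category.{v} C] [CartesianMonoidalCategory C]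
    (T : StrongMonad C) {X₁ X₂ P : C} (i₁ : X₁ ⟶ P) (i₂ : X₂ ⟶ P) : Prop :=
  IsKleisliCoprod T i₁ i₂ ∧ ∀ Z : C, IsKleisliCoprod T (Z ◁ i₁) (Z ◁ i₂)

/-- The first layer of a model on the cartesian category `C`: a choice of finite products for
finite tuples and for families indexed by a finite set of operation symbols (the chosen terminal
object and binary products are those of `CartesianMonoidalCategory C`), strong monads `T_S` indexed
by semantic signatures, Kleisli exponentials for each `T_S`, and morphisms `A_op ⟶ T_S B_op`
for `op : A_op ↠ B_op` in `S`. -/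
structure EffFrame (Op : Type w) (C : Type u) [Category.{v} C] [CartesianMonoidalCategory C] where
  tup : ∀ {n : ℕ} (X : Fin n → C), LimitCone (Discrete.functor X)
  opProd : ∀ (d : Finset Op) (X : {o // o ∈ d} → C), LimitCone (Discrete.functor X)
  T : Sig Op C → StrongMonad C
  kexp : ∀ (S : Sig Op C) (Y Z : C), KleisliExp (T S) Y Z
  op : ∀ (S : Sig Op C) (o : {o // o ∈ S.dom}), S.arg o ⟶ (T S).obj (S.res o)

namespace EffFrame

variable {Op : Type w} {C : Type u} [Category.{v} C] [CartesianMonoidalCategory C]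
  (F : EffFrame Op C)

/-- The type of handler clauses for `op ∈ S` with values in `X ∈ C_{T_{S'}}`: the object
`(A_op × (B_op ⇒ X)) ⇒ X`, with Kleisli exponentials for `T_{S'}`. -/
def clauseObj (S S' : Sig Op C) (X : C) (o : {o // o ∈ S.dom}) : C :=
  (F.kexp S' (S.arg o ⊗ (F.kexp S' (S.res o) X).pt) X).pt

/-- The object `∏_{op ∈ S} ((A_op × (B_op ⇒ X)) ⇒ X)` of handlers, for `X ∈ C_{T_{S'}}`. -/
def hdlObj (S S' : Sig Op C) (X : C) : C := (F.opProd S.dom (F.clauseObj S S' X)).cone.pt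

/-- The projection `π_op` from the object of handlers. -/
def hdlProj (S S' : Sig Op C) (X : C) (o : {o // o ∈ S.dom}) :
    F.hdlObj S S' X ⟶ F.clauseObj S S' X o :=
  Fan.proj (F.opProd S.dom (F.clauseObj S S' X)).cone o

/-- The tupling of a family of morphisms into the object of handlers. -/
def hdlLift (S S' : Sig Op C) (X : C) {Z : C} (f : ∀ o, Z ⟶ F.clauseObj S S' X o) :
    Z ⟶ F.hdlObj S S' X :=
  Fan.IsLimit.lift (F.opProd S.dom (F.clauseObj S S' X)).isLimit f

/-- The morphism `A_op × (B_op ⇒ X) ⟶ T_S T_{S'} X` induced by `op : A_op ⟶ T_S B_op`. -/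
def mixedOp (S S' : Sig Op C) (X : C) (o : {o // o ∈ S.dom}) :
    S.arg o ⊗ (F.kexp S' (S.res o) X).pt ⟶ (F.T S).obj ((F.T S').obj X) :=
  (F.op S o ▷ _) ≫ lift (snd _ _) (fst _ _) ≫ (F.T S).st _ _ ≫
    (F.T S).map (F.kexp S' (S.res o) X).eval

end EffFrame

/-- Models of the calculus without sum types. -/
structure EffModel (Op : Type w) (C : Type u) [Category.{v} C] [CartesianMonoidalCategory C]
    extends EffFrame Op C where
  handle : ∀ (S S' : Sig Op C) (X : C),
    toEffFrame.hdlObj S S' X ⊗ (T S).obj ((T S').obj X) ⟶ (T S').obj X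
  handle_unit : ∀ (S S' : Sig Op C) (X : C),
    (toEffFrame.hdlObj S S' X ◁ (T S).η.app ((T S').obj X)) ≫ handle S S' X = snd _ _
  handle_mult : ∀ (S S' : Sig Op C) (X : C),
    (toEffFrame.hdlObj S S' X ◁ (T S).μ.app ((T S').obj X)) ≫ handle S S' X =
      lift (fst _ _) ((T S).st (toEffFrame.hdlObj S S' X) ((T S).obj ((T S').obj X))) ≫
        (toEffFrame.hdlObj S S' X ◁ (T S).map (handle S S' X)) ≫ handle S S' X
  handle_op : ∀ (S S' : Sig Op C) (X : C) (o : {o // o ∈ S.dom}),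
    (toEffFrame.hdlObj S S' X ◁ toEffFrame.mixedOp S S' X o) ≫ handle S S' X =
      (toEffFrame.hdlProj S S' X o ▷ _) ≫ (kexp S' _ X).eval

/-- Models of the calculus with sum types: models with joint distributive Kleisli binary
coproducts for all the monads `T_S`. -/
structure EffPlusModel (Op : Type w) (C : Type u) [Category.{v} C] [CartesianMonoidalCategory C]
    extends EffModel Op C where
  sum : C → C → C
  inl : ∀ X Y : C, X ⟶ sum X Y
  inr : ∀ X Y : C, Y ⟶ sum X Y
  isDistribKleisliCoprod : ∀ (S : Sig Op C) (X Y : C),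
    IsDistribKleisliCoprod (T S) (inl X Y) (inr X Y)

/-! ## Interpretation -/

namespace EffPlusModel

variable {Op : Type w} {C : Type u} [Category.{v} C] [CartesianMonoidalCategory C]
  (𝓜 : EffPlusModel Op C)

/-- The unique `h : Z × (X + Y) ⟶ T_S W` restricting to `f` on `Z × X` and to `g` on `Z × Y`. -/
noncomputable def copair (S : Sig Op C) {Z X Y W : C} (f : Z ⊗ X ⟶ (𝓜.T S).obj W)
    (g : Z ⊗ Y ⟶ (𝓜.T S).obj W) : Z ⊗ 𝓜.sum X Y ⟶ (𝓜.T S).obj W :=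
  ((𝓜.isDistribKleisliCoprod S X Y).2 Z W f g).choose

/-- Interpretation of value types. -/
def ty : VTy Op → C
  | .arrow A d a r B => (𝓜.kexp ⟨d, fun o => ty (a o), fun o => ty (r o)⟩ (ty A) (ty B)).pt
  | .prod A => (𝓜.tup fun i => ty (A i)).cone.pt
  | .sum A B => 𝓜.sum (ty A) (ty B)

/-- Interpretation of signatures. -/
def sig (S : Sig Op (VTy Op)) : Sig Op C := S.map 𝓜.ty

/-- Interpretation of computation types: `A ! Σ` is sent to `T_Σ A`. -/
def cty (D : CTy Op) : C := (𝓜.T (𝓜.sig D.sig)).obj (𝓜.ty D.val)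

/-- Interpretation of contexts. -/
def ctx : Ctx Op → C
  | [] => 𝟙_ C
  | A :: Γ => ctx Γ ⊗ 𝓜.ty A

/-- Interpretation of variables. -/
def var : {Γ : Ctx Op} → {A : VTy Op} → Var Γ A → (𝓜.ctx Γ ⟶ 𝓜.ty A)
  | _, _, .zero => snd _ _
  | _, _, .succ x => fst _ _ ≫ var x

mutual

/-- Interpretation of value terms. -/
noncomputable def val : {Γ : Ctx Op} → {A : VTy Op} → Val Γ A → (𝓜.ctx Γ ⟶ 𝓜.ty A)
  | _, _, .var x => 𝓜.var x
  | _, _, .lam (A := A) (C := D) M =>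
      (𝓜.kexp (𝓜.sig D.sig) (𝓜.ty A) (𝓜.ty D.val)).curry (comp M)
  | _, _, .tuple (A := A) V =>
      Fan.IsLimit.lift (𝓜.tup fun i => 𝓜.ty (A i)).isLimit fun i => val (V i)
  | _, _, .proj (A := A) i V => val V ≫ Fan.proj (𝓜.tup fun i => 𝓜.ty (A i)).cone i
  | _, _, .inl V => val V ≫ 𝓜.inl _ _
  | _, _, .inr V => val V ≫ 𝓜.inr _ _

/-- Interpretation of computation terms. -/
noncomputable def comp : {Γ : Ctx Op} → {D : CTy Op} → Comp Γ D → (𝓜.ctx Γ ⟶ 𝓜.cty D)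
  | _, D, .app (A := A) V W =>
      lift (val V) (val W) ≫ (𝓜.kexp (𝓜.sig D.sig) (𝓜.ty A) (𝓜.ty D.val)).eval
  | _, _, .ret (S := S) V => val V ≫ (𝓜.T (𝓜.sig S)).η.app _
  | _, _, .letin (S := S) M N =>
      lift (𝟙 _) (comp M) ≫ (𝓜.T (𝓜.sig S)).st _ _ ≫ (𝓜.T (𝓜.sig S)).map (comp N) ≫
        (𝓜.T (𝓜.sig S)).μ.app _
  | _, _, .op (S := S) o V => val V ≫ 𝓜.op (𝓜.sig S) o
  | _, D, .handle (S := S) M H N =>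
      lift
        (𝓜.hdlLift (𝓜.sig S) (𝓜.sig D.sig) (𝓜.ty D.val) fun o =>
          (𝓜.kexp (𝓜.sig D.sig) _ (𝓜.ty D.val)).curry ((α_ _ _ _).inv ≫ comp (H o)))
        (lift (𝟙 _) (comp M) ≫ (𝓜.T (𝓜.sig S)).st _ _ ≫ (𝓜.T (𝓜.sig S)).map (comp N)) ≫
      𝓜.handle (𝓜.sig S) (𝓜.sig D.sig) (𝓜.ty D.val)
  | _, D, .case V M N =>
      lift (𝟙 _) (val V) ≫ 𝓜.copair (𝓜.sig D.sig) (comp M) (comp N)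

end

/-- Interpretation of handlers: the tupling of the interpretations of the clauses. -/
noncomputable def hdl {Γ : Ctx Op} {S : Sig Op (VTy Op)} {D : CTy Op} (H : Hdl Γ S D) :
    𝓜.ctx Γ ⟶ 𝓜.hdlObj (𝓜.sig S) (𝓜.sig D.sig) (𝓜.ty D.val) :=
  𝓜.hdlLift (𝓜.sig S) (𝓜.sig D.sig) (𝓜.ty D.val) fun o =>
    (𝓜.kexp (𝓜.sig D.sig) _ (𝓜.ty D.val)).curry ((α_ _ _ _).inv ≫ 𝓜.comp (H o))

end EffPlusModel

end Models

end LambdaEff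

namespace LambdaEff

section Substitution

variable {Op : Type w}

/-! ## Renaming and substitution lemmas -/

theorem Ren.lift_comp {Γ Δ Θ : Ctx Op} (ρ : Ren Γ Δ) (ρ' : Ren Δ Θ) (B : VTy Op) :
    (fun A (x : Var (B :: Γ) A) => ρ'.lift B (ρ.lift B x)) = Ren.lift (fun _ x => ρ' (ρ x)) B := by
  funext A x; cases x <;> rfl

theorem Subst.lift_comp_ren {Γ Δ Θ : Ctx Op} (ρ : Ren Γ Δ) (σ : Subst Δ Θ) (B : VTy Op) :
    (fun A (x : Var (B :: Γ) A) => σ.lift B (ρ.lift B x)) =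
      Subst.lift (fun _ x => σ (ρ x)) B := by
  funext A x; cases x <;> rfl

theorem Subst.lift_var {Γ Δ : Ctx Op} (ρ : Ren Γ Δ) (B : VTy Op) :
    Subst.lift (fun _ x => .var (ρ x)) B = fun _ x => Val.var (ρ.lift B x) := by
  funext A x; cases x <;> simp [Subst.lift, Ren.lift, Val.weaken, Val.rename]

theorem Subst.lift_id (Γ : Ctx Op) (B : VTy Op) : (Subst.id Γ).lift B = Subst.id (B :: Γ) := by
  funext A x; cases x <;> simp [Subst.lift, Subst.id, Val.weaken, Val.rename]

mutual

theorem Val.rename_rename {Γ Δ Θ : Ctx Op} {A : VTy Op} (ρ : Ren Γ Δ) (ρ' : Ren Δ Θ) :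
    (V : Val Γ A) → (V.rename ρ).rename ρ' = V.rename fun _ x => ρ' (ρ x)
  | .var x => by simp [Val.rename]
  | .lam M => by simp [Val.rename, Comp.rename_rename _ _ M, Ren.lift_comp]
  | .tuple V => by
    simp only [Val.rename]
    congr 1; funext i; exact Val.rename_rename _ _ (V i)
  | .proj (A := _) i V => by simp [Val.rename, Val.rename_rename _ _ V]
  | .inl V => by simp [Val.rename, Val.rename_rename _ _ V]
  | .inr V => by simp [Val.rename, Val.rename_rename _ _ V]

theorem Comp.rename_rename {Γ Δ Θ : Ctx Op} {C : CTy Op} (ρ : Ren Γ Δ) (ρ' : Ren Δ Θ) :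
    (M : Comp Γ C) → (M.rename ρ).rename ρ' = M.rename fun _ x => ρ' (ρ x)
  | .app V W => by simp [Comp.rename, Val.rename_rename _ _ V, Val.rename_rename _ _ W]
  | .ret V => by simp [Comp.rename, Val.rename_rename _ _ V]
  | .letin M N => by
    simp [Comp.rename, Comp.rename_rename _ _ M, Comp.rename_rename _ _ N, Ren.lift_comp]
  | .op o V => by simp [Comp.rename, Val.rename_rename _ _ V]
  | .handle M H N => by
    simp only [Comp.rename, Comp.rename_rename _ _ M, Comp.rename_rename _ _ N, Ren.lift_comp]
    congr 1; funext o; rw [Comp.rename_rename _ _ (H o), Ren.lift_comp, Ren.lift_comp]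
  | .case V M N => by
    simp [Comp.rename, Val.rename_rename _ _ V, Comp.rename_rename _ _ M,
      Comp.rename_rename _ _ N, Ren.lift_comp]

end

theorem Subst.lift_rename {Γ Δ Θ : Ctx Op} (σ : Subst Γ Δ) (ρ : Ren Δ Θ) (B : VTy Op) :
    (fun A (x : Var (B :: Γ) A) => (σ.lift B x).rename (ρ.lift B)) =
      Subst.lift (fun _ x => (σ x).rename ρ) B := by
  funext A x
  cases x with
  | zero => simp [Subst.lift, Ren.lift, Val.rename]
  | succ x => simp [Subst.lift, Val.weaken, Val.rename_rename, Ren.lift]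

mutual

theorem Val.subst_rename {Γ Δ Θ : Ctx Op} {A : VTy Op} (ρ : Ren Γ Δ) (σ : Subst Δ Θ) :
    (V : Val Γ A) → (V.rename ρ).subst σ = V.subst fun _ x => σ (ρ x)
  | .var x => by simp [Val.rename, Val.subst]
  | .lam M => by simp [Val.rename, Val.subst, Comp.subst_rename _ _ M, Subst.lift_comp_ren]
  | .tuple V => by
    simp only [Val.rename, Val.subst]
    congr 1; funext i; exact Val.subst_rename _ _ (V i)
  | .proj (A := _) i V => by simp [Val.rename, Val.subst, Val.subst_rename _ _ V]
  | .inl V => by simp [Val.rename, Val.subst, Val.subst_rename _ _ V]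
  | .inr V => by simp [Val.rename, Val.subst, Val.subst_rename _ _ V]

theorem Comp.subst_rename {Γ Δ Θ : Ctx Op} {C : CTy Op} (ρ : Ren Γ Δ) (σ : Subst Δ Θ) :
    (M : Comp Γ C) → (M.rename ρ).subst σ = M.subst fun _ x => σ (ρ x)
  | .app V W => by
    simp [Comp.rename, Comp.subst, Val.subst_rename _ _ V, Val.subst_rename _ _ W]
  | .ret V => by simp [Comp.rename, Comp.subst, Val.subst_rename _ _ V]
  | .letin M N => by
    simp [Comp.rename, Comp.subst, Comp.subst_rename _ _ M, Comp.subst_rename _ _ N,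
      Subst.lift_comp_ren]
  | .op o V => by simp [Comp.rename, Comp.subst, Val.subst_rename _ _ V]
  | .handle M H N => by
    simp only [Comp.rename, Comp.subst, Comp.subst_rename _ _ M, Comp.subst_rename _ _ N,
      Subst.lift_comp_ren]
    congr 1; funext o
    rw [Comp.subst_rename _ _ (H o), Subst.lift_comp_ren, Subst.lift_comp_ren]
  | .case V M N => by
    simp [Comp.rename, Comp.subst, Val.subst_rename _ _ V, Comp.subst_rename _ _ M,
      Comp.subst_rename _ _ N, Subst.lift_comp_ren]

end

mutual

theorem Val.rename_subst {Γ Δ Θ : Ctx Op} {A : VTy Op} (σ : Subst Γ Δ) (ρ : Ren Δ Θ) :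
    (V : Val Γ A) → (V.subst σ).rename ρ = V.subst fun _ x => (σ x).rename ρ
  | .var x => by simp [Val.subst]
  | .lam M => by simp [Val.rename, Val.subst, Comp.rename_subst _ _ M, Subst.lift_rename]
  | .tuple V => by
    simp only [Val.rename, Val.subst]
    congr 1; funext i; exact Val.rename_subst _ _ (V i)
  | .proj (A := _) i V => by simp [Val.rename, Val.subst, Val.rename_subst _ _ V]
  | .inl V => by simp [Val.rename, Val.subst, Val.rename_subst _ _ V]
  | .inr V => by simp [Val.rename, Val.subst, Val.rename_subst _ _ V]

theorem Comp.rename_subst {Γ Δ Θ : Ctx Op} {C : CTy Op} (σ : Subst Γ Δ) (ρ : Ren Δ Θ) :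
    (M : Comp Γ C) → (M.subst σ).rename ρ = M.subst fun _ x => (σ x).rename ρ
  | .app V W => by
    simp [Comp.rename, Comp.subst, Val.rename_subst _ _ V, Val.rename_subst _ _ W]
  | .ret V => by simp [Comp.rename, Comp.subst, Val.rename_subst _ _ V]
  | .letin M N => by
    simp [Comp.rename, Comp.subst, Comp.rename_subst _ _ M, Comp.rename_subst _ _ N,
      Subst.lift_rename]
  | .op o V => by simp [Comp.rename, Comp.subst, Val.rename_subst _ _ V]
  | .handle M H N => by
    simp only [Comp.rename, Comp.subst, Comp.rename_subst _ _ M, Comp.rename_subst _ _ N,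
      Subst.lift_rename]
    congr 1; funext o
    rw [Comp.rename_subst _ _ (H o), Subst.lift_rename, Subst.lift_rename]
  | .case V M N => by
    simp [Comp.rename, Comp.subst, Val.rename_subst _ _ V, Comp.rename_subst _ _ M,
      Comp.rename_subst _ _ N, Subst.lift_rename]

end

mutual

theorem Val.rename_eq_subst {Γ Δ : Ctx Op} {A : VTy Op} (ρ : Ren Γ Δ) :
    (V : Val Γ A) → V.rename ρ = V.subst fun _ x => .var (ρ x)
  | .var x => by simp [Val.rename, Val.subst]
  | .lam M => by simp [Val.rename, Val.subst, Comp.rename_eq_subst _ M, Subst.lift_var]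
  | .tuple V => by
    simp only [Val.rename, Val.subst]
    congr 1; funext i; exact Val.rename_eq_subst _ (V i)
  | .proj (A := _) i V => by simp [Val.rename, Val.subst, Val.rename_eq_subst _ V]
  | .inl V => by simp [Val.rename, Val.subst, Val.rename_eq_subst _ V]
  | .inr V => by simp [Val.rename, Val.subst, Val.rename_eq_subst _ V]

theorem Comp.rename_eq_subst {Γ Δ : Ctx Op} {C : CTy Op} (ρ : Ren Γ Δ) :
    (M : Comp Γ C) → M.rename ρ = M.subst fun _ x => .var (ρ x)
  | .app V W => by
    simp [Comp.rename, Comp.subst, Val.rename_eq_subst _ V, Val.rename_eq_subst _ W]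
  | .ret V => by simp [Comp.rename, Comp.subst, Val.rename_eq_subst _ V]
  | .letin M N => by
    simp [Comp.rename, Comp.subst, Comp.rename_eq_subst _ M, Comp.rename_eq_subst _ N,
      Subst.lift_var]
  | .op o V => by simp [Comp.rename, Comp.subst, Val.rename_eq_subst _ V]
  | .handle M H N => by
    simp only [Comp.rename, Comp.subst, Comp.rename_eq_subst _ M, Comp.rename_eq_subst _ N,
      Subst.lift_var]
    congr 1; funext o
    rw [Comp.rename_eq_subst _ (H o)]
  | .case V M N => by
    simp [Comp.rename, Comp.subst, Val.rename_eq_subst _ V, Comp.rename_eq_subst _ M,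
      Comp.rename_eq_subst _ N, Subst.lift_var]

end

theorem Subst.lift_subst {Γ Δ Θ : Ctx Op} (σ : Subst Γ Δ) (τ : Subst Δ Θ) (B : VTy Op) :
    (fun A (x : Var (B :: Γ) A) => (σ.lift B x).subst (τ.lift B)) =
      Subst.lift (fun _ x => (σ x).subst τ) B := by
  funext A x
  cases x with
  | zero => simp [Subst.lift, Val.subst]
  | succ x => simp [Subst.lift, Val.weaken, Val.subst_rename, Val.rename_subst]

mutual

theorem Val.subst_subst {Γ Δ Θ : Ctx Op} {A : VTy Op} (σ : Subst Γ Δ) (τ : Subst Δ Θ) :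
    (V : Val Γ A) → (V.subst σ).subst τ = V.subst fun _ x => (σ x).subst τ
  | .var x => by simp [Val.subst]
  | .lam M => by simp [Val.subst, Comp.subst_subst _ _ M, Subst.lift_subst]
  | .tuple V => by
    simp only [Val.subst]
    congr 1; funext i; exact Val.subst_subst _ _ (V i)
  | .proj (A := _) i V => by simp [Val.subst, Val.subst_subst _ _ V]
  | .inl V => by simp [Val.subst, Val.subst_subst _ _ V]
  | .inr V => by simp [Val.subst, Val.subst_subst _ _ V]

theorem Comp.subst_subst {Γ Δ Θ : Ctx Op} {C : CTy Op} (σ : Subst Γ Δ) (τ : Subst Δ Θ) :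
    (M : Comp Γ C) → (M.subst σ).subst τ = M.subst fun _ x => (σ x).subst τ
  | .app V W => by simp [Comp.subst, Val.subst_subst _ _ V, Val.subst_subst _ _ W]
  | .ret V => by simp [Comp.subst, Val.subst_subst _ _ V]
  | .letin M N => by
    simp [Comp.subst, Comp.subst_subst _ _ M, Comp.subst_subst _ _ N, Subst.lift_subst]
  | .op o V => by simp [Comp.subst, Val.subst_subst _ _ V]
  | .handle M H N => by
    simp only [Comp.subst, Comp.subst_subst _ _ M, Comp.subst_subst _ _ N, Subst.lift_subst]
    congr 1; funext o
    rw [Comp.subst_subst _ _ (H o), Subst.lift_subst, Subst.lift_subst]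
  | .case V M N => by
    simp [Comp.subst, Val.subst_subst _ _ V, Comp.subst_subst _ _ M,
      Comp.subst_subst _ _ N, Subst.lift_subst]

end

mutual

theorem Val.subst_id {Γ : Ctx Op} {A : VTy Op} : (V : Val Γ A) → V.subst (Subst.id Γ) = V
  | .var x => by simp [Val.subst, Subst.id]
  | .lam M => by simp [Val.subst, Comp.subst_id M, Subst.lift_id]
  | .tuple V => by
    simp only [Val.subst]
    congr 1; funext i; exact Val.subst_id (V i)
  | .proj (A := _) i V => by simp [Val.subst, Val.subst_id V]
  | .inl V => by simp [Val.subst, Val.subst_id V]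
  | .inr V => by simp [Val.subst, Val.subst_id V]

theorem Comp.subst_id {Γ : Ctx Op} {C : CTy Op} : (M : Comp Γ C) → M.subst (Subst.id Γ) = M
  | .app V W => by simp [Comp.subst, Val.subst_id V, Val.subst_id W]
  | .ret V => by simp [Comp.subst, Val.subst_id V]
  | .letin M N => by simp [Comp.subst, Comp.subst_id M, Comp.subst_id N, Subst.lift_id]
  | .op o V => by simp [Comp.subst, Val.subst_id V]
  | .handle M H N => by
    simp only [Comp.subst, Comp.subst_id M, Comp.subst_id N, Subst.lift_id]
    congr 1; funext o; exact Comp.subst_id (H o)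
  | .case V M N => by
    simp [Comp.subst, Val.subst_id V, Comp.subst_id M, Comp.subst_id N, Subst.lift_id]

end

theorem Val.weaken_subst_cons {Γ Δ : Ctx Op} {A B : VTy Op} (V : Val Γ A) (σ : Subst Γ Δ)
    (W : Val Δ B) : (V.weaken B).subst (σ.cons W) = V.subst σ := by
  rw [Val.weaken, Val.subst_rename]; rfl

theorem Subst.lift_subst_cons {Γ Δ Θ : Ctx Op} {B : VTy Op} (σ : Subst Γ Δ) (τ : Subst Δ Θ)
    (W : Val Θ B) :
    (fun A (x : Var (B :: Γ) A) => (σ.lift B x).subst (τ.cons W)) =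
      Subst.cons (fun _ x => (σ x).subst τ) W := by
  funext A x
  cases x with
  | zero => simp [Subst.lift, Subst.cons, Val.subst]
  | succ x => simp [Subst.lift, Subst.cons, Val.weaken_subst_cons]

theorem Subst.cons_subst {Γ Δ Θ : Ctx Op} {B : VTy Op} (σ : Subst Γ Δ) (V : Val Δ B)
    (τ : Subst Δ Θ) :
    (fun A (x : Var (B :: Γ) A) => (σ.cons V x).subst τ) =
      Subst.cons (fun _ x => (σ x).subst τ) (V.subst τ) := by
  funext A x; cases x <;> rfl

theorem Comp.inst_subst {Γ Δ : Ctx Op} {A : VTy Op} {C : CTy Op} (M : Comp (A :: Γ) C)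
    (V : Val Γ A) (σ : Subst Γ Δ) :
    (M.inst V).subst σ = (M.subst (σ.lift A)).inst (V.subst σ) := by
  simp [Comp.inst, Comp.subst_subst, Subst.cons_subst, Subst.lift_subst_cons, Val.subst_id,
    Subst.id, Val.subst]

theorem Comp.inst₂_subst {Γ Δ : Ctx Op} {A B : VTy Op} {C : CTy Op} (M : Comp (B :: A :: Γ) C)
    (V : Val Γ A) (W : Val Γ B) (σ : Subst Γ Δ) :
    (M.inst₂ V W).subst σ =
      (M.subst ((σ.lift A).lift B)).inst₂ (V.subst σ) (W.subst σ) := by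
  simp only [Comp.inst₂, Comp.subst_subst, Subst.cons_subst, Subst.lift_subst_cons]
  congr 3
  funext A x
  exact (Val.subst_id (σ x)).symm

theorem Comp.weakenUnder_subst {Γ Δ : Ctx Op} {A : VTy Op} {C : CTy Op} (M : Comp (A :: Γ) C)
    (B : VTy Op) (σ : Subst Γ Δ) :
    (M.weakenUnder B).subst ((σ.lift B).lift A) = (M.subst (σ.lift A)).weakenUnder B := by
  simp only [Comp.weakenUnder, Comp.subst_rename, Comp.rename_subst, Subst.lift_comp_ren,
    Subst.lift_rename]
  rfl

theorem Hdl.weaken_subst {Γ Δ : Ctx Op} {S : Sig Op (VTy Op)} {C : CTy Op} (H : Hdl Γ S C)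
    (B : VTy Op) (σ : Subst Γ Δ) :
    (fun o => (H.weaken B o).subst (((σ.lift B).lift _).lift _)) =
      Hdl.weaken (S := S) (fun o => (H o).subst ((σ.lift _).lift _)) B := by
  funext o
  simp only [Hdl.weaken, Comp.subst_rename, Comp.rename_subst, Subst.lift_comp_ren,
    Subst.lift_rename]
  rfl

theorem Comp.replace_subst {Γ Δ : Ctx Op} {A B : VTy Op} {C : CTy Op} (M : Comp (A :: Γ) C)
    (V : Val (B :: Γ) A) (σ : Subst Γ Δ) :
    (M.replace V).subst (σ.lift B) = (M.subst (σ.lift A)).replace (V.subst (σ.lift B)) := by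
  simp only [Comp.replace, Comp.subst_subst, Subst.cons_subst, Subst.lift_subst_cons]
  congr 2
  funext A x
  simp only [Val.subst, Subst.lift, Val.weaken]
  rw [Val.rename_eq_subst]

/-! ## Substitution preserves derivable equality -/

mutual

theorem ValEq.subst {Γ Δ : Ctx Op} {A : VTy Op} {V W : Val Γ A} (σ : Subst Γ Δ) :
    ValEq V W → ValEq (V.subst σ) (W.subst σ)
  | .refl V => .refl _
  | .symm h => .symm (h.subst σ)
  | .trans h h' => .trans (h.subst σ) (h'.subst σ)
  | .lam_congr h => by simpa only [Val.subst] using .lam_congr (h.subst _)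
  | .tuple_congr h => by simpa only [Val.subst] using .tuple_congr fun i => (h i).subst σ
  | .proj_congr (A := _) i h => by simpa only [Val.subst] using .proj_congr i (h.subst σ)
  | .inl_congr h => by simpa only [Val.subst] using .inl_congr (h.subst σ)
  | .inr_congr h => by simpa only [Val.subst] using .inr_congr (h.subst σ)
  | .lam_eta V => by
    have := ValEq.lam_eta (V.subst σ)
    simpa only [Val.subst, Comp.subst, Val.weaken, Val.subst_rename, Val.rename_subst,
      Subst.lift] using this
  | .prod_beta (A := _) V i => by simpa only [Val.subst] using .prod_beta (fun i => (V i).subst σ) i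
  | .prod_eta V => by simpa only [Val.subst] using .prod_eta (V.subst σ)

theorem CompEq.subst {Γ Δ : Ctx Op} {C : CTy Op} {M N : Comp Γ C} (σ : Subst Γ Δ) :
    CompEq M N → CompEq (M.subst σ) (N.subst σ)
  | .refl M => .refl _
  | .symm h => .symm (h.subst σ)
  | .trans h h' => .trans (h.subst σ) (h'.subst σ)
  | .app_congr h h' => by simpa only [Comp.subst] using .app_congr (h.subst σ) (h'.subst σ)
  | .ret_congr h => by simpa only [Comp.subst] using .ret_congr (h.subst σ)
  | .letin_congr h h' => by simpa only [Comp.subst] using .letin_congr (h.subst σ) (h'.subst _)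
  | .op_congr o h => by simpa only [Comp.subst] using .op_congr o (h.subst σ)
  | .handle_congr h h' h'' => by
    simpa only [Comp.subst] using .handle_congr (h.subst σ) (h'.subst σ) (h''.subst _)
  | .case_congr h h' h'' => by
    simpa only [Comp.subst] using .case_congr (h.subst σ) (h'.subst _) (h''.subst _)
  | .lam_beta M V => by
    simpa only [Val.subst, Comp.subst, Comp.inst_subst] using .lam_beta (M.subst (σ.lift _)) _
  | .ret_let V M => by
    simpa only [Val.subst, Comp.subst, Comp.inst_subst] using .ret_let _ (M.subst (σ.lift _))
  | .let_ret M => by simpa only [Val.subst, Comp.subst] using .let_ret (M.subst σ)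
  | .let_let M N L => by
    simpa only [Comp.subst, Comp.weakenUnder_subst] using .let_let _ _ _
  | .handle_ret V H M => by
    simpa only [Comp.subst, Comp.inst_subst] using .handle_ret _ _ _
  | .handle_let L M H N => by
    have := CompEq.handle_let (L.subst σ) (M.subst (σ.lift _))
      (fun o => (H o).subst ((σ.lift _).lift _)) (N.subst (σ.lift _))
    rw [← Hdl.weaken_subst] at this
    simpa only [Comp.subst, Comp.weakenUnder_subst] using this
  | .handle_op o V H M => by
    simpa only [Val.subst, Comp.subst, Comp.inst₂_subst] using
      .handle_op o (V.subst σ) (fun o => (H o).subst ((σ.lift _).lift _)) (M.subst (σ.lift _))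
  | .case_inl V M N => by
    simpa only [Val.subst, Comp.subst, Comp.inst_subst] using .case_inl _ _ _
  | .case_inr V M N => by
    simpa only [Val.subst, Comp.subst, Comp.inst_subst] using .case_inr _ _ _
  | .case_eta V M => by
    simpa only [Val.subst, Comp.subst, Comp.inst_subst, Comp.replace_subst] using
      .case_eta (V.subst σ) (M.subst (σ.lift _))

theorem HdlEq.subst {Γ Δ : Ctx Op} {S : Sig Op (VTy Op)} {C : CTy Op} {H H' : Hdl Γ S C}
    (σ : Subst Γ Δ) : HdlEq H H' →
      HdlEq (fun o => (H o).subst ((σ.lift _).lift _)) (fun o => (H' o).subst ((σ.lift _).lift _))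
  | .refl H => .refl _
  | .symm h => .symm (h.subst σ)
  | .trans h h' => .trans (h.subst σ) (h'.subst σ)
  | .congr h => .congr fun o => (h o).subst _

end

end Substitution

section Quotient

variable {Op : Type w}

/-! ## Terms modulo derivable equality -/

instance Val.setoid (Γ : Ctx Op) (A : VTy Op) : Setoid (Val Γ A) where
  r := ValEq
  iseqv := ⟨.refl, .symm, .trans⟩

instance Comp.setoid (Γ : Ctx Op) (C : CTy Op) : Setoid (Comp Γ C) where
  r := CompEq
  iseqv := ⟨.refl, .symm, .trans⟩

/-- Value terms modulo derivable equality. -/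
def QVal (Γ : Ctx Op) (A : VTy Op) : Type w := Quotient (Val.setoid Γ A)

/-- Computation terms modulo derivable equality. -/
def QComp (Γ : Ctx Op) (C : CTy Op) : Type w := Quotient (Comp.setoid Γ C)

/-- The class of a value term. -/
def Val.cls {Γ : Ctx Op} {A : VTy Op} (V : Val Γ A) : QVal Γ A := Quotient.mk _ V

/-- The class of a computation term. -/
def Comp.cls {Γ : Ctx Op} {C : CTy Op} (M : Comp Γ C) : QComp Γ C := Quotient.mk _ M

/-- A representative of a class of value terms. -/
noncomputable def QVal.rep {Γ : Ctx Op} {A : VTy Op} (v : QVal Γ A) : Val Γ A := Quotient.out v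

/-- A representative of a class of computation terms. -/
noncomputable def QComp.rep {Γ : Ctx Op} {C : CTy Op} (m : QComp Γ C) : Comp Γ C := Quotient.out m

theorem Val.cls_eq {Γ : Ctx Op} {A : VTy Op} {V W : Val Γ A} : V.cls = W.cls ↔ ValEq V W :=
  Quotient.eq

theorem Comp.cls_eq {Γ : Ctx Op} {C : CTy Op} {M N : Comp Γ C} : M.cls = N.cls ↔ CompEq M N :=
  Quotient.eq

theorem QVal.cls_rep {Γ : Ctx Op} {A : VTy Op} (v : QVal Γ A) : v.rep.cls = v :=
  Quotient.out_eq v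

theorem QComp.cls_rep {Γ : Ctx Op} {C : CTy Op} (m : QComp Γ C) : m.rep.cls = m :=
  Quotient.out_eq m

theorem Val.rep_cls {Γ : Ctx Op} {A : VTy Op} (V : Val Γ A) : ValEq V.cls.rep V :=
  Val.cls_eq.1 (QVal.cls_rep _)

theorem Comp.rep_cls {Γ : Ctx Op} {C : CTy Op} (M : Comp Γ C) : CompEq M.cls.rep M :=
  Comp.cls_eq.1 (QComp.cls_rep _)

noncomputable section

namespace QVal

def var {Γ : Ctx Op} {A : VTy Op} (x : Var Γ A) : QVal Γ A := (Val.var x).cls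

def lam {Γ : Ctx Op} {A : VTy Op} {C : CTy Op} (m : QComp (A :: Γ) C) : QVal Γ (A.fn C) :=
  (Val.lam m.rep).cls

def tuple {Γ : Ctx Op} {n : ℕ} {A : Fin n → VTy Op} (v : ∀ i, QVal Γ (A i)) : QVal Γ (.prod A) :=
  (Val.tuple fun i => (v i).rep).cls

def proj {Γ : Ctx Op} {n : ℕ} {A : Fin n → VTy Op} (i : Fin n) (v : QVal Γ (.prod A)) :
    QVal Γ (A i) :=
  (Val.proj i v.rep).cls

def inl {Γ : Ctx Op} {A B : VTy Op} (v : QVal Γ A) : QVal Γ (.sum A B) := (Val.inl v.rep).cls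

def inr {Γ : Ctx Op} {A B : VTy Op} (v : QVal Γ B) : QVal Γ (.sum A B) := (Val.inr v.rep).cls

end QVal

namespace QComp

def app {Γ : Ctx Op} {A : VTy Op} {C : CTy Op} (v : QVal Γ (A.fn C)) (w : QVal Γ A) : QComp Γ C :=
  (Comp.app v.rep w.rep).cls

def ret {Γ : Ctx Op} {A : VTy Op} {S : Sig Op (VTy Op)} (v : QVal Γ A) : QComp Γ ⟨A, S⟩ :=
  (Comp.ret v.rep).cls

def letin {Γ : Ctx Op} {A B : VTy Op} {S : Sig Op (VTy Op)} (m : QComp Γ ⟨A, S⟩)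
    (n : QComp (A :: Γ) ⟨B, S⟩) : QComp Γ ⟨B, S⟩ :=
  (Comp.letin m.rep n.rep).cls

def op {Γ : Ctx Op} {S : Sig Op (VTy Op)} (o : {o // o ∈ S.dom}) (v : QVal Γ (S.arg o)) :
    QComp Γ ⟨S.res o, S⟩ :=
  (Comp.op o v.rep).cls

def handle {Γ : Ctx Op} {A : VTy Op} {S : Sig Op (VTy Op)} {C : CTy Op} (m : QComp Γ ⟨A, S⟩)
    (h : ∀ o : {o // o ∈ S.dom}, QComp ((S.res o).fn C :: S.arg o :: Γ) C)
    (n : QComp (A :: Γ) C) : QComp Γ C :=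
  (Comp.handle m.rep (fun o => (h o).rep) n.rep).cls

def case {Γ : Ctx Op} {A B : VTy Op} {C : CTy Op} (v : QVal Γ (.sum A B))
    (m : QComp (A :: Γ) C) (n : QComp (B :: Γ) C) : QComp Γ C :=
  (Comp.case v.rep m.rep n.rep).cls

end QComp

/-! ### Classes of compound terms -/

theorem Val.cls_var {Γ : Ctx Op} {A : VTy Op} (x : Var Γ A) : (Val.var x).cls = .var x := rfl

theorem Val.cls_lam {Γ : Ctx Op} {A : VTy Op} {C : CTy Op} (M : Comp (A :: Γ) C) :
    (Val.lam M).cls = .lam M.cls :=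
  Val.cls_eq.2 (.symm (.lam_congr M.rep_cls))

theorem Val.cls_tuple {Γ : Ctx Op} {n : ℕ} {A : Fin n → VTy Op} (V : ∀ i, Val Γ (A i)) :
    (Val.tuple V).cls = .tuple fun i => (V i).cls :=
  Val.cls_eq.2 (.symm (.tuple_congr fun i => (V i).rep_cls))

theorem Val.cls_proj {Γ : Ctx Op} {n : ℕ} {A : Fin n → VTy Op} (i : Fin n) (V : Val Γ (.prod A)) :
    (Val.proj i V).cls = .proj i V.cls :=
  Val.cls_eq.2 (.symm (.proj_congr i V.rep_cls))

theorem Val.cls_inl {Γ : Ctx Op} {A B : VTy Op} (V : Val Γ A) :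
    (Val.inl (B := B) V).cls = .inl V.cls :=
  Val.cls_eq.2 (.symm (.inl_congr V.rep_cls))

theorem Val.cls_inr {Γ : Ctx Op} {A B : VTy Op} (V : Val Γ B) :
    (Val.inr (A := A) V).cls = .inr V.cls :=
  Val.cls_eq.2 (.symm (.inr_congr V.rep_cls))

theorem Comp.cls_app {Γ : Ctx Op} {A : VTy Op} {C : CTy Op} (V : Val Γ (A.fn C)) (W : Val Γ A) :
    (Comp.app V W).cls = .app V.cls W.cls :=
  Comp.cls_eq.2 (.symm (.app_congr V.rep_cls W.rep_cls))

theorem Comp.cls_ret {Γ : Ctx Op} {A : VTy Op} {S : Sig Op (VTy Op)} (V : Val Γ A) :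
    (Comp.ret (S := S) V).cls = .ret V.cls :=
  Comp.cls_eq.2 (.symm (.ret_congr V.rep_cls))

theorem Comp.cls_letin {Γ : Ctx Op} {A B : VTy Op} {S : Sig Op (VTy Op)} (M : Comp Γ ⟨A, S⟩)
    (N : Comp (A :: Γ) ⟨B, S⟩) : (Comp.letin M N).cls = .letin M.cls N.cls :=
  Comp.cls_eq.2 (.symm (.letin_congr M.rep_cls N.rep_cls))

theorem Comp.cls_op {Γ : Ctx Op} {S : Sig Op (VTy Op)} (o : {o // o ∈ S.dom})
    (V : Val Γ (S.arg o)) : (Comp.op o V).cls = .op o V.cls :=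
  Comp.cls_eq.2 (.symm (.op_congr o V.rep_cls))

theorem Comp.cls_handle {Γ : Ctx Op} {A : VTy Op} {S : Sig Op (VTy Op)} {C : CTy Op}
    (M : Comp Γ ⟨A, S⟩) (H : Hdl Γ S C) (N : Comp (A :: Γ) C) :
    (Comp.handle M H N).cls = .handle M.cls (fun o => (H o).cls) N.cls :=
  Comp.cls_eq.2 (.symm (.handle_congr M.rep_cls (.congr fun o => (H o).rep_cls) N.rep_cls))

theorem Comp.cls_case {Γ : Ctx Op} {A B : VTy Op} {C : CTy Op} (V : Val Γ (.sum A B))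
    (M : Comp (A :: Γ) C) (N : Comp (B :: Γ) C) :
    (Comp.case V M N).cls = .case V.cls M.cls N.cls :=
  Comp.cls_eq.2 (.symm (.case_congr V.rep_cls M.rep_cls N.rep_cls))

/-! ### Substitution of classes -/

/-- Substitutions of classes of value terms in context `Δ` for the variables in `Γ`. -/
def QSubst (Γ Δ : Ctx Op) : Type w := ∀ A : VTy Op, Var Γ A → QVal Δ A

/-- A substitution of representatives. -/
def QSubst.rep {Γ Δ : Ctx Op} (σ : QSubst Γ Δ) : Subst Γ Δ := fun A x => (σ A x).rep

def QVal.subst {Γ Δ : Ctx Op} {A : VTy Op} (v : QVal Γ A) (σ : QSubst Γ Δ) : QVal Δ A :=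
  (v.rep.subst σ.rep).cls

def QComp.subst {Γ Δ : Ctx Op} {C : CTy Op} (m : QComp Γ C) (σ : QSubst Γ Δ) : QComp Δ C :=
  (m.rep.subst σ.rep).cls

namespace QSubst

def id (Γ : Ctx Op) : QSubst Γ Γ := fun _ x => .var x

def wk (Γ : Ctx Op) (B : VTy Op) : QSubst Γ (B :: Γ) := fun _ x => .var (.succ x)

def cons {Γ Δ : Ctx Op} {B : VTy Op} (σ : QSubst Γ Δ) (v : QVal Δ B) : QSubst (B :: Γ) Δ
  | _, .zero => v
  | _, .succ x => σ _ x

def comp {Γ Δ Θ : Ctx Op} (σ : QSubst Γ Δ) (τ : QSubst Δ Θ) : QSubst Γ Θ :=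
  fun A x => (σ A x).subst τ

def lift {Γ Δ : Ctx Op} (σ : QSubst Γ Δ) (B : VTy Op) : QSubst (B :: Γ) (B :: Δ) :=
  (σ.comp (wk Δ B)).cons (.var .zero)

end QSubst

/-- The class of a substitution. -/
def Subst.cls {Γ Δ : Ctx Op} (σ : Subst Γ Δ) : QSubst Γ Δ := fun _ x => (σ x).cls

theorem QSubst.cls_rep {Γ Δ : Ctx Op} (σ : QSubst Γ Δ) : σ.rep.cls = σ := by
  funext A x; exact QVal.cls_rep _

end

end Quotient

section

variable {Op : Type w}

theorem ValEq.rename {Γ Δ : Ctx Op} {A : VTy Op} {V W : Val Γ A} (ρ : Ren Γ Δ) (h : ValEq V W) :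
    ValEq (V.rename ρ) (W.rename ρ) := by
  rw [Val.rename_eq_subst, Val.rename_eq_subst]; exact h.subst _

theorem Subst.lift_valEq {Γ Δ : Ctx Op} {σ τ : Subst Γ Δ}
    (h : ∀ (A : VTy Op) (x : Var Γ A), ValEq (σ x) (τ x)) (B : VTy Op) :
    ∀ (A : VTy Op) (x : Var (B :: Γ) A), ValEq (σ.lift B x) (τ.lift B x)
  | _, .zero => .refl _
  | _, .succ x => (h _ x).rename _

mutual

theorem Val.subst_valEq {Γ Δ : Ctx Op} {A : VTy Op} {σ τ : Subst Γ Δ}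
    (h : ∀ (A : VTy Op) (x : Var Γ A), ValEq (σ x) (τ x)) :
    (V : Val Γ A) → ValEq (V.subst σ) (V.subst τ)
  | .var x => by simpa only [Val.subst] using h _ x
  | .lam M => by simpa only [Val.subst] using .lam_congr (M.subst_compEq (Subst.lift_valEq h _))
  | .tuple V => by simpa only [Val.subst] using .tuple_congr fun i => (V i).subst_valEq h
  | .proj (A := _) i V => by simpa only [Val.subst] using .proj_congr i (V.subst_valEq h)
  | .inl V => by simpa only [Val.subst] using .inl_congr (V.subst_valEq h)
  | .inr V => by simpa only [Val.subst] using .inr_congr (V.subst_valEq h)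

theorem Comp.subst_compEq {Γ Δ : Ctx Op} {C : CTy Op} {σ τ : Subst Γ Δ}
    (h : ∀ (A : VTy Op) (x : Var Γ A), ValEq (σ x) (τ x)) :
    (M : Comp Γ C) → CompEq (M.subst σ) (M.subst τ)
  | .app V W => by
    simpa only [Comp.subst] using .app_congr (V.subst_valEq h) (W.subst_valEq h)
  | .ret V => by simpa only [Comp.subst] using .ret_congr (V.subst_valEq h)
  | .letin M N => by
    simpa only [Comp.subst] using
      .letin_congr (M.subst_compEq h) (N.subst_compEq (Subst.lift_valEq h _))
  | .op o V => by simpa only [Comp.subst] using .op_congr o (V.subst_valEq h)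
  | .handle M H N => by
    simpa only [Comp.subst] using
      .handle_congr (M.subst_compEq h)
        (.congr fun o => (H o).subst_compEq (Subst.lift_valEq (Subst.lift_valEq h _) _))
        (N.subst_compEq (Subst.lift_valEq h _))
  | .case V M N => by
    simpa only [Comp.subst] using
      .case_congr (V.subst_valEq h) (M.subst_compEq (Subst.lift_valEq h _))
        (N.subst_compEq (Subst.lift_valEq h _))

end

theorem Val.cls_subst {Γ Δ : Ctx Op} {A : VTy Op} (V : Val Γ A) (σ : Subst Γ Δ) :
    (V.subst σ).cls = V.cls.subst σ.cls :=
  Val.cls_eq.2 (.symm (.trans (V.rep_cls.subst _) (V.subst_valEq fun _ x => (σ x).rep_cls)))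

theorem Comp.cls_subst {Γ Δ : Ctx Op} {C : CTy Op} (M : Comp Γ C) (σ : Subst Γ Δ) :
    (M.subst σ).cls = M.cls.subst σ.cls :=
  Comp.cls_eq.2 (.symm (.trans (M.rep_cls.subst _) (M.subst_compEq fun _ x => (σ x).rep_cls)))

theorem Val.cls_weaken {Γ : Ctx Op} {A : VTy Op} (V : Val Γ A) (B : VTy Op) :
    (V.weaken B).cls = V.cls.subst (.wk Γ B) := by
  rw [Val.weaken, Val.rename_eq_subst, Val.cls_subst]; rfl

theorem Subst.cls_lift {Γ Δ : Ctx Op} (σ : Subst Γ Δ) (B : VTy Op) :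
    (σ.lift B).cls = σ.cls.lift B := by
  funext A x
  cases x with
  | zero => rfl
  | succ x => exact Val.cls_weaken _ _

theorem Subst.cls_cons {Γ Δ : Ctx Op} {B : VTy Op} (σ : Subst Γ Δ) (V : Val Δ B) :
    (σ.cons V).cls = σ.cls.cons V.cls := by
  funext A x; cases x <;> rfl

theorem Subst.cls_id (Γ : Ctx Op) : (Subst.id Γ).cls = .id Γ := rfl

theorem Comp.cls_inst {Γ : Ctx Op} {A : VTy Op} {C : CTy Op} (M : Comp (A :: Γ) C) (V : Val Γ A) :
    (M.inst V).cls = M.cls.subst ((QSubst.id Γ).cons V.cls) := by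
  rw [Comp.inst, Comp.cls_subst, Subst.cls_cons, Subst.cls_id]

theorem Comp.cls_weakenUnder {Γ : Ctx Op} {A : VTy Op} {C : CTy Op} (M : Comp (A :: Γ) C)
    (B : VTy Op) : (M.weakenUnder B).cls = M.cls.subst ((QSubst.wk Γ B).lift A) := by
  rw [Comp.weakenUnder, Comp.rename_eq_subst, Comp.cls_subst, ← Subst.lift_var, Subst.cls_lift]
  rfl

theorem QVal.ind {Γ : Ctx Op} {A : VTy Op} {p : QVal Γ A → Prop} (h : ∀ V : Val Γ A, p V.cls)
    (v : QVal Γ A) : p v := v.cls_rep ▸ h v.rep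

theorem QComp.ind {Γ : Ctx Op} {C : CTy Op} {p : QComp Γ C → Prop} (h : ∀ M : Comp Γ C, p M.cls)
    (m : QComp Γ C) : p m := m.cls_rep ▸ h m.rep

theorem QVal.ind_family {ι : Type*} {Γ : ι → Ctx Op} {A : ι → VTy Op}
    {p : (∀ i, QVal (Γ i) (A i)) → Prop}
    (h : ∀ V : ∀ i, Val (Γ i) (A i), p fun i => (V i).cls) (v : ∀ i, QVal (Γ i) (A i)) : p v := by
  have := h fun i => (v i).rep
  simpa only [QVal.cls_rep] using this

theorem QComp.ind_family {ι : Type*} {Γ : ι → Ctx Op} {C : ι → CTy Op}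
    {p : (∀ i, QComp (Γ i) (C i)) → Prop}
    (h : ∀ M : ∀ i, Comp (Γ i) (C i), p fun i => (M i).cls) (m : ∀ i, QComp (Γ i) (C i)) : p m := by
  have := h fun i => (m i).rep
  simpa only [QComp.cls_rep] using this

theorem QSubst.ind {Γ Δ : Ctx Op} {p : QSubst Γ Δ → Prop} (h : ∀ σ : Subst Γ Δ, p σ.cls)
    (σ : QSubst Γ Δ) : p σ := σ.cls_rep ▸ h σ.rep

/-! ### Substitution calculus for classes -/

namespace QVal

@[simp] theorem var_subst {Γ Δ : Ctx Op} {A : VTy Op} (x : Var Γ A) (σ : QSubst Γ Δ) :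
    (var x).subst σ = σ A x := by
  induction σ using QSubst.ind with | _ σ
  rw [← Val.cls_var, ← Val.cls_subst, Val.subst]; rfl

@[simp] theorem lam_subst {Γ Δ : Ctx Op} {A : VTy Op} {C : CTy Op} (m : QComp (A :: Γ) C)
    (σ : QSubst Γ Δ) : (lam m).subst σ = lam (m.subst (σ.lift A)) := by
  induction σ using QSubst.ind with | _ σ
  induction m using QComp.ind with | _ M
  rw [← Val.cls_lam, ← Val.cls_subst, Val.subst, Val.cls_lam, Comp.cls_subst, Subst.cls_lift]

@[simp] theorem tuple_subst {Γ Δ : Ctx Op} {n : ℕ} {A : Fin n → VTy Op} (v : ∀ i, QVal Γ (A i))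
    (σ : QSubst Γ Δ) : (tuple v).subst σ = tuple fun i => (v i).subst σ := by
  induction σ using QSubst.ind with | _ σ
  induction v using QVal.ind_family with | _ V
  simp only [← Val.cls_tuple, ← Val.cls_subst, Val.subst]

@[simp] theorem proj_subst {Γ Δ : Ctx Op} {n : ℕ} {A : Fin n → VTy Op} (i : Fin n)
    (v : QVal Γ (.prod A)) (σ : QSubst Γ Δ) : (proj i v).subst σ = proj i (v.subst σ) := by
  induction σ using QSubst.ind with | _ σ
  induction v using QVal.ind with | _ V
  simp only [← Val.cls_proj, ← Val.cls_subst, Val.subst]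

@[simp] theorem inl_subst {Γ Δ : Ctx Op} {A B : VTy Op} (v : QVal Γ A) (σ : QSubst Γ Δ) :
    (inl (B := B) v).subst σ = inl (v.subst σ) := by
  induction σ using QSubst.ind with | _ σ
  induction v using QVal.ind with | _ V
  simp only [← Val.cls_inl, ← Val.cls_subst, Val.subst]

@[simp] theorem inr_subst {Γ Δ : Ctx Op} {A B : VTy Op} (v : QVal Γ B) (σ : QSubst Γ Δ) :
    (inr (A := A) v).subst σ = inr (v.subst σ) := by
  induction σ using QSubst.ind with | _ σ
  induction v using QVal.ind with | _ V
  simp only [← Val.cls_inr, ← Val.cls_subst, Val.subst]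

@[simp] theorem subst_subst {Γ Δ Θ : Ctx Op} {A : VTy Op} (v : QVal Γ A) (σ : QSubst Γ Δ)
    (τ : QSubst Δ Θ) : (v.subst σ).subst τ = v.subst (σ.comp τ) := by
  induction σ using QSubst.ind with | _ σ
  induction τ using QSubst.ind with | _ τ
  induction v using QVal.ind with | _ V
  rw [← Val.cls_subst, ← Val.cls_subst, Val.subst_subst, Val.cls_subst]
  congr 1
  funext A x
  exact Val.cls_subst _ _

@[simp] theorem subst_id {Γ : Ctx Op} {A : VTy Op} (v : QVal Γ A) : v.subst (.id Γ) = v := by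
  induction v using QVal.ind with | _ V
  rw [← Subst.cls_id, ← Val.cls_subst, Val.subst_id]

end QVal

namespace QComp

@[simp] theorem app_subst {Γ Δ : Ctx Op} {A : VTy Op} {C : CTy Op} (v : QVal Γ (A.fn C))
    (w : QVal Γ A) (σ : QSubst Γ Δ) : (app v w).subst σ = app (v.subst σ) (w.subst σ) := by
  induction σ using QSubst.ind with | _ σ
  induction v using QVal.ind with | _ V
  induction w using QVal.ind with | _ W
  simp only [← Comp.cls_app, ← Comp.cls_subst, ← Val.cls_subst, Comp.subst]

@[simp] theorem ret_subst {Γ Δ : Ctx Op} {A : VTy Op} {S : Sig Op (VTy Op)} (v : QVal Γ A)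
    (σ : QSubst Γ Δ) : (ret (S := S) v).subst σ = ret (v.subst σ) := by
  induction σ using QSubst.ind with | _ σ
  induction v using QVal.ind with | _ V
  simp only [← Comp.cls_ret, ← Comp.cls_subst, ← Val.cls_subst, Comp.subst]

@[simp] theorem letin_subst {Γ Δ : Ctx Op} {A B : VTy Op} {S : Sig Op (VTy Op)}
    (m : QComp Γ ⟨A, S⟩) (n : QComp (A :: Γ) ⟨B, S⟩) (σ : QSubst Γ Δ) :
    (letin m n).subst σ = letin (m.subst σ) (n.subst (σ.lift A)) := by
  induction σ using QSubst.ind with | _ σ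
  induction m using QComp.ind with | _ M
  induction n using QComp.ind with | _ N
  simp only [← Comp.cls_letin, ← Comp.cls_subst, ← Subst.cls_lift, Comp.subst]

@[simp] theorem op_subst {Γ Δ : Ctx Op} {S : Sig Op (VTy Op)} (o : {o // o ∈ S.dom})
    (v : QVal Γ (S.arg o)) (σ : QSubst Γ Δ) : (op o v).subst σ = op o (v.subst σ) := by
  induction σ using QSubst.ind with | _ σ
  induction v using QVal.ind with | _ V
  simp only [← Comp.cls_op, ← Comp.cls_subst, ← Val.cls_subst, Comp.subst]

@[simp] theorem handle_subst {Γ Δ : Ctx Op} {A : VTy Op} {S : Sig Op (VTy Op)} {C : CTy Op}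
    (m : QComp Γ ⟨A, S⟩)
    (h : ∀ o : {o // o ∈ S.dom}, QComp ((S.res o).fn C :: S.arg o :: Γ) C)
    (n : QComp (A :: Γ) C) (σ : QSubst Γ Δ) :
    (handle m h n).subst σ =
      handle (m.subst σ) (fun o => (h o).subst ((σ.lift _).lift _)) (n.subst (σ.lift A)) := by
  induction σ using QSubst.ind with | _ σ
  induction m using QComp.ind with | _ M
  induction n using QComp.ind with | _ N
  induction h using QComp.ind_family with | _ H
  simp only [← Subst.cls_lift, ← Comp.cls_subst, ← Comp.cls_handle, Comp.subst]

@[simp] theorem case_subst {Γ Δ : Ctx Op} {A B : VTy Op} {C : CTy Op} (v : QVal Γ (.sum A B))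
    (m : QComp (A :: Γ) C) (n : QComp (B :: Γ) C) (σ : QSubst Γ Δ) :
    (case v m n).subst σ = case (v.subst σ) (m.subst (σ.lift A)) (n.subst (σ.lift B)) := by
  induction σ using QSubst.ind with | _ σ
  induction v using QVal.ind with | _ V
  induction m using QComp.ind with | _ M
  induction n using QComp.ind with | _ N
  simp only [← Comp.cls_case, ← Comp.cls_subst, ← Val.cls_subst, ← Subst.cls_lift, Comp.subst]

@[simp] theorem subst_subst {Γ Δ Θ : Ctx Op} {C : CTy Op} (m : QComp Γ C) (σ : QSubst Γ Δ)
    (τ : QSubst Δ Θ) : (m.subst σ).subst τ = m.subst (σ.comp τ) := by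
  induction σ using QSubst.ind with | _ σ
  induction τ using QSubst.ind with | _ τ
  induction m using QComp.ind with | _ M
  rw [← Comp.cls_subst, ← Comp.cls_subst, Comp.subst_subst, Comp.cls_subst]
  congr 1
  funext A x
  exact Val.cls_subst _ _

@[simp] theorem subst_id {Γ : Ctx Op} {C : CTy Op} (m : QComp Γ C) : m.subst (.id Γ) = m := by
  induction m using QComp.ind with | _ M
  rw [← Subst.cls_id, ← Comp.cls_subst, Comp.subst_id]

end QComp

namespace QSubst

@[simp] theorem cons_zero {Γ Δ : Ctx Op} {B : VTy Op} (σ : QSubst Γ Δ) (v : QVal Δ B) :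
    σ.cons v B .zero = v := rfl

@[simp] theorem cons_succ {Γ Δ : Ctx Op} {A B : VTy Op} (σ : QSubst Γ Δ) (v : QVal Δ B)
    (x : Var Γ A) : σ.cons v A (.succ x) = σ A x := rfl

@[simp] theorem id_apply {Γ : Ctx Op} {A : VTy Op} (x : Var Γ A) : id Γ A x = .var x := rfl

@[simp] theorem wk_apply {Γ : Ctx Op} {A B : VTy Op} (x : Var Γ A) :
    wk Γ B A x = .var (.succ x) := rfl

@[simp] theorem comp_apply {Γ Δ Θ : Ctx Op} {A : VTy Op} (σ : QSubst Γ Δ) (τ : QSubst Δ Θ)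
    (x : Var Γ A) : σ.comp τ A x = (σ A x).subst τ := rfl

@[simp] theorem lift_eq {Γ Δ : Ctx Op} (σ : QSubst Γ Δ) (B : VTy Op) :
    σ.lift B = (σ.comp (wk Δ B)).cons (.var .zero) := rfl

@[simp] theorem cons_comp {Γ Δ Θ : Ctx Op} {B : VTy Op} (σ : QSubst Γ Δ) (v : QVal Δ B)
    (τ : QSubst Δ Θ) : (σ.cons v).comp τ = (σ.comp τ).cons (v.subst τ) := by
  funext A x; cases x <;> rfl

@[simp] theorem comp_id {Γ Δ : Ctx Op} (σ : QSubst Γ Δ) : σ.comp (id Δ) = σ := by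
  funext A x; simp

@[simp] theorem id_comp {Γ Δ : Ctx Op} (σ : QSubst Γ Δ) : (id Γ).comp σ = σ := by
  funext A x; simp

@[simp] theorem wk_comp_cons {Γ Δ : Ctx Op} {B : VTy Op} (σ : QSubst Γ Δ) (v : QVal Δ B) :
    (wk Γ B).comp (σ.cons v) = σ := by
  funext A x; simp

@[simp] theorem comp_assoc {Γ Δ Θ Ξ : Ctx Op} (σ : QSubst Γ Δ) (τ : QSubst Δ Θ)
    (υ : QSubst Θ Ξ) : (σ.comp τ).comp υ = σ.comp (τ.comp υ) := by
  funext A x; simp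

end QSubst

/-! ### Equational laws for classes -/

@[simp] theorem QVal.proj_tuple {Γ : Ctx Op} {n : ℕ} {A : Fin n → VTy Op} (v : ∀ i, QVal Γ (A i))
    (i : Fin n) : (QVal.tuple v).proj i = v i := by
  induction v using QVal.ind_family with | _ V
  rw [← Val.cls_tuple, ← Val.cls_proj]
  exact Val.cls_eq.2 (.prod_beta V i)

theorem QVal.tuple_proj {Γ : Ctx Op} {n : ℕ} {A : Fin n → VTy Op} (v : QVal Γ (.prod A)) :
    (QVal.tuple fun i => v.proj i) = v := by
  induction v using QVal.ind with | _ V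
  simp only [← Val.cls_tuple, ← Val.cls_proj]
  exact Val.cls_eq.2 (.symm (.prod_eta V))

theorem QVal.prod_ext {Γ : Ctx Op} {n : ℕ} {A : Fin n → VTy Op} {v w : QVal Γ (.prod A)}
    (h : ∀ i, v.proj i = w.proj i) : v = w := by
  rw [← v.tuple_proj, ← w.tuple_proj]; simp only [h]

theorem QVal.lam_eta {Γ : Ctx Op} {A : VTy Op} {C : CTy Op} (v : QVal Γ (A.fn C)) :
    QVal.lam (QComp.app (v.subst (.wk Γ A)) (.var .zero)) = v := by
  induction v using QVal.ind with | _ V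
  rw [← Val.cls_weaken, ← Val.cls_var, ← Comp.cls_app, ← Val.cls_lam]
  exact Val.cls_eq.2 (.symm (.lam_eta V))

theorem QVal.fn_ext {Γ : Ctx Op} {A : VTy Op} {C : CTy Op} {v w : QVal Γ (A.fn C)}
    (h : QComp.app (v.subst (.wk Γ A)) (.var .zero) = QComp.app (w.subst (.wk Γ A)) (.var .zero)) :
    v = w := by
  rw [← v.lam_eta, ← w.lam_eta, h]

namespace QComp

@[simp] theorem app_lam {Γ : Ctx Op} {A : VTy Op} {C : CTy Op} (m : QComp (A :: Γ) C)
    (v : QVal Γ A) : app (.lam m) v = m.subst ((QSubst.id Γ).cons v) := by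
  induction v using QVal.ind with | _ V
  induction m using QComp.ind with | _ M
  rw [← Val.cls_lam, ← Comp.cls_app, ← Comp.cls_inst]
  exact Comp.cls_eq.2 (.lam_beta _ _)

@[simp] theorem letin_ret {Γ : Ctx Op} {A B : VTy Op} {S : Sig Op (VTy Op)} (v : QVal Γ A)
    (m : QComp (A :: Γ) ⟨B, S⟩) : letin (ret v) m = m.subst ((QSubst.id Γ).cons v) := by
  induction v using QVal.ind with | _ V
  induction m using QComp.ind with | _ M
  rw [← Comp.cls_ret, ← Comp.cls_letin, ← Comp.cls_inst]
  exact Comp.cls_eq.2 (.ret_let _ _)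

@[simp] theorem letin_ret_var {Γ : Ctx Op} {A : VTy Op} {S : Sig Op (VTy Op)}
    (m : QComp Γ ⟨A, S⟩) : letin m (ret (.var .zero)) = m := by
  induction m using QComp.ind with | _ M
  rw [← Val.cls_var, ← Comp.cls_ret, ← Comp.cls_letin]
  exact Comp.cls_eq.2 (.let_ret _)

@[simp] theorem letin_letin {Γ : Ctx Op} {A₁ A₂ A₃ : VTy Op} {S : Sig Op (VTy Op)}
    (m : QComp Γ ⟨A₁, S⟩) (n : QComp (A₁ :: Γ) ⟨A₂, S⟩) (l : QComp (A₂ :: Γ) ⟨A₃, S⟩) :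
    letin (letin m n) l = letin m (letin n (l.subst ((QSubst.wk Γ A₁).lift A₂))) := by
  induction m using QComp.ind with | _ M
  induction n using QComp.ind with | _ N
  induction l using QComp.ind with | _ L
  simp only [← Comp.cls_weakenUnder, ← Comp.cls_letin]
  exact Comp.cls_eq.2 (.let_let _ _ _)

@[simp] theorem handle_ret {Γ : Ctx Op} {A : VTy Op} {S : Sig Op (VTy Op)} {C : CTy Op}
    (v : QVal Γ A) (h : ∀ o : {o // o ∈ S.dom}, QComp ((S.res o).fn C :: S.arg o :: Γ) C)
    (m : QComp (A :: Γ) C) : handle (ret v) h m = m.subst ((QSubst.id Γ).cons v) := by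
  induction v using QVal.ind with | _ V
  induction m using QComp.ind with | _ M
  induction h using QComp.ind_family with | _ H
  rw [← Comp.cls_ret, ← Comp.cls_handle, ← Comp.cls_inst]
  exact Comp.cls_eq.2 (.handle_ret _ _ _)

@[simp] theorem handle_letin {Γ : Ctx Op} {A B : VTy Op} {S : Sig Op (VTy Op)} {C : CTy Op}
    (l : QComp Γ ⟨A, S⟩) (m : QComp (A :: Γ) ⟨B, S⟩)
    (h : ∀ o : {o // o ∈ S.dom}, QComp ((S.res o).fn C :: S.arg o :: Γ) C)
    (n : QComp (B :: Γ) C) :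
    handle (letin l m) h n =
      handle l h (handle m (fun o => (h o).subst (((QSubst.wk Γ A).lift _).lift _))
        (n.subst ((QSubst.wk Γ A).lift B))) := by
  induction l using QComp.ind with | _ L
  induction m using QComp.ind with | _ M
  induction n using QComp.ind with | _ N
  induction h using QComp.ind_family with | _ H
  have this : ∀ o, (H o).cls.subst (((QSubst.wk Γ A).lift _).lift _) = (Hdl.weaken H A o).cls := by
    intro o
    rw [Hdl.weaken, Comp.rename_eq_subst, Comp.cls_subst, ← Subst.lift_var, ← Subst.lift_var,
      Subst.cls_lift, Subst.cls_lift]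
    rfl
  simp only [this, ← Comp.cls_weakenUnder, ← Comp.cls_handle, ← Comp.cls_letin]
  exact Comp.cls_eq.2 (.handle_let _ _ _ _)

@[simp] theorem handle_op {Γ : Ctx Op} {S : Sig Op (VTy Op)} {C : CTy Op} (o : {o // o ∈ S.dom})
    (v : QVal Γ (S.arg o)) (h : ∀ o : {o // o ∈ S.dom}, QComp ((S.res o).fn C :: S.arg o :: Γ) C)
    (m : QComp (S.res o :: Γ) C) :
    handle (op o v) h m = (h o).subst (((QSubst.id Γ).cons v).cons (.lam m)) := by
  induction v using QVal.ind with | _ V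
  induction m using QComp.ind with | _ M
  induction h using QComp.ind_family with | _ H
  rw [← Comp.cls_op, ← Comp.cls_handle, ← Val.cls_lam, ← Subst.cls_id, ← Subst.cls_cons,
    ← Subst.cls_cons, ← Comp.cls_subst]
  exact Comp.cls_eq.2 (.handle_op _ _ _ _)

@[simp] theorem case_inl {Γ : Ctx Op} {A B : VTy Op} {C : CTy Op} (v : QVal Γ A)
    (m : QComp (A :: Γ) C) (n : QComp (B :: Γ) C) :
    case (.inl v) m n = m.subst ((QSubst.id Γ).cons v) := by
  induction v using QVal.ind with | _ V
  induction m using QComp.ind with | _ M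
  induction n using QComp.ind with | _ N
  rw [← Val.cls_inl, ← Comp.cls_case, ← Comp.cls_inst]
  exact Comp.cls_eq.2 (.case_inl _ _ _)

@[simp] theorem case_inr {Γ : Ctx Op} {A B : VTy Op} {C : CTy Op} (v : QVal Γ B)
    (m : QComp (A :: Γ) C) (n : QComp (B :: Γ) C) :
    case (.inr v) m n = n.subst ((QSubst.id Γ).cons v) := by
  induction v using QVal.ind with | _ V
  induction m using QComp.ind with | _ M
  induction n using QComp.ind with | _ N
  rw [← Val.cls_inr, ← Comp.cls_case, ← Comp.cls_inst]
  exact Comp.cls_eq.2 (.case_inr _ _ _)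

theorem case_eta {Γ : Ctx Op} {A B : VTy Op} {C : CTy Op} (v : QVal Γ (.sum A B))
    (m : QComp (.sum A B :: Γ) C) :
    case v (m.subst ((QSubst.wk Γ A).cons (.inl (.var .zero))))
      (m.subst ((QSubst.wk Γ B).cons (.inr (.var .zero)))) =
      m.subst ((QSubst.id Γ).cons v) := by
  induction v using QVal.ind with | _ V
  induction m using QComp.ind with | _ M
  have := Comp.cls_eq.2 (CompEq.case_eta V M)
  rwa [Comp.cls_case, Comp.cls_inst, Comp.replace, Comp.replace, Comp.cls_subst, Comp.cls_subst,
    Subst.cls_cons, Subst.cls_cons, Val.cls_inl, Val.cls_inr] at this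

end QComp

end

noncomputable section

variable {Op : Type w}

/-! ## Pairs and thunks of classes of terms -/

/-- The two types of a pair. -/
def VTy.pairFam (A B : VTy Op) : Fin 2 → VTy Op
  | 0 => A
  | 1 => B

/-- The empty product type. -/
def VTy.unit : VTy Op := .prod (n := 0) Fin.elim0

/-- The binary product type. -/
def VTy.pair (A B : VTy Op) : VTy Op := .prod (A.pairFam B)

/-- The type of thunks of computations of type `A ! S`. -/
def VTy.thunk (S : Sig Op (VTy Op)) (A : VTy Op) : VTy Op := VTy.unit.fn ⟨A, S⟩

namespace QVal

def star {Γ : Ctx Op} : QVal Γ VTy.unit := tuple fun i => i.elim0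

def pair {Γ : Ctx Op} {A B : VTy Op} (v : QVal Γ A) (w : QVal Γ B) : QVal Γ (A.pair B) :=
  tuple fun | 0 => v | 1 => w

def fst {Γ : Ctx Op} {A B : VTy Op} (v : QVal Γ (A.pair B)) : QVal Γ A :=
  proj (A := A.pairFam B) 0 v

def snd {Γ : Ctx Op} {A B : VTy Op} (v : QVal Γ (A.pair B)) : QVal Γ B :=
  proj (A := A.pairFam B) 1 v

theorem eq_star {Γ : Ctx Op} (v : QVal Γ VTy.unit) : v = star := prod_ext fun i => i.elim0

@[simp] theorem star_subst {Γ Δ : Ctx Op} (σ : QSubst Γ Δ) : star.subst σ = star := eq_star _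

@[simp] theorem fst_pair {Γ : Ctx Op} {A B : VTy Op} (v : QVal Γ A) (w : QVal Γ B) :
    (pair v w).fst = v := proj_tuple (A := A.pairFam B) _ 0

@[simp] theorem snd_pair {Γ : Ctx Op} {A B : VTy Op} (v : QVal Γ A) (w : QVal Γ B) :
    (pair v w).snd = w := proj_tuple (A := A.pairFam B) _ 1

theorem pair_ext {Γ : Ctx Op} {A B : VTy Op} {v w : QVal Γ (A.pair B)} (h : v.fst = w.fst)
    (h' : v.snd = w.snd) : v = w :=
  prod_ext fun | 0 => h | 1 => h'

@[simp] theorem pair_fst_snd {Γ : Ctx Op} {A B : VTy Op} (v : QVal Γ (A.pair B)) :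
    pair v.fst v.snd = v := pair_ext (by simp) (by simp)

@[simp] theorem fst_subst {Γ Δ : Ctx Op} {A B : VTy Op} (v : QVal Γ (A.pair B)) (σ : QSubst Γ Δ) :
    v.fst.subst σ = (v.subst σ).fst := proj_subst (A := A.pairFam B) _ _ _

@[simp] theorem snd_subst {Γ Δ : Ctx Op} {A B : VTy Op} (v : QVal Γ (A.pair B)) (σ : QSubst Γ Δ) :
    v.snd.subst σ = (v.subst σ).snd := proj_subst (A := A.pairFam B) _ _ _

@[simp] theorem pair_subst {Γ Δ : Ctx Op} {A B : VTy Op} (v : QVal Γ A) (w : QVal Γ B)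
    (σ : QSubst Γ Δ) : (pair v w).subst σ = pair (v.subst σ) (w.subst σ) :=
  pair_ext (by rw [← fst_subst]; simp) (by rw [← snd_subst]; simp)

/-- Run a thunk. -/
def force {Γ : Ctx Op} {S : Sig Op (VTy Op)} {A : VTy Op} (v : QVal Γ (A.thunk S)) :
    QComp Γ ⟨A, S⟩ := QComp.app v star

end QVal

/-- The thunk of a computation. -/
def QComp.thunk {Γ : Ctx Op} {S : Sig Op (VTy Op)} {A : VTy Op} (m : QComp Γ ⟨A, S⟩) :
    QVal Γ (A.thunk S) := QVal.lam (m.subst (.wk Γ _))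

namespace QVal

@[simp] theorem force_thunk {Γ : Ctx Op} {S : Sig Op (VTy Op)} {A : VTy Op} (m : QComp Γ ⟨A, S⟩) :
    m.thunk.force = m := by
  simp [force, QComp.thunk]

@[simp] theorem thunk_force {Γ : Ctx Op} {S : Sig Op (VTy Op)} {A : VTy Op}
    (v : QVal Γ (A.thunk S)) : v.force.thunk = v := by
  refine .trans (congrArg QVal.lam ?_) (QVal.lam_eta v)
  refine (QComp.app_subst _ _ _).trans ?_
  rw [star_subst, eq_star (var .zero)]

theorem force_ext {Γ : Ctx Op} {S : Sig Op (VTy Op)} {A : VTy Op} {v w : QVal Γ (A.thunk S)}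
    (h : v.force = w.force) : v = w := by
  rw [← v.thunk_force, ← w.thunk_force, h]

@[simp] theorem force_subst {Γ Δ : Ctx Op} {S : Sig Op (VTy Op)} {A : VTy Op}
    (v : QVal Γ (A.thunk S)) (σ : QSubst Γ Δ) : v.force.subst σ = (v.subst σ).force :=
  (QComp.app_subst _ _ _).trans (by rw [star_subst]; rfl)

@[simp] theorem thunk_subst {Γ Δ : Ctx Op} {S : Sig Op (VTy Op)} {A : VTy Op}
    (m : QComp Γ ⟨A, S⟩) (σ : QSubst Γ Δ) : m.thunk.subst σ = (m.subst σ).thunk :=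
  force_ext (by rw [← force_subst]; simp)

end QVal

/-! ## The category of types and terms -/

/-- Morphisms of the term model: maps from classes of values of type `A` to classes of values of
type `B`, in every context, compatible with substitution. -/
@[ext]
structure TermHom (A B : VTy Op) : Type w where
  app : ∀ {Γ : Ctx Op}, QVal Γ A → QVal Γ B
  natural : ∀ {Γ Δ : Ctx Op} (v : QVal Γ A) (σ : QSubst Γ Δ), (app v).subst σ = app (v.subst σ)

attribute [simp] TermHom.natural

instance : Category.{w} (VTy Op) where
  Hom := TermHom
  id A := ⟨fun v => v, fun _ _ => rfl⟩
  comp f g := ⟨fun v => g.app (f.app v), by simp⟩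

namespace TermHom

/-- The action of a morphism of the term model. -/
def ap {A B : VTy Op} (f : A ⟶ B) {Γ : Ctx Op} (v : QVal Γ A) : QVal Γ B :=
  TermHom.app f v

theorem hom_ext {A B : VTy Op} {f g : A ⟶ B}
    (h : ∀ (Γ : Ctx Op) (v : QVal Γ A), ap f v = ap g v) : f = g :=
  TermHom.ext (funext fun Γ => funext fun v => h Γ v)

/-- A morphism of the term model from a natural family of maps. -/
def of {A B : VTy Op} (f : ∀ Γ : Ctx Op, QVal Γ A → QVal Γ B)
    (h : ∀ {Γ Δ : Ctx Op} (v : QVal Γ A) (σ : QSubst Γ Δ), (f Γ v).subst σ = f Δ (v.subst σ)) :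
    A ⟶ B :=
  (⟨fun {Γ} => f Γ, h⟩ : TermHom A B)

@[simp] theorem ap_subst {A B : VTy Op} (f : A ⟶ B) {Γ Δ : Ctx Op} (v : QVal Γ A)
    (σ : QSubst Γ Δ) : (ap f v).subst σ = ap f (v.subst σ) := TermHom.natural f v σ

@[simp] theorem ap_id (A : VTy Op) {Γ : Ctx Op} (v : QVal Γ A) : ap (𝟙 A) v = v := rfl

@[simp] theorem ap_comp {A B C : VTy Op} (f : A ⟶ B) (g : B ⟶ C) {Γ : Ctx Op} (v : QVal Γ A) :
    ap (f ≫ g) v = ap g (ap f v) := rfl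

/-- The pairing of two morphisms. -/
def pair {Z A B : VTy Op} (f : Z ⟶ A) (g : Z ⟶ B) : Z ⟶ A.pair B :=
  of (fun _ v => (ap f v).pair (ap g v)) (by simp)

/-- The first projection. -/
def fst (A B : VTy Op) : A.pair B ⟶ A := of (fun _ v => v.fst) (by simp)

/-- The second projection. -/
def snd (A B : VTy Op) : A.pair B ⟶ B := of (fun _ v => v.snd) (by simp)

@[simp] theorem ap_pair {Z A B : VTy Op} (f : Z ⟶ A) (g : Z ⟶ B) {Γ : Ctx Op} (v : QVal Γ Z) :
    ap (pair f g) v = (ap f v).pair (ap g v) := rfl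

@[simp] theorem ap_fst {A B : VTy Op} {Γ : Ctx Op} (v : QVal Γ (A.pair B)) :
    ap (fst A B) v = v.fst := rfl

@[simp] theorem ap_snd {A B : VTy Op} {Γ : Ctx Op} (v : QVal Γ (A.pair B)) :
    ap (snd A B) v = v.snd := rfl

end TermHom

open TermHom in
instance : MonoidalCategoryStruct (VTy Op) where
  tensorObj := VTy.pair
  tensorUnit := VTy.unit
  whiskerLeft A _ _ f := pair (fst _ _) (snd A _ ≫ f)
  whiskerRight f B := pair (fst _ B ≫ f) (snd _ _)
  tensorHom f g := pair (fst _ _ ≫ f) (snd _ _ ≫ g)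
  associator A B C :=
    { hom := pair (fst _ _ ≫ fst _ _) (pair (fst _ _ ≫ snd _ _) (snd _ _))
      inv := pair (pair (fst _ _) (snd _ _ ≫ fst _ _)) (snd _ _ ≫ snd _ _)
      hom_inv_id := hom_ext fun _ _ => by simp
      inv_hom_id := hom_ext fun _ _ => by simp }
  leftUnitor A :=
    { hom := snd _ _
      inv := pair (of (fun _ _ => .star) (by simp)) (𝟙 A)
      hom_inv_id := hom_ext fun _ v => QVal.pair_ext (QVal.eq_star _ |>.trans (QVal.eq_star _).symm)
        (by simp)
      inv_hom_id := hom_ext fun _ _ => by simp }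
  rightUnitor A :=
    { hom := fst _ _
      inv := pair (𝟙 A) (of (fun _ _ => .star) (by simp))
      hom_inv_id := hom_ext fun _ v => QVal.pair_ext (by simp)
        (QVal.eq_star _ |>.trans (QVal.eq_star _).symm)
      inv_hom_id := hom_ext fun _ _ => by simp }

namespace TermHom

theorem tensorObj_eq (A B : VTy Op) : A ⊗ B = A.pair B := rfl

theorem whiskerLeft_eq (A : VTy Op) {B C : VTy Op} (f : B ⟶ C) :
    A ◁ f = pair (fst _ _) (snd A _ ≫ f) := rfl

theorem whiskerRight_eq {A B : VTy Op} (f : A ⟶ B) (C : VTy Op) :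
    f ▷ C = pair (fst _ C ≫ f) (snd _ _) := rfl

theorem tensorHom_eq {A A' B B' : VTy Op} (f : A ⟶ A') (g : B ⟶ B') :
    (f ⊗ₘ g) = pair (fst _ _ ≫ f) (snd _ _ ≫ g) := rfl

theorem associator_hom_eq (A B C : VTy Op) : (α_ A B C).hom =
    pair (fst _ _ ≫ fst _ _) (pair (fst _ _ ≫ snd _ _) (snd _ _)) := rfl

theorem leftUnitor_hom_eq (A : VTy Op) : (λ_ A).hom = snd _ _ := rfl

theorem rightUnitor_hom_eq (A : VTy Op) : (ρ_ A).hom = fst _ _ := rfl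

end TermHom

open TermHom in
instance : MonoidalCategory (VTy Op) where
  tensorHom_def f g := hom_ext fun _ _ => by
    simp [tensorHom_eq, whiskerLeft_eq, whiskerRight_eq, tensorObj_eq]
  id_tensorHom_id A B := hom_ext fun _ v => QVal.pair_fst_snd v
  tensorHom_comp_tensorHom f₁ f₂ g₁ g₂ := hom_ext fun _ v => by
    simp [tensorHom_eq]
  whiskerLeft_id A B := hom_ext fun _ v => QVal.pair_fst_snd v
  id_whiskerRight A B := hom_ext fun _ v => QVal.pair_fst_snd v
  associator_naturality f₁ f₂ f₃ := hom_ext fun _ v => by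
    simp [tensorHom_eq, associator_hom_eq]
  leftUnitor_naturality f := hom_ext fun _ v => by simp [whiskerLeft_eq, leftUnitor_hom_eq]
  rightUnitor_naturality f := hom_ext fun _ v => by simp [whiskerRight_eq, rightUnitor_hom_eq]
  pentagon A B C D := hom_ext fun _ v => by
    simp [whiskerLeft_eq, whiskerRight_eq, associator_hom_eq]
  triangle A B := hom_ext fun _ v => by
    simp [whiskerLeft_eq, whiskerRight_eq, associator_hom_eq, leftUnitor_hom_eq, rightUnitor_hom_eq]

end

noncomputable section

variable {Op : Type w}

namespace TermHom

/-- The empty product type is terminal. -/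
def isTerminalUnit : IsTerminal (𝟙_ (VTy Op)) :=
  IsTerminal.ofUniqueHom (fun _ => of (fun _ _ => .star) (by simp))
    fun _ _ => hom_ext fun _ _ => QVal.eq_star _

end TermHom

open TermHom in
instance : CartesianMonoidalCategory (VTy Op) where
  isTerminalTensorUnit := isTerminalUnit
  fst := TermHom.fst
  snd := TermHom.snd
  tensorProductIsBinaryProduct _ _ := BinaryFan.IsLimit.mk _ (fun f g => TermHom.pair f g)
    (fun f g => hom_ext fun _ v => QVal.fst_pair (ap f v) (ap g v))
    (fun f g => hom_ext fun _ v => QVal.snd_pair (ap f v) (ap g v))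
    (fun f g _ h h' => hom_ext fun _ v => QVal.pair_ext
      ((congrArg (ap · v) h).trans (QVal.fst_pair (ap f v) (ap g v)).symm)
      ((congrArg (ap · v) h').trans (QVal.snd_pair (ap f v) (ap g v)).symm))
  fst_def _ _ := hom_ext fun _ v => (QVal.fst_pair v.fst _).symm
  snd_def _ _ := hom_ext fun _ v => (QVal.snd_pair _ v.snd).symm

namespace TermHom

theorem lift_eq {Z A B : VTy Op} (f : Z ⟶ A) (g : Z ⟶ B) : lift f g = pair f g := by
  apply CartesianMonoidalCategory.hom_ext
  · rw [lift_fst]; exact hom_ext fun _ v => (QVal.fst_pair (ap f v) (ap g v)).symm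
  · rw [lift_snd]; exact hom_ext fun _ v => (QVal.snd_pair (ap f v) (ap g v)).symm

/-! ### The strong monads of the term model -/

/-- The action of `T_S` on morphisms. -/
def thunkMap (S : Sig Op (VTy Op)) {A B : VTy Op} (f : A ⟶ B) : A.thunk S ⟶ B.thunk S :=
  of (fun _ v => (v.force.letin (.ret (ap f (.var .zero)))).thunk) (by simp)

@[simp] theorem ap_thunkMap (S : Sig Op (VTy Op)) {A B : VTy Op} (f : A ⟶ B) {Γ : Ctx Op}
    (v : QVal Γ (A.thunk S)) : ap (thunkMap S f) v =
      (v.force.letin (.ret (ap f (.var .zero)))).thunk := rfl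

/-- The unit of `T_S`. -/
def thunkUnit (S : Sig Op (VTy Op)) (A : VTy Op) : A ⟶ A.thunk S :=
  of (fun _ v => (QComp.ret v).thunk) (by simp)

@[simp] theorem ap_thunkUnit (S : Sig Op (VTy Op)) {A : VTy Op} {Γ : Ctx Op}
    (v : QVal Γ A) : ap (thunkUnit S A) v = (QComp.ret v).thunk := rfl

/-- The multiplication of `T_S`. -/
def thunkMult (S : Sig Op (VTy Op)) (A : VTy Op) : (A.thunk S).thunk S ⟶ A.thunk S :=
  of (fun _ v => (v.force.letin (QVal.var .zero).force).thunk) (by simp)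

@[simp] theorem ap_thunkMult (S : Sig Op (VTy Op)) {A : VTy Op} {Γ : Ctx Op}
    (v : QVal Γ ((A.thunk S).thunk S)) :
    ap (thunkMult S A) v = (v.force.letin (QVal.var .zero).force).thunk := rfl

/-- The strength of `T_S`. -/
def thunkStrength (S : Sig Op (VTy Op)) (A B : VTy Op) :
    A.pair (B.thunk S) ⟶ (A.pair B).thunk S :=
  of (fun Γ v => (v.snd.force.letin (.ret ((v.fst.subst (.wk Γ B)).pair (.var .zero)))).thunk)
    (by simp)

@[simp] theorem ap_thunkStrength (S : Sig Op (VTy Op)) {A B : VTy Op} {Γ : Ctx Op}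
    (v : QVal Γ (A.pair (B.thunk S))) : ap (thunkStrength S A B) v =
      (v.snd.force.letin (.ret ((v.fst.subst (.wk Γ B)).pair (.var .zero)))).thunk := rfl

theorem thunkMap_id (S : Sig Op (VTy Op)) (A : VTy Op) : thunkMap S (𝟙 A) = 𝟙 (A.thunk S) :=
  hom_ext fun _ v => QVal.force_ext (by simp)

theorem thunkMap_comp (S : Sig Op (VTy Op)) {A B C : VTy Op} (f : A ⟶ B) (g : B ⟶ C) :
    thunkMap S (f ≫ g) = thunkMap S f ≫ thunkMap S g :=
  hom_ext fun _ v => QVal.force_ext (by simp)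

theorem thunkUnit_natural (S : Sig Op (VTy Op)) {A B : VTy Op} (f : A ⟶ B) :
    f ≫ thunkUnit S B = thunkUnit S A ≫ thunkMap S f :=
  hom_ext fun _ v => QVal.force_ext (by simp)

theorem thunkMult_natural (S : Sig Op (VTy Op)) {A B : VTy Op} (f : A ⟶ B) :
    thunkMap S (thunkMap S f) ≫ thunkMult S B = thunkMult S A ≫ thunkMap S f :=
  hom_ext fun _ v => QVal.force_ext (by simp)

theorem thunkMult_assoc (S : Sig Op (VTy Op)) (A : VTy Op) :
    thunkMap S (thunkMult S A) ≫ thunkMult S A = thunkMult S (A.thunk S) ≫ thunkMult S A :=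
  hom_ext fun _ v => QVal.force_ext (by simp)

theorem thunkUnit_thunkMult (S : Sig Op (VTy Op)) (A : VTy Op) :
    thunkUnit S (A.thunk S) ≫ thunkMult S A = 𝟙 (A.thunk S) :=
  hom_ext fun _ v => QVal.force_ext (by simp)

theorem thunkMap_thunkUnit_thunkMult (S : Sig Op (VTy Op)) (A : VTy Op) :
    thunkMap S (thunkUnit S A) ≫ thunkMult S A = 𝟙 (A.thunk S) :=
  hom_ext fun _ v => QVal.force_ext (by simp)

theorem thunkStrength_natural (S : Sig Op (VTy Op)) {A A' B B' : VTy Op} (f : A ⟶ A')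
    (g : B ⟶ B') : pair (fst _ _ ≫ f) (snd _ _ ≫ thunkMap S g) ≫ thunkStrength S A' B' =
      thunkStrength S A B ≫ thunkMap S (pair (fst _ _ ≫ f) (snd _ _ ≫ g)) :=
  hom_ext fun _ v => QVal.force_ext (by simp)

theorem thunkStrength_snd (S : Sig Op (VTy Op)) (A B : VTy Op) :
    thunkStrength S A B ≫ thunkMap S (snd A B) = snd _ _ :=
  hom_ext fun _ v => QVal.force_ext (by simp)

theorem thunkStrength_assoc (S : Sig Op (VTy Op)) (A B C : VTy Op) :
    thunkStrength S (A.pair B) C ≫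
      thunkMap S (pair (fst _ _ ≫ fst _ _) (pair (fst _ _ ≫ snd _ _) (snd _ _))) =
    pair (fst _ _ ≫ fst _ _) (pair (fst _ _ ≫ snd _ _) (snd _ _)) ≫
      pair (fst _ _) (snd _ _ ≫ thunkStrength S B C) ≫ thunkStrength S A (B.pair C) :=
  hom_ext fun _ v => QVal.force_ext (by simp)

theorem thunkStrength_unit (S : Sig Op (VTy Op)) (A B : VTy Op) :
    pair (fst _ _) (snd A B ≫ thunkUnit S B) ≫ thunkStrength S A B = thunkUnit S (A.pair B) :=
  hom_ext fun _ v => QVal.force_ext (by simp)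

theorem thunkStrength_mult (S : Sig Op (VTy Op)) (A B : VTy Op) :
    pair (fst _ _) (snd A _ ≫ thunkMult S B) ≫ thunkStrength S A B =
      thunkStrength S A (B.thunk S) ≫ thunkMap S (thunkStrength S A B) ≫
        thunkMult S (A.pair B) :=
  hom_ext fun _ v => QVal.force_ext (by simp)

/-- The strong monad `T_S`. -/
def strongMonad (S : Sig Op (VTy Op)) : StrongMonad (VTy Op) where
  obj A := A.thunk S
  map := thunkMap S
  map_id := thunkMap_id S
  map_comp := thunkMap_comp S
  η := { app := thunkUnit S, naturality := fun _ _ => thunkUnit_natural S }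
  μ := { app := thunkMult S, naturality := fun _ _ => thunkMult_natural S }
  assoc := thunkMult_assoc S
  left_unit := thunkUnit_thunkMult S
  right_unit := thunkMap_thunkUnit_thunkMult S
  st := thunkStrength S
  st_natural := thunkStrength_natural S
  st_leftUnitor := thunkStrength_snd S _
  st_associator := thunkStrength_assoc S
  st_unit := thunkStrength_unit S
  st_mult := thunkStrength_mult S

end TermHom

end

noncomputable section

variable {Op : Type w}

/-! ### Products of families indexed by operation symbols -/

/-- The product of a family of types indexed by a finite set. -/
def VTy.opProd (d : Finset Op) (X : {o // o ∈ d} → VTy Op) : VTy Op :=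
  .prod fun i => X (d.equivFin.symm i)

namespace QVal

variable {d : Finset Op} {X : {o // o ∈ d} → VTy Op} {Γ : Ctx Op}

def opTuple (v : ∀ o, QVal Γ (X o)) : QVal Γ (VTy.opProd d X) :=
  tuple fun i => v (d.equivFin.symm i)

def opProj (o : {o // o ∈ d}) (v : QVal Γ (VTy.opProd d X)) : QVal Γ (X o) :=
  d.equivFin.symm_apply_apply o ▸ proj (A := fun i => X (d.equivFin.symm i)) (d.equivFin o) v

theorem opProj_eq {o : {o // o ∈ d}} {i : Fin d.card} (h : d.equivFin.symm i = o)
    (v : QVal Γ (VTy.opProd d X)) :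
    opProj o v = h ▸ proj (A := fun i => X (d.equivFin.symm i)) i v := by
  obtain rfl : i = d.equivFin o := by rw [← h, Equiv.apply_symm_apply]
  rfl

@[simp] theorem opProj_opTuple (v : ∀ o, QVal Γ (X o)) (o : {o // o ∈ d}) :
    opProj o (opTuple v) = v o := by
  obtain ⟨i, rfl⟩ := d.equivFin.symm.surjective o
  rw [opProj_eq rfl]
  exact proj_tuple (A := fun i => X (d.equivFin.symm i)) _ i

theorem opProd_ext {v w : QVal Γ (VTy.opProd d X)} (h : ∀ o, opProj o v = opProj o w) : v = w :=
  prod_ext fun i => by simpa only [opProj_eq rfl] using h (d.equivFin.symm i)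

@[simp] theorem opProj_subst {Δ : Ctx Op} (o : {o // o ∈ d}) (v : QVal Γ (VTy.opProd d X))
    (σ : QSubst Γ Δ) : (opProj o v).subst σ = opProj o (v.subst σ) := by
  obtain ⟨i, rfl⟩ := d.equivFin.symm.surjective o
  rw [opProj_eq rfl, opProj_eq rfl]
  exact proj_subst (A := fun i => X (d.equivFin.symm i)) _ _ _

@[simp] theorem opTuple_subst {Δ : Ctx Op} (v : ∀ o, QVal Γ (X o)) (σ : QSubst Γ Δ) :
    (opTuple v).subst σ = opTuple fun o => (v o).subst σ :=
  opProd_ext fun o => by rw [← opProj_subst]; simp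

end QVal

namespace TermHom

/-- Product projections of the term model. -/
def proj {n : ℕ} (X : Fin n → VTy Op) (i : Fin n) : VTy.prod X ⟶ X i :=
  of (fun _ v => v.proj i) (by simp)

/-- Tuples of morphisms of the term model. -/
def tuple {n : ℕ} {X : Fin n → VTy Op} {Z : VTy Op} (f : ∀ i, Z ⟶ X i) : Z ⟶ VTy.prod X :=
  of (fun _ v => .tuple fun i => ap (f i) v) (by simp)

/-- Product projections of the term model, for families indexed by operation symbols. -/
def opProj {d : Finset Op} (X : {o // o ∈ d} → VTy Op) (o : {o // o ∈ d}) :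
    VTy.opProd d X ⟶ X o :=
  of (fun _ v => v.opProj o) (by simp)

@[simp] theorem ap_opProj {d : Finset Op} (X : {o // o ∈ d} → VTy Op) (o : {o // o ∈ d})
    {Γ : Ctx Op} (v : QVal Γ (VTy.opProd d X)) : ap (opProj X o) v = v.opProj o := rfl

/-- Tuples of morphisms of the term model, for families indexed by operation symbols. -/
def opTuple {d : Finset Op} {X : {o // o ∈ d} → VTy Op} {Z : VTy Op} (f : ∀ o, Z ⟶ X o) :
    Z ⟶ VTy.opProd d X :=
  of (fun _ v => .opTuple fun o => ap (f o) v) (by simp)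

@[simp] theorem ap_opTuple {d : Finset Op} {X : {o // o ∈ d} → VTy Op} {Z : VTy Op}
    (f : ∀ o, Z ⟶ X o) {Γ : Ctx Op} (v : QVal Γ Z) :
    ap (opTuple f) v = .opTuple fun o => ap (f o) v := rfl

/-- The limit cone of a finite tuple of types. -/
def tupleCone {n : ℕ} (X : Fin n → VTy Op) : LimitCone (Discrete.functor X) where
  cone := Fan.mk (VTy.prod X) (proj X)
  isLimit := Fan.IsLimit.mk _ (fun s => tuple s.proj)
    (fun s i => hom_ext fun _ v => QVal.proj_tuple (fun i => ap (s.proj i) v) i)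
    (fun s _ h => hom_ext fun _ v => QVal.prod_ext fun i =>
      (congrArg (ap · v) (h i)).trans (QVal.proj_tuple (fun i => ap (s.proj i) v) i).symm)

/-- The limit cone of a family of types indexed by operation symbols. -/
def opTupleCone (d : Finset Op) (X : {o // o ∈ d} → VTy Op) :
    LimitCone (Discrete.functor X) where
  cone := Fan.mk (VTy.opProd d X) (opProj X)
  isLimit := Fan.IsLimit.mk _ (fun s => opTuple s.proj)
    (fun s o => hom_ext fun _ v => QVal.opProj_opTuple (fun o => ap (s.proj o) v) o)
    (fun s _ h => hom_ext fun _ v => QVal.opProd_ext fun o =>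
      (congrArg (ap · v) (h o)).trans (QVal.opProj_opTuple (fun o => ap (s.proj o) v) o).symm)

/-! ### Kleisli exponentials of the term model -/

/-- Currying for the Kleisli exponentials of the term model. -/
def curry (S : Sig Op (VTy Op)) {X Y Z : VTy Op} (g : X.pair Y ⟶ Z.thunk S) : X ⟶ Y.fn ⟨Z, S⟩ :=
  of (fun Γ v => .lam (ap g ((v.subst (.wk Γ Y)).pair (.var .zero))).force) (by simp)

/-- Uncurrying for the Kleisli exponentials of the term model. -/
def uncurry (S : Sig Op (VTy Op)) {X Y Z : VTy Op} (h : X ⟶ Y.fn ⟨Z, S⟩) :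
    X.pair Y ⟶ Z.thunk S :=
  of (fun _ v => (QComp.app (ap h v.fst) v.snd).thunk) (by simp)

@[simp] theorem ap_curry (S : Sig Op (VTy Op)) {X Y Z : VTy Op} (g : X.pair Y ⟶ Z.thunk S)
    {Γ : Ctx Op} (v : QVal Γ X) : ap (curry S g) v =
      .lam (ap g ((v.subst (.wk Γ Y)).pair (.var .zero))).force := rfl

@[simp] theorem ap_uncurry (S : Sig Op (VTy Op)) {X Y Z : VTy Op} (h : X ⟶ Y.fn ⟨Z, S⟩)
    {Γ : Ctx Op} (v : QVal Γ (X.pair Y)) : ap (uncurry S h) v =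
      (QComp.app (ap h v.fst) v.snd).thunk := rfl

theorem uncurry_curry (S : Sig Op (VTy Op)) {X Y Z : VTy Op} (g : X.pair Y ⟶ Z.thunk S) :
    uncurry S (curry S g) = g :=
  hom_ext fun _ v => QVal.force_ext (by simp)

theorem curry_uncurry (S : Sig Op (VTy Op)) {X Y Z : VTy Op} (h : X ⟶ Y.fn ⟨Z, S⟩) :
    curry S (uncurry S h) = h :=
  hom_ext fun _ v => QVal.fn_ext (by simp)

theorem curry_natural (S : Sig Op (VTy Op)) {X X' Y Z : VTy Op} (f : X' ⟶ X)
    (g : X.pair Y ⟶ Z.thunk S) : curry S (pair (fst _ _ ≫ f) (snd _ _) ≫ g) = f ≫ curry S g :=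
  hom_ext fun _ v => QVal.fn_ext (by simp)

/-- The Kleisli exponentials of the term model. -/
def kleisliExp (S : Sig Op (VTy Op)) (Y Z : VTy Op) : KleisliExp (strongMonad S) Y Z where
  pt := Y.fn ⟨Z, S⟩
  curry := ⟨curry S, uncurry S, uncurry_curry S, curry_uncurry S⟩
  curry_natural := curry_natural S

/-! ### Operations and handlers of the term model -/

/-- The operations of the term model. -/
def op (S : Sig Op (VTy Op)) (o : {o // o ∈ S.dom}) : S.arg o ⟶ (S.res o).thunk S :=
  of (fun _ v => (QComp.op o v).thunk) (by simp)

@[simp] theorem ap_op (S : Sig Op (VTy Op)) (o : {o // o ∈ S.dom}) {Γ : Ctx Op}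
    (v : QVal Γ (S.arg o)) : ap (op S o) v = (QComp.op o v).thunk := rfl

/-- The underlying frame of the term model. -/
def frame (Op : Type w) : EffFrame Op (VTy Op) where
  tup := tupleCone
  opProd := opTupleCone
  T := strongMonad
  kexp := kleisliExp
  op := op

/-- The type of handler clauses. -/
abbrev clauseTy (S S' : Sig Op (VTy Op)) (X : VTy Op) (o : {o // o ∈ S.dom}) : VTy Op :=
  ((S.arg o).pair ((S.res o).fn ⟨X, S'⟩)).fn ⟨X, S'⟩

/-- The type of handlers. -/
abbrev hdlTy (S S' : Sig Op (VTy Op)) (X : VTy Op) : VTy Op :=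
  VTy.opProd S.dom (clauseTy S S' X)

/-- The clauses of a handler, as computations. -/
def clauses {S S' : Sig Op (VTy Op)} {X : VTy Op} {Γ : Ctx Op} (h : QVal Γ (hdlTy S S' X)) :
    ∀ o : {o // o ∈ S.dom}, QComp ((S.res o).fn ⟨X, S'⟩ :: S.arg o :: Γ) ⟨X, S'⟩ :=
  fun o => .app (.opProj o (h.subst ((QSubst.wk _ _).comp (.wk _ _))))
    ((QVal.var (.succ .zero)).pair (.var .zero))

@[simp] theorem clauses_subst {S S' : Sig Op (VTy Op)} {X : VTy Op} {Γ Δ : Ctx Op}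
    (h : QVal Γ (hdlTy S S' X)) (σ : QSubst Γ Δ) (o : {o // o ∈ S.dom}) :
    (clauses h o).subst (((σ.comp ((QSubst.wk Δ (S.arg o)).comp
      (.wk _ ((S.res o).fn ⟨X, S'⟩)))).cons (.var (.succ .zero))).cons (.var .zero)) =
      clauses (h.subst σ) o := by
  simp [clauses]

/-- The handling morphism of the term model. -/
def handle (S S' : Sig Op (VTy Op)) (X : VTy Op) :
    (hdlTy S S' X).pair ((X.thunk S').thunk S) ⟶ X.thunk S' :=
  of (fun _ v => (QComp.handle v.snd.force (clauses v.fst) (QVal.var .zero).force).thunk)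
    (by simp)

@[simp] theorem ap_handle (S S' : Sig Op (VTy Op)) (X : VTy Op) {Γ : Ctx Op}
    (v : QVal Γ ((hdlTy S S' X).pair ((X.thunk S').thunk S))) : ap (handle S S' X) v =
      (QComp.handle v.snd.force (clauses v.fst) (QVal.var .zero).force).thunk := rfl

theorem handle_unit (S S' : Sig Op (VTy Op)) (X : VTy Op) :
    pair (fst _ _) (snd (hdlTy S S' X) _ ≫ thunkUnit S (X.thunk S')) ≫ handle S S' X =
      snd _ _ :=
  hom_ext fun _ v => QVal.force_ext (by simp)

theorem handle_mult (S S' : Sig Op (VTy Op)) (X : VTy Op) :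
    pair (fst _ _) (snd (hdlTy S S' X) _ ≫ thunkMult S (X.thunk S')) ≫ handle S S' X =
      pair (fst _ _) (thunkStrength S (hdlTy S S' X) ((X.thunk S').thunk S)) ≫
        pair (fst _ _) (snd (hdlTy S S' X) _ ≫ thunkMap S (handle S S' X)) ≫ handle S S' X :=
  hom_ext fun _ v => QVal.force_ext (by simp [clauses])

theorem handle_op (S S' : Sig Op (VTy Op)) (X : VTy Op) (o : {o // o ∈ S.dom}) :
    pair (fst _ _) (snd (hdlTy S S' X) _ ≫
      pair (fst _ _ ≫ op S o) (snd _ _) ≫ pair (snd _ _) (fst _ _) ≫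
        thunkStrength S ((S.res o).fn ⟨X, S'⟩) (S.res o) ≫ thunkMap S (uncurry S' (𝟙 _))) ≫
      handle S S' X =
    pair (fst _ _ ≫ opProj (clauseTy S S' X) o) (snd _ _) ≫ uncurry S' (𝟙 _) :=
  hom_ext fun _ v => QVal.force_ext (by
    have := QVal.lam_eta v.snd.snd
    simp only [QVal.snd_subst] at this
    simp [clauses, this])

theorem frame_mixedOp (S S' : Sig Op (VTy Op)) (X : VTy Op) (o : {o // o ∈ S.dom}) :
    (frame Op).mixedOp S S' X o =
      pair (fst _ _ ≫ op S o) (snd _ _) ≫ pair (snd _ _) (fst _ _) ≫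
        thunkStrength S ((S.res o).fn ⟨X, S'⟩) (S.res o) ≫ thunkMap S (uncurry S' (𝟙 _)) := by
  rw [EffFrame.mixedOp, lift_eq]
  rfl

/-- The term model without sums. -/
def model (Op : Type w) : EffModel Op (VTy Op) where
  toEffFrame := frame Op
  handle := handle
  handle_unit := handle_unit
  handle_mult S S' X := by
    rw [lift_eq]; exact handle_mult S S' X
  handle_op S S' X o := by
    rw [frame_mixedOp]; exact handle_op S S' X o

/-! ### Sums of the term model -/

/-- The first injection. -/
def inl (A B : VTy Op) : A ⟶ A.sum B := of (fun _ v => v.inl) (by simp)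

/-- The second injection. -/
def inr (A B : VTy Op) : B ⟶ A.sum B := of (fun _ v => v.inr) (by simp)

@[simp] theorem ap_inl {A B : VTy Op} {Γ : Ctx Op} (v : QVal Γ A) : ap (inl A B) v = v.inl := rfl

@[simp] theorem ap_inr {A B : VTy Op} {Γ : Ctx Op} (v : QVal Γ B) : ap (inr A B) v = v.inr := rfl

/-- Case distinction in the presence of a parameter. -/
def copair (S : Sig Op (VTy Op)) {Z A B D : VTy Op} (f : Z.pair A ⟶ D.thunk S)
    (g : Z.pair B ⟶ D.thunk S) : Z.pair (A.sum B) ⟶ D.thunk S :=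
  of (fun Γ v => (QComp.case v.snd
    (ap f ((v.fst.subst (.wk Γ A)).pair (.var .zero))).force
    (ap g ((v.fst.subst (.wk Γ B)).pair (.var .zero))).force).thunk) (by simp)

@[simp] theorem ap_copair (S : Sig Op (VTy Op)) {Z A B D : VTy Op} (f : Z.pair A ⟶ D.thunk S)
    (g : Z.pair B ⟶ D.thunk S) {Γ : Ctx Op} (v : QVal Γ (Z.pair (A.sum B))) :
    ap (copair S f g) v = (QComp.case v.snd
      (ap f ((v.fst.subst (.wk Γ A)).pair (.var .zero))).force
      (ap g ((v.fst.subst (.wk Γ B)).pair (.var .zero))).force).thunk := rfl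

theorem inl_copair (S : Sig Op (VTy Op)) {Z A B D : VTy Op} (f : Z.pair A ⟶ D.thunk S)
    (g : Z.pair B ⟶ D.thunk S) : pair (fst _ _) (snd Z A ≫ inl A B) ≫ copair S f g = f :=
  hom_ext fun _ v => QVal.force_ext (by simp)

theorem inr_copair (S : Sig Op (VTy Op)) {Z A B D : VTy Op} (f : Z.pair A ⟶ D.thunk S)
    (g : Z.pair B ⟶ D.thunk S) : pair (fst _ _) (snd Z B ≫ inr A B) ≫ copair S f g = g :=
  hom_ext fun _ v => QVal.force_ext (by simp)

theorem copair_unique (S : Sig Op (VTy Op)) {Z A B D : VTy Op}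
    (h : Z.pair (A.sum B) ⟶ D.thunk S) :
    h = copair S (pair (fst _ _) (snd Z A ≫ inl A B) ≫ h) (pair (fst _ _) (snd Z B ≫ inr A B) ≫ h) :=
  hom_ext fun Γ v => QVal.force_ext (by
    have := QComp.case_eta v.snd
      (ap h ((v.fst.subst (.wk Γ (A.sum B))).pair (.var .zero))).force
    simp at this
    simp [this])

theorem existsUnique_copair (S : Sig Op (VTy Op)) {A B D : VTy Op} (f : A ⟶ D.thunk S)
    (g : B ⟶ D.thunk S) : ∃! h : A.sum B ⟶ D.thunk S, inl A B ≫ h = f ∧ inr A B ≫ h = g := by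
  have hf := congrArg (pair (of (fun _ _ => .star) (by simp)) (𝟙 A) ≫ ·)
    (inl_copair S (snd VTy.unit A ≫ f) (snd VTy.unit B ≫ g))
  have hg := congrArg (pair (of (fun _ _ => .star) (by simp)) (𝟙 B) ≫ ·)
    (inr_copair S (snd VTy.unit A ≫ f) (snd VTy.unit B ≫ g))
  refine ⟨pair (of (fun _ _ => .star) (by simp)) (𝟙 _) ≫
    copair S (snd VTy.unit A ≫ f) (snd VTy.unit B ≫ g), ⟨?_, ?_⟩, ?_⟩
  · exact hom_ext fun _ v => QVal.force_ext (by simp)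
  · exact hom_ext fun _ v => QVal.force_ext (by simp)
  · rintro h ⟨rfl, rfl⟩
    have := congrArg (pair (of (fun _ _ => .star) (by simp)) (𝟙 _) ≫ ·)
      (copair_unique S (snd VTy.unit _ ≫ h))
    refine .trans ?_ (this.trans ?_)
    · exact hom_ext fun _ v => QVal.force_ext (by simp)
    · exact hom_ext fun _ v => QVal.force_ext (by simp)

/-- The term model. -/
def plusModel (Op : Type w) : EffPlusModel Op (VTy Op) where
  toEffModel := model Op
  sum := VTy.sum
  inl := inl
  inr := inr
  isDistribKleisliCoprod S A B := by
    refine ⟨fun D f g => existsUnique_copair S f g, fun Z D f g =>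
      ⟨copair S f g, ⟨inl_copair S f g, inr_copair S f g⟩, ?_⟩⟩
    rintro h ⟨rfl, rfl⟩
    exact copair_unique S h

theorem plusModel_copair (S : Sig Op (VTy Op)) {Z A B D : VTy Op} (f : Z.pair A ⟶ D.thunk S)
    (g : Z.pair B ⟶ D.thunk S) : (plusModel Op).copair S f g = copair S f g := by
  have h := (((plusModel Op).isDistribKleisliCoprod S A B).2 Z D f g).choose_spec.1
  refine (copair_unique S _).trans ?_
  exact congrArg₂ (copair S) h.1 h.2

end TermHom

end

noncomputable section

variable {Op : Type w}

/-! ## Interpretation in the term model -/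

namespace TermHom

/-- The interpretation of types in the term model. -/
abbrev ty (A : VTy Op) : VTy Op := (plusModel Op).ty A

/-- The interpretation of computation types in the term model, as a computation type. -/
abbrev cty (C : CTy Op) : CTy Op := ⟨ty C.val, C.sig.map ty⟩

theorem ty_eq : ∀ A : VTy Op, ty A = A
  | .arrow A d a r B => by
    change VTy.arrow (ty A) d (fun o => ty (a o)) (fun o => ty (r o)) (ty B) = _
    simp only [ty_eq A, ty_eq B, fun o => ty_eq (a o), fun o => ty_eq (r o)]
  | .prod A => by
    change VTy.prod (fun i => ty (A i)) = _
    simp only [fun i => ty_eq (A i)]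
  | .sum A B => by
    change VTy.sum (ty A) (ty B) = _
    simp only [ty_eq A, ty_eq B]

theorem sig_map_ty (S : Sig Op (VTy Op)) : S.map ty = S := by
  simp only [Sig.map, ty_eq]

theorem cty_eq (C : CTy Op) : cty C = C := by
  simp only [cty, ty_eq, sig_map_ty]

theorem ctx_map_ty (Γ : Ctx Op) : Γ.map ty = Γ := by
  rw [funext ty_eq]; exact List.map_id Γ

/-- The variable over interpreted types. -/
def trVar : {Γ : Ctx Op} → {A : VTy Op} → Var Γ A → Var (Γ.map ty) (ty A)
  | _, _, .zero => .zero
  | _, _, .succ x => .succ (trVar x)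

mutual

/-- The value term over interpreted types. -/
def trVal : {Γ : Ctx Op} → {A : VTy Op} → Val Γ A → Val (Γ.map ty) (ty A)
  | _, _, .var x => .var (trVar x)
  | _, _, .lam (A := A) (C := C) M => (Val.lam (A := ty A) (C := cty C) (trComp M))
  | _, _, .tuple (A := A) V => (Val.tuple (A := fun i => ty (A i)) fun i => trVal (V i))
  | _, _, .proj (A := A) i V => (Val.proj (A := fun i => ty (A i)) i (trVal V))
  | _, _, .inl (A := A) (B := B) V => Val.inl (A := ty A) (B := ty B) (trVal V)
  | _, _, .inr (A := A) (B := B) V => Val.inr (A := ty A) (B := ty B) (trVal V)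

/-- The computation term over interpreted types. -/
def trComp : {Γ : Ctx Op} → {C : CTy Op} → Comp Γ C → Comp (Γ.map ty) (cty C)
  | _, _, .app (A := A) (C := C) V W => .app (A := ty A) (C := cty C) (trVal V) (trVal W)
  | _, _, .ret (S := S) V => .ret (S := S.map ty) (trVal V)
  | _, _, .letin (A := A) (B := B) (S := S) M N =>
      .letin (A := ty A) (B := ty B) (S := S.map ty) (trComp M) (trComp N)
  | _, _, .op (S := S) o V => .op (S := S.map ty) o (trVal V)
  | _, _, .handle (S := S) (C := C) M H N =>
      .handle (S := S.map ty) (C := cty C) (trComp M) (fun o => trComp (H o)) (trComp N)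
  | _, _, .case (A := A) (B := B) V M N =>
      .case (A := ty A) (B := ty B) (trVal V) (trComp M) (trComp N)

end

/-- The components of a tuple representing the values of a context. -/
def substOf : {Γ Δ : Ctx Op} → QVal Δ ((plusModel Op).ctx Γ) → QSubst (Γ.map ty) Δ
  | [], _, _ => fun _ x => nomatch x
  | _ :: _, _, v => (substOf (QVal.fst v)).cons (QVal.snd v)

theorem substOf_surjective : ∀ {Γ Δ : Ctx Op} (σ : QSubst (Γ.map ty) Δ),
    ∃ v : QVal Δ ((plusModel Op).ctx Γ), substOf v = σ
  | [], _, σ => ⟨QVal.star, funext fun _ => funext fun x => nomatch x⟩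
  | A :: Γ, Δ, σ => by
    obtain ⟨v, hv⟩ := substOf_surjective (Γ := Γ) (fun B x => σ B (.succ x))
    refine ⟨QVal.pair v (σ (ty A) .zero), ?_⟩
    funext B x
    cases x with
    | zero => exact QVal.snd_pair _ _
    | succ x =>
      refine .trans ?_ (congrFun (congrFun hv B) x)
      exact congrArg (fun u => substOf u B x) (QVal.fst_pair _ _)

theorem substOf_pair {Γ Δ : Ctx Op} {A : VTy Op} (v : QVal Δ ((plusModel Op).ctx Γ))
    (w : QVal Δ (ty A)) :
    substOf (Γ := A :: Γ) (QVal.pair v w) = (substOf v).cons w := by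
  simp only [substOf, QVal.fst_pair, QVal.snd_pair]

theorem substOf_subst : ∀ {Γ Δ Θ : Ctx Op} (v : QVal Δ ((plusModel Op).ctx Γ)) (σ : QSubst Δ Θ),
    substOf (v.subst σ) = (substOf v).comp σ
  | [], _, _, _, _ => funext fun _ => funext fun x => nomatch x
  | A :: Γ, _, _, v, σ => by
    simp only [substOf, QSubst.cons_comp]
    rw [← substOf_subst (Γ := Γ)]
    congr 1
    · congr 1; exact (QVal.fst_subst _ _).symm
    · exact (QVal.snd_subst _ _).symm

end TermHom

end

noncomputable section

variable {Op : Type w}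

namespace TermHom

theorem ap_var : ∀ {Γ : Ctx Op} {A : VTy Op} (x : Var Γ A) {Δ : Ctx Op}
    (v : QVal Δ ((plusModel Op).ctx Γ)),
    ap ((plusModel Op).var x) v = substOf v (ty A) (trVar x)
  | _, _, .zero, _, _ => rfl
  | _, _, .succ x, _, v => ap_var x (QVal.fst v)

/-- The value of a computation of the term model. -/
def run {Γ : Ctx Op} {D : CTy Op} (f : (plusModel Op).ctx Γ ⟶ (plusModel Op).cty D) {Δ : Ctx Op}
    (v : QVal Δ ((plusModel Op).ctx Γ)) : QComp Δ (cty D) :=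
  QVal.force (S := D.sig.map ty) (A := ty D.val) (ap f v)

theorem substOf_lift {Γ Δ : Ctx Op} {A : VTy Op} (v : QVal Δ ((plusModel Op).ctx Γ)) :
    substOf (Γ := A :: Γ) (QVal.pair (v.subst (.wk Δ (ty A))) (.var .zero)) =
      (substOf v).lift (ty A) := by
  rw [substOf_pair, substOf_subst]; rfl

theorem substOf_lift_lift {Γ Δ : Ctx Op} {A B : VTy Op} (v : QVal Δ ((plusModel Op).ctx Γ)) :
    substOf (Γ := B :: A :: Γ) (QVal.pair (QVal.pair (v.subst ((QSubst.wk Δ (ty A)).comp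
      (.wk _ (ty B)))) (.var (.succ .zero))) (.var .zero)) =
      ((substOf v).lift (ty A)).lift (ty B) := by
  refine (substOf_pair _ _).trans ?_
  refine (congrArg (QSubst.cons · _) (substOf_pair _ _)).trans ?_
  rw [substOf_subst]
  simp

theorem force_app {S : Sig Op (VTy Op)} {X Y Z : VTy Op} (f : X ⟶ Y.fn ⟨Z, S⟩) (g : X ⟶ Y)
    {Γ : Ctx Op} (v : QVal Γ X) :
    (ap (pair f g ≫ uncurry S (𝟙 (Y.fn ⟨Z, S⟩))) v).force = .app (ap f v) (ap g v) := by
  simp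

theorem force_letin {S : Sig Op (VTy Op)} {X A B : VTy Op} (f : X ⟶ A.thunk S)
    (g : X.pair A ⟶ B.thunk S) {Γ : Ctx Op} (v : QVal Γ X) :
    (ap (pair (𝟙 X) f ≫ thunkStrength S X A ≫ thunkMap S g ≫ thunkMult S B) v).force =
      .letin (ap f v).force (ap g (QVal.pair (v.subst (.wk Γ A)) (.var .zero))).force := by
  simp

theorem force_handle {S S' : Sig Op (VTy Op)} {X A B : VTy Op} (f : X ⟶ A.thunk S)
    (h : ∀ o : {o // o ∈ S.dom}, (X.pair (S.arg o)).pair ((S.res o).fn ⟨B, S'⟩) ⟶ B.thunk S')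
    (g : X.pair A ⟶ B.thunk S') {Γ : Ctx Op} (v : QVal Γ X) :
    (ap (pair (opTuple (X := clauseTy S S' B) fun o => curry S'
          (pair (pair (fst _ _) (snd _ _ ≫ fst _ _)) (snd _ _ ≫ snd _ _) ≫ h o))
        (pair (𝟙 X) f ≫ thunkStrength S X A ≫ thunkMap S g) ≫ handle S S' B) v).force =
      .handle (ap f v).force
        (fun o => (ap (h o) (QVal.pair (QVal.pair (v.subst ((QSubst.wk Γ (S.arg o)).comp
          (.wk _ ((S.res o).fn ⟨B, S'⟩)))) (.var (.succ .zero))) (.var .zero))).force)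
        (ap g (QVal.pair (v.subst (.wk Γ A)) (.var .zero))).force := by
  simp
  congr 1
  funext o
  simp [clauses]

theorem force_case {S : Sig Op (VTy Op)} {X A B D : VTy Op} (f : X ⟶ A.sum B)
    (g : X.pair A ⟶ D.thunk S) (h : X.pair B ⟶ D.thunk S) {Γ : Ctx Op} (v : QVal Γ X) :
    (ap (pair (𝟙 X) f ≫ copair S g h) v).force =
      .case (ap f v) (ap g (QVal.pair (v.subst (.wk Γ A)) (.var .zero))).force
        (ap h (QVal.pair (v.subst (.wk Γ B)) (.var .zero))).force := by
  simp

theorem val_lam {Γ : Ctx Op} {A : VTy Op} {C : CTy Op} (M : Comp (A :: Γ) C) :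
    (plusModel Op).val (.lam M) =
      curry (C.sig.map ty) (X := (plusModel Op).ctx Γ) (Y := ty A) (Z := ty C.val)
        ((plusModel Op).comp M) := by
  simp only [EffPlusModel.val]; rfl

theorem comp_app {Γ : Ctx Op} {A : VTy Op} {C : CTy Op} (V : Val Γ (A.fn C)) (W : Val Γ A) :
    (plusModel Op).comp (.app V W) =
      pair (B := ty A) ((plusModel Op).val V) ((plusModel Op).val W) ≫
        uncurry (C.sig.map ty) (𝟙 ((ty A).fn (cty C))) := by
  simp only [EffPlusModel.comp, lift_eq]; rfl

theorem comp_ret {Γ : Ctx Op} {A : VTy Op} {S : Sig Op (VTy Op)} (V : Val Γ A) :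
    (plusModel Op).comp (.ret (S := S) V) =
      (plusModel Op).val V ≫ thunkUnit (S.map ty) (ty A) := by
  simp only [EffPlusModel.comp]; rfl

theorem comp_letin {Γ : Ctx Op} {A B : VTy Op} {S : Sig Op (VTy Op)} (M : Comp Γ ⟨A, S⟩)
    (N : Comp (A :: Γ) ⟨B, S⟩) :
    (plusModel Op).comp (.letin M N) =
      pair (B := (ty A).thunk (S.map ty)) (𝟙 _) ((plusModel Op).comp M) ≫
        thunkStrength (S.map ty) ((plusModel Op).ctx Γ) (ty A) ≫
          thunkMap (S.map ty) (B := (ty B).thunk (S.map ty)) ((plusModel Op).comp N) ≫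
            thunkMult (S.map ty) (ty B) := by
  simp only [EffPlusModel.comp, lift_eq]; rfl

theorem comp_op {Γ : Ctx Op} {S : Sig Op (VTy Op)} (o : {o // o ∈ S.dom}) (V : Val Γ (S.arg o)) :
    (plusModel Op).comp (.op o V) = (plusModel Op).val V ≫ op (S.map ty) o := by
  simp only [EffPlusModel.comp]; rfl

theorem comp_handle {Γ : Ctx Op} {A : VTy Op} {S : Sig Op (VTy Op)} {C : CTy Op}
    (M : Comp Γ ⟨A, S⟩) (H : Hdl Γ S C) (N : Comp (A :: Γ) C) :
    (plusModel Op).comp (.handle M H N) =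
      pair (B := ((ty C.val).thunk (C.sig.map ty)).thunk (S.map ty))
        (opTuple (X := clauseTy (S.map ty) (C.sig.map ty) (ty C.val)) fun o =>
          curry (C.sig.map ty) (X := (plusModel Op).ctx Γ) (Z := ty C.val)
            (Y := (ty (S.arg o)).pair ((ty (S.res o)).fn (cty C)))
            (pair (pair (fst _ _) (snd _ _ ≫ fst _ _)) (snd _ _ ≫ snd _ _) ≫
              (plusModel Op).comp (H o)))
        (pair (B := (ty A).thunk (S.map ty)) (𝟙 _) ((plusModel Op).comp M) ≫
          thunkStrength (S.map ty) ((plusModel Op).ctx Γ) (ty A) ≫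
            thunkMap (S.map ty) (B := (ty C.val).thunk (C.sig.map ty)) ((plusModel Op).comp N)) ≫
      handle (S.map ty) (C.sig.map ty) (ty C.val) := by
  simp only [EffPlusModel.comp, lift_eq]; rfl

theorem comp_case {Γ : Ctx Op} {A B : VTy Op} {C : CTy Op} (V : Val Γ (.sum A B))
    (M : Comp (A :: Γ) C) (N : Comp (B :: Γ) C) :
    (plusModel Op).comp (.case V M N) =
      pair (B := (ty A).sum (ty B)) (𝟙 _) ((plusModel Op).val V) ≫
        copair (C.sig.map ty) (Z := (plusModel Op).ctx Γ) (D := ty C.val)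
          ((plusModel Op).comp M) ((plusModel Op).comp N) := by
  simp only [EffPlusModel.comp, lift_eq]
  exact congrArg (pair (B := (ty A).sum (ty B)) (𝟙 _) ((plusModel Op).val V) ≫ ·)
    (plusModel_copair (C.sig.map ty) (Z := (plusModel Op).ctx Γ) (A := ty A) (B := ty B)
      (D := ty C.val) ((plusModel Op).comp M) ((plusModel Op).comp N))

section

variable {Γ Δ : Ctx Op} (σ : QSubst (Γ.map ty) Δ)

theorem trVal_lam_subst {A : VTy Op} {C : CTy Op} (M : Comp (A :: Γ) C) :
    (trVal (.lam M)).cls.subst σ =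
      QVal.lam (A := ty A) (C := cty C) ((trComp M).cls.subst (σ.lift (ty A))) :=
  (congrArg (QVal.subst · σ) (Val.cls_lam (A := ty A) (C := cty C) (trComp M))).trans
    (QVal.lam_subst _ _)

theorem trVal_tuple_subst {n : ℕ} {A : Fin n → VTy Op} (V : ∀ i, Val Γ (A i)) :
    (trVal (.tuple V)).cls.subst σ =
      QVal.tuple (A := fun i => ty (A i)) fun i => (trVal (V i)).cls.subst σ :=
  (congrArg (QVal.subst · σ) (Val.cls_tuple (A := fun i => ty (A i)) fun i => trVal (V i))).trans
    (QVal.tuple_subst _ _)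

theorem trVal_proj_subst {n : ℕ} {A : Fin n → VTy Op} (i : Fin n) (V : Val Γ (.prod A)) :
    (trVal (.proj i V)).cls.subst σ =
      QVal.proj (A := fun i => ty (A i)) i ((trVal V).cls.subst σ) :=
  (congrArg (QVal.subst · σ) (Val.cls_proj (A := fun i => ty (A i)) i (trVal V))).trans
    (QVal.proj_subst _ _ _)

theorem trVal_inl_subst {A B : VTy Op} (V : Val Γ A) :
    (trVal (.inl (B := B) V)).cls.subst σ =
      QVal.inl (A := ty A) (B := ty B) ((trVal V).cls.subst σ) :=
  (congrArg (QVal.subst · σ) (Val.cls_inl (A := ty A) (B := ty B) (trVal V))).trans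
    (QVal.inl_subst _ _)

theorem trVal_inr_subst {A B : VTy Op} (V : Val Γ B) :
    (trVal (.inr (A := A) V)).cls.subst σ =
      QVal.inr (A := ty A) (B := ty B) ((trVal V).cls.subst σ) :=
  (congrArg (QVal.subst · σ) (Val.cls_inr (A := ty A) (B := ty B) (trVal V))).trans
    (QVal.inr_subst _ _)

theorem trComp_app_subst {A : VTy Op} {C : CTy Op} (V : Val Γ (A.fn C)) (W : Val Γ A) :
    (trComp (.app V W)).cls.subst σ =
      QComp.app (A := ty A) (C := cty C) ((trVal V).cls.subst σ) ((trVal W).cls.subst σ) :=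
  (congrArg (QComp.subst · σ) (Comp.cls_app (A := ty A) (C := cty C) (trVal V) (trVal W))).trans
    (QComp.app_subst _ _ _)

theorem trComp_ret_subst {A : VTy Op} {S : Sig Op (VTy Op)} (V : Val Γ A) :
    (trComp (.ret (S := S) V)).cls.subst σ =
      QComp.ret (A := ty A) (S := S.map ty) ((trVal V).cls.subst σ) :=
  (congrArg (QComp.subst · σ) (Comp.cls_ret (A := ty A) (S := S.map ty) (trVal V))).trans
    (QComp.ret_subst _ _)

theorem trComp_letin_subst {A B : VTy Op} {S : Sig Op (VTy Op)} (M : Comp Γ ⟨A, S⟩)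
    (N : Comp (A :: Γ) ⟨B, S⟩) :
    (trComp (.letin M N)).cls.subst σ =
      QComp.letin (A := ty A) (B := ty B) (S := S.map ty) ((trComp M).cls.subst σ)
        ((trComp N).cls.subst (σ.lift (ty A))) :=
  (congrArg (QComp.subst · σ) (Comp.cls_letin (A := ty A) (B := ty B) (S := S.map ty)
    (trComp M) (trComp N))).trans (QComp.letin_subst _ _ _)

theorem trComp_op_subst {S : Sig Op (VTy Op)} (o : {o // o ∈ S.dom}) (V : Val Γ (S.arg o)) :
    (trComp (.op o V)).cls.subst σ = QComp.op (S := S.map ty) o ((trVal V).cls.subst σ) :=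
  (congrArg (QComp.subst · σ) (Comp.cls_op (S := S.map ty) o (trVal V))).trans
    (QComp.op_subst _ _ _)

theorem trComp_handle_subst {A : VTy Op} {S : Sig Op (VTy Op)} {C : CTy Op}
    (M : Comp Γ ⟨A, S⟩) (H : Hdl Γ S C) (N : Comp (A :: Γ) C) :
    (trComp (.handle M H N)).cls.subst σ =
      QComp.handle (A := ty A) (S := S.map ty) (C := cty C) ((trComp M).cls.subst σ)
        (fun o => (trComp (H o)).cls.subst ((σ.lift (ty (S.arg o))).lift (ty ((S.res o).fn C))))
        ((trComp N).cls.subst (σ.lift (ty A))) :=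
  (congrArg (QComp.subst · σ) (Comp.cls_handle (A := ty A) (S := S.map ty) (C := cty C)
    (trComp M) (fun o => trComp (H o)) (trComp N))).trans (QComp.handle_subst _ _ _ _)

theorem trComp_case_subst {A B : VTy Op} {C : CTy Op} (V : Val Γ (.sum A B))
    (M : Comp (A :: Γ) C) (N : Comp (B :: Γ) C) :
    (trComp (.case V M N)).cls.subst σ =
      QComp.case (A := ty A) (B := ty B) (C := cty C) ((trVal V).cls.subst σ)
        ((trComp M).cls.subst (σ.lift (ty A))) ((trComp N).cls.subst (σ.lift (ty B))) :=
  (congrArg (QComp.subst · σ) (Comp.cls_case (A := ty A) (B := ty B) (C := cty C)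
    (trVal V) (trComp M) (trComp N))).trans (QComp.case_subst _ _ _ _)

end

mutual

theorem ap_val : {Γ : Ctx Op} → {A : VTy Op} → (V : Val Γ A) → {Δ : Ctx Op} →
    (v : QVal Δ ((plusModel Op).ctx Γ)) →
    ap ((plusModel Op).val V) v = (trVal V).cls.subst (substOf v)
  | _, _, .var x, _, v => by
    simp only [EffPlusModel.val, ap_var, trVal, Val.cls_var, QVal.var_subst]
  | _, _, .lam M, _, v => by
    refine .trans ?_ (trVal_lam_subst _ M).symm
    refine (congrArg (ap · v) (val_lam M)).trans ?_
    exact congrArg QVal.lam ((run_comp M _).trans (congrArg _ (substOf_lift v)))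
  | _, _, .tuple (A := A) V, _, v => by
    refine .trans ?_ (trVal_tuple_subst _ V).symm
    simp only [EffPlusModel.val]
    exact congrArg (QVal.tuple (A := fun i => ty (A i))) (funext fun i => ap_val (V i) v)
  | _, _, .proj (A := A) i V, _, v => by
    refine .trans ?_ (trVal_proj_subst _ i V).symm
    simp only [EffPlusModel.val]
    exact congrArg (QVal.proj (A := fun i => ty (A i)) i) (ap_val V v)
  | _, _, .inl V, _, v => by
    refine .trans ?_ (trVal_inl_subst _ V).symm
    simp only [EffPlusModel.val]
    exact congrArg QVal.inl (ap_val V v)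
  | _, _, .inr V, _, v => by
    refine .trans ?_ (trVal_inr_subst _ V).symm
    simp only [EffPlusModel.val]
    exact congrArg QVal.inr (ap_val V v)

theorem run_comp : {Γ : Ctx Op} → {C : CTy Op} → (M : Comp Γ C) → {Δ : Ctx Op} →
    (v : QVal Δ ((plusModel Op).ctx Γ)) →
    run ((plusModel Op).comp M) v = (trComp M).cls.subst (substOf v)
  | _, C, .app (A := A) V W, _, v => by
    refine .trans ?_ (trComp_app_subst _ V W).symm
    refine (congrArg (run · v) (comp_app V W)).trans ((force_app _ _ v).trans ?_)
    exact congrArg₂ (QComp.app (A := ty A) (C := cty C)) (ap_val V v) (ap_val W v)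
  | _, _, .ret V, _, v => by
    refine .trans ?_ (trComp_ret_subst _ V).symm
    refine (congrArg (run · v) (comp_ret V)).trans ((QVal.force_thunk _).trans ?_)
    exact congrArg QComp.ret (ap_val V v)
  | _, _, .letin M N, _, v => by
    refine .trans ?_ (trComp_letin_subst _ M N).symm
    refine (congrArg (run · v) (comp_letin M N)).trans ((force_letin _ _ v).trans ?_)
    exact congrArg₂ QComp.letin (run_comp M v)
      ((run_comp N _).trans (congrArg _ (substOf_lift v)))
  | _, _, .op (S := S) o V, _, v => by
    refine .trans ?_ (trComp_op_subst _ o V).symm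
    refine (congrArg (run · v) (comp_op o V)).trans ((QVal.force_thunk _).trans ?_)
    exact congrArg (QComp.op (S := S.map ty) o) (ap_val V v)
  | _, _, .handle (A := A) (S := S) (C := C) M H N, _, v => by
    refine .trans ?_ (trComp_handle_subst _ M H N).symm
    refine (congrArg (run · v) (comp_handle M H N)).trans ((force_handle _ _ _ v).trans ?_)
    have h₁ := run_comp M v
    have h₂ := fun o => (run_comp (H o) _).trans
      (congrArg _ (substOf_lift_lift (A := S.arg o) (B := (S.res o).fn C) v))
    have h₃ := (run_comp N _).trans (congrArg _ (substOf_lift v))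
    exact congr (congrArg₂ (QComp.handle (A := ty A) (S := S.map ty) (C := cty C)) h₁
      (funext h₂)) h₃
  | _, _, .case (A := A) (B := B) (C := C) V M N, _, v => by
    refine .trans ?_ (trComp_case_subst _ V M N).symm
    refine (congrArg (run · v) (comp_case V M N)).trans ((force_case _ _ _ v).trans ?_)
    exact congr (congrArg₂ (QComp.case (A := ty A) (B := ty B) (C := cty C)) (ap_val V v)
      ((run_comp M _).trans (congrArg _ (substOf_lift v))))
      ((run_comp N _).trans (congrArg _ (substOf_lift v)))

end

/-! ### Terms over interpreted types -/

theorem trVar_heq : ∀ {Γ : Ctx Op} {A : VTy Op} (x : Var Γ A), HEq (trVar x) x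
  | _, _, .zero (Γ := Γ) (A := A) => by
    have : ∀ {Γ' A'}, Γ' = Γ → A' = A →
        HEq (Var.zero : Var (A' :: Γ') A') (Var.zero : Var (A :: Γ) A) := by
      rintro _ _ rfl rfl; rfl
    exact this (ctx_map_ty Γ) (ty_eq A)
  | _, _, .succ (Γ := Γ) (A := A) (B := B) x => by
    have : ∀ {Γ' A' B'} {x' : Var Γ' A'}, Γ' = Γ → A' = A → B' = B → HEq x' x →
        HEq (Var.succ (B := B') x') (Var.succ (B := B) x) := by
      rintro _ _ _ _ rfl rfl rfl ⟨⟩; rfl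
    exact this (ctx_map_ty Γ) (ty_eq A) (ty_eq B) (trVar_heq x)

mutual

theorem trVal_heq : ∀ {Γ : Ctx Op} {A : VTy Op} (V : Val Γ A), HEq (trVal V) V
  | Γ, A, .var x => by
    have : ∀ {Γ' A'} {x' : Var Γ' A'}, Γ' = Γ → A' = A → HEq x' x →
        HEq (Val.var x') (Val.var x) := by
      rintro _ _ _ rfl rfl ⟨⟩; rfl
    exact this (ctx_map_ty Γ) (ty_eq A) (trVar_heq x)
  | Γ, _, .lam (A := A) (C := C) M => by
    have : ∀ {Γ' A' C'} {M' : Comp (A' :: Γ') C'}, Γ' = Γ → A' = A → C' = C → HEq M' M →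
        HEq (Val.lam M') (Val.lam M) := by
      rintro _ _ _ _ rfl rfl rfl ⟨⟩; rfl
    exact this (ctx_map_ty Γ) (ty_eq A) (cty_eq C) (trComp_heq M)
  | Γ, _, .tuple (A := A) V => by
    have : ∀ {Γ'} {A' : Fin _ → VTy Op} {V' : ∀ i, Val Γ' (A' i)}, Γ' = Γ → A' = A → (∀ i, HEq (V' i) (V i)) →
        HEq (Val.tuple V') (Val.tuple V) := by
      rintro _ _ V' rfl rfl h
      exact heq_of_eq (congrArg Val.tuple (funext fun i => eq_of_heq (h i)))
    rw [trVal]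
    exact this (ctx_map_ty Γ) (funext fun i => ty_eq (A i)) fun i => trVal_heq (V i)
  | Γ, _, .proj (A := A) i V => by
    have : ∀ {Γ' A'} {V' : Val Γ' (.prod A')}, Γ' = Γ → A' = A → HEq V' V →
        HEq (Val.proj i V') (Val.proj (A := A) i V) := by
      rintro _ _ _ rfl rfl ⟨⟩; rfl
    exact this (ctx_map_ty Γ) (funext fun i => ty_eq (A i)) (trVal_heq V)
  | Γ, _, .inl (A := A) (B := B) V => by
    have : ∀ {Γ' A' B'} {V' : Val Γ' A'}, Γ' = Γ → A' = A → B' = B → HEq V' V →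
        HEq (Val.inl (B := B') V') (Val.inl (B := B) V) := by
      rintro _ _ _ _ rfl rfl rfl ⟨⟩; rfl
    exact this (ctx_map_ty Γ) (ty_eq A) (ty_eq B) (trVal_heq V)
  | Γ, _, .inr (A := A) (B := B) V => by
    have : ∀ {Γ' A' B'} {V' : Val Γ' B'}, Γ' = Γ → A' = A → B' = B → HEq V' V →
        HEq (Val.inr (A := A') V') (Val.inr (A := A) V) := by
      rintro _ _ _ _ rfl rfl rfl ⟨⟩; rfl
    exact this (ctx_map_ty Γ) (ty_eq A) (ty_eq B) (trVal_heq V)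

theorem trComp_heq : ∀ {Γ : Ctx Op} {C : CTy Op} (M : Comp Γ C), HEq (trComp M) M
  | Γ, C, .app (A := A) V W => by
    have : ∀ {Γ' A' C'} {V' : Val Γ' (.fn A' C')} {W' : Val Γ' A'}, Γ' = Γ → A' = A → C' = C →
        HEq V' V → HEq W' W → HEq (Comp.app V' W') (Comp.app V W) := by
      rintro _ _ _ _ _ rfl rfl rfl ⟨⟩ ⟨⟩; rfl
    exact this (ctx_map_ty Γ) (ty_eq A) (cty_eq C) (trVal_heq V) (trVal_heq W)
  | Γ, _, .ret (A := A) (S := S) V => by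
    have : ∀ {Γ' A' S'} {V' : Val Γ' A'}, Γ' = Γ → A' = A → S' = S → HEq V' V →
        HEq (Comp.ret (S := S') V') (Comp.ret (S := S) V) := by
      rintro _ _ _ _ rfl rfl rfl ⟨⟩; rfl
    exact this (ctx_map_ty Γ) (ty_eq A) (sig_map_ty S) (trVal_heq V)
  | Γ, _, .letin (A := A) (B := B) (S := S) M N => by
    have : ∀ {Γ' A' B' S'} {M' : Comp Γ' ⟨A', S'⟩} {N' : Comp (A' :: Γ') ⟨B', S'⟩}, Γ' = Γ →
        A' = A → B' = B → S' = S → HEq M' M → HEq N' N →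
        HEq (Comp.letin M' N') (Comp.letin M N) := by
      rintro _ _ _ _ _ _ rfl rfl rfl rfl ⟨⟩ ⟨⟩; rfl
    exact this (ctx_map_ty Γ) (ty_eq A) (ty_eq B) (sig_map_ty S) (trComp_heq M) (trComp_heq N)
  | Γ, _, .op (S := S) o V => by
    have : ∀ {Γ' arg' res'} {V' : Val Γ' (arg' o)}, Γ' = Γ → arg' = S.arg → res' = S.res →
        HEq V' V → HEq (Comp.op (S := ⟨S.dom, arg', res'⟩) o V') (Comp.op o V) := by
      rintro _ _ _ _ rfl rfl rfl ⟨⟩; rfl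
    exact this (ctx_map_ty Γ) (funext fun o => ty_eq (S.arg o)) (funext fun o => ty_eq (S.res o))
      (trVal_heq V)
  | Γ, C, .handle (A := A) (S := S) M H N => by
    have : ∀ {Γ' A' C' arg' res'} {M' : Comp Γ' ⟨A', ⟨S.dom, arg', res'⟩⟩}
        {H' : Hdl Γ' ⟨S.dom, arg', res'⟩ C'} {N' : Comp (A' :: Γ') C'}, Γ' = Γ → A' = A →
        C' = C → arg' = S.arg → res' = S.res → HEq M' M → (∀ o, HEq (H' o) (H o)) → HEq N' N →
        HEq (Comp.handle M' H' N') (Comp.handle M H N) := by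
      rintro _ _ _ _ _ _ H' _ rfl rfl rfl rfl rfl ⟨⟩ h ⟨⟩
      obtain rfl : H' = H := funext fun o => eq_of_heq (h o)
      rfl
    exact this (ctx_map_ty Γ) (ty_eq A) (cty_eq C) (funext fun o => ty_eq (S.arg o))
      (funext fun o => ty_eq (S.res o)) (trComp_heq M) (fun o => trComp_heq (H o)) (trComp_heq N)
  | Γ, C, .case (A := A) (B := B) V M N => by
    have : ∀ {Γ' A' B' C'} {V' : Val Γ' (.sum A' B')} {M' : Comp (A' :: Γ') C'}
        {N' : Comp (B' :: Γ') C'}, Γ' = Γ → A' = A → B' = B → C' = C → HEq V' V → HEq M' M →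
        HEq N' N → HEq (Comp.case V' M' N') (Comp.case V M N) := by
      rintro _ _ _ _ _ _ _ rfl rfl rfl rfl ⟨⟩ ⟨⟩ ⟨⟩; rfl
    exact this (ctx_map_ty Γ) (ty_eq A) (ty_eq B) (cty_eq C) (trVal_heq V) (trComp_heq M)
      (trComp_heq N)

end

/-! ### Completeness of the term model -/

theorem valEq_of_val_eq {Γ : Ctx Op} {A : VTy Op} {V W : Val Γ A}
    (h : (plusModel Op).val V = (plusModel Op).val W) : ValEq V W := by
  obtain ⟨v, hv⟩ := substOf_surjective (QSubst.id (Γ.map ty))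
  have := congrArg (ap · v) h
  simp only [ap_val, hv, QVal.subst_id, Val.cls_eq] at this
  have key : ∀ {Γ' A'} {V' W' : Val Γ' A'}, Γ' = Γ → A' = A → HEq V' V → HEq W' W →
      ValEq V' W' → ValEq V W := by
    rintro _ _ _ _ rfl rfl ⟨⟩ ⟨⟩ h; exact h
  exact key (ctx_map_ty Γ) (ty_eq A) (trVal_heq V) (trVal_heq W) this

theorem compEq_of_comp_eq {Γ : Ctx Op} {C : CTy Op} {M N : Comp Γ C}
    (h : (plusModel Op).comp M = (plusModel Op).comp N) : CompEq M N := by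
  obtain ⟨v, hv⟩ := substOf_surjective (QSubst.id (Γ.map ty))
  have := congrArg (run · v) h
  simp only [run_comp, hv, QComp.subst_id, Comp.cls_eq] at this
  have key : ∀ {Γ' C'} {M' N' : Comp Γ' C'}, Γ' = Γ → C' = C → HEq M' M → HEq N' N →
      CompEq M' N' → CompEq M N := by
    rintro _ _ _ _ rfl rfl ⟨⟩ ⟨⟩ h; exact h
  exact key (ctx_map_ty Γ) (cty_eq C) (trComp_heq M) (trComp_heq N) this

end TermHom

theorem EffFrame.hdlLift_hdlProj {C : Type u} [Category.{v} C] [CartesianMonoidalCategory C]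
    (F : EffFrame Op C) (S S' : Sig Op C) (X : C) {Z : C} (f : ∀ o, Z ⟶ F.clauseObj S S' X o)
    (o : {o // o ∈ S.dom}) : F.hdlLift S S' X f ≫ F.hdlProj S S' X o = f o :=
  Fan.IsLimit.fac _ _ _

theorem EffFrame.hdlLift_injective {C : Type u} [Category.{v} C] [CartesianMonoidalCategory C]
    (F : EffFrame Op C) (S S' : Sig Op C) (X : C) {Z : C} {f g : ∀ o, Z ⟶ F.clauseObj S S' X o}
    (h : F.hdlLift S S' X f = F.hdlLift S S' X g) (o : {o // o ∈ S.dom}) : f o = g o := by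
  rw [← F.hdlLift_hdlProj S S' X f, h, F.hdlLift_hdlProj]

theorem EffPlusModel.comp_eq_of_hdl_eq {C : Type u} [Category.{v} C] [CartesianMonoidalCategory C]
    (𝓜 : EffPlusModel Op C) {Γ : Ctx Op} {S : Sig Op (VTy Op)} {D : CTy Op} {H H' : Hdl Γ S D}
    (h : 𝓜.hdl H = 𝓜.hdl H') (o : {o // o ∈ S.dom}) : 𝓜.comp (H o) = 𝓜.comp (H' o) := by
  simp only [EffPlusModel.hdl] at h
  exact (Iso.cancel_iso_inv_left (α_ _ _ _) _ _).1
    ((𝓜.kexp _ _ _).curry.injective (𝓜.hdlLift_injective _ _ _ h o))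

end

section

variable {Op : Type w} {C : Type u} [Category.{v} C] [CartesianMonoidalCategory C]

/-! ## Calculus of strong monads -/

namespace StrongMonad

variable (T : StrongMonad C)

/-- Map a morphism with a parameter over a computation. -/
def mapWith {X A W : C} (m : X ⟶ T.obj A) (n : X ⊗ A ⟶ W) : X ⟶ T.obj W :=
  lift (𝟙 X) m ≫ T.st X A ≫ T.map n

/-- Sequencing of computations with a parameter. -/
def bindWith {X A B : C} (m : X ⟶ T.obj A) (n : X ⊗ A ⟶ T.obj B) : X ⟶ T.obj B :=
  lift (𝟙 X) m ≫ T.st X A ≫ T.map n ≫ T.μ.app B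

theorem bindWith_eq {X A B : C} (m : X ⟶ T.obj A) (n : X ⊗ A ⟶ T.obj B) :
    T.bindWith m n = T.mapWith m n ≫ T.μ.app B := by
  simp [bindWith, mapWith]

theorem whiskerRight_st {X X' : C} (f : X ⟶ X') (A : C) :
    f ▷ T.obj A ≫ T.st X' A = T.st X A ≫ T.map (f ▷ A) := by
  simpa using T.st_natural f (𝟙 A)

theorem whiskerLeft_st (X : C) {A A' : C} (g : A ⟶ A') :
    X ◁ T.map g ≫ T.st X A' = T.st X A ≫ T.map (X ◁ g) := by
  simpa using T.st_natural (𝟙 X) g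

theorem comp_mapWith {X Y A W : C} (f : Y ⟶ X) (m : X ⟶ T.obj A) (n : X ⊗ A ⟶ W) :
    f ≫ T.mapWith m n = T.mapWith (f ≫ m) (f ▷ A ≫ n) := by
  have : f ≫ lift (𝟙 X) m = lift (𝟙 Y) (f ≫ m) ≫ f ▷ T.obj A := by simp
  rw [mapWith, mapWith, ← Category.assoc, this, Category.assoc, ← Category.assoc (f ▷ _),
    whiskerRight_st, Functor.map_comp, Category.assoc]

theorem comp_bindWith {X Y A B : C} (f : Y ⟶ X) (m : X ⟶ T.obj A) (n : X ⊗ A ⟶ T.obj B) :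
    f ≫ T.bindWith m n = T.bindWith (f ≫ m) (f ▷ A ≫ n) := by
  rw [bindWith_eq, bindWith_eq, ← Category.assoc, comp_mapWith]

theorem mapWith_map {X A W W' : C} (m : X ⟶ T.obj A) (n : X ⊗ A ⟶ W) (g : W ⟶ W') :
    T.mapWith m n ≫ T.map g = T.mapWith m (n ≫ g) := by
  simp [mapWith]

theorem mapWith_unit {X A W : C} (v : X ⟶ A) (n : X ⊗ A ⟶ W) :
    T.mapWith (v ≫ T.η.app A) n = lift (𝟙 X) v ≫ n ≫ T.η.app W := by
  have h : lift (𝟙 X) (v ≫ T.η.app A) = lift (𝟙 X) v ≫ X ◁ T.η.app A := by simp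
  have h' : T.η.app (X ⊗ A) ≫ T.map n = n ≫ T.η.app W := (T.η.naturality n).symm
  rw [mapWith, h, Category.assoc, ← Category.assoc (X ◁ _), st_unit, h']

theorem st_snd (X A : C) : T.st X A ≫ T.map (snd X A) = snd X (T.obj A) := by
  have h : snd X A = toUnit X ▷ A ≫ (λ_ A).hom := snd_def X A
  rw [h, Functor.map_comp, ← Category.assoc, ← whiskerRight_st, Category.assoc, st_leftUnitor]
  exact (snd_def X (T.obj A)).symm

theorem mapWith_snd {X A : C} (m : X ⟶ T.obj A) : T.mapWith m (snd X A) = m := by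
  rw [mapWith, st_snd, lift_snd]

theorem lift_mapWith_st {X Y A W : C} (h : X ⟶ Y) (m : X ⟶ T.obj A) (n : X ⊗ A ⟶ W) :
    lift h (T.mapWith m n) ≫ T.st Y W = T.mapWith m (lift (fst X A ≫ h) n) := by
  have h₁ : lift h (T.mapWith m n) =
      lift h (lift (𝟙 X) m) ≫ Y ◁ T.st X A ≫ Y ◁ T.map n := by simp [mapWith]
  have h₂ : lift h (lift (𝟙 X) m) =
      lift (𝟙 X) m ≫ lift h (𝟙 X) ▷ T.obj A ≫ (α_ Y X (T.obj A)).hom := by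
    ext <;> simp
  have h₃ : lift h (𝟙 X) ▷ A ≫ (α_ Y X A).hom ≫ Y ◁ n = lift (fst X A ≫ h) n := by
    have h₄ : lift h (𝟙 X) ▷ A ≫ (α_ Y X A).hom = lift (fst X A ≫ h) (𝟙 _) := by
      ext <;> simp
    rw [← Category.assoc, h₄, lift_whiskerLeft, Category.id_comp]
  rw [h₁, h₂, mapWith]
  simp only [Category.assoc]
  rw [whiskerLeft_st, ← Category.assoc (Y ◁ _), ← Category.assoc (α_ _ _ _).hom,
    ← st_associator, ← h₃]
  simp only [Functor.map_comp, Category.assoc]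
  rw [← Category.assoc (_ ▷ _), whiskerRight_st]
  simp only [Category.assoc]

theorem mapWith_bindWith {X A B W : C} (m : X ⟶ T.obj A) (n : X ⊗ A ⟶ T.obj B)
    (l : X ⊗ B ⟶ W) :
    T.mapWith (T.bindWith m n) l =
      T.bindWith m (T.mapWith n (fst X A ▷ B ≫ l)) := by
  have h : lift (𝟙 X) (T.bindWith m n) = lift (𝟙 X) (T.mapWith m n) ≫ X ◁ T.μ.app B := by
    simp [bindWith_eq]
  have h' : T.mapWith n (fst X A ▷ B ≫ l) = lift (fst X A) n ≫ T.st X B ≫ T.map l := by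
    rw [mapWith, Functor.map_comp, ← Category.assoc (T.st _ _), ← whiskerRight_st]
    simp
  have hμ : T.μ.app (X ⊗ B) ≫ T.map l = T.map (T.map l) ≫ T.μ.app W := (T.μ.naturality l).symm
  rw [mapWith, h, Category.assoc, ← Category.assoc (X ◁ _), st_mult]
  simp only [Category.assoc]
  rw [hμ, ← Category.assoc, lift_mapWith_st, Category.comp_id, ← Category.assoc, mapWith_map,
    ← Category.assoc, mapWith_map, bindWith_eq, h', Category.assoc]

theorem bindWith_bindWith {X A B D : C} (m : X ⟶ T.obj A) (n : X ⊗ A ⟶ T.obj B)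
    (l : X ⊗ B ⟶ T.obj D) :
    T.bindWith (T.bindWith m n) l = T.bindWith m (T.bindWith n (fst X A ▷ B ≫ l)) := by
  have h : T.μ.app (T.obj D) ≫ T.μ.app D = T.map (T.μ.app D) ≫ T.μ.app D := (T.assoc D).symm
  rw [bindWith_eq T (T.bindWith m n), mapWith_bindWith, bindWith_eq, bindWith_eq, bindWith_eq,
    Category.assoc, h, ← Category.assoc, mapWith_map]

theorem bindWith_unit {X A B : C} (v : X ⟶ A) (n : X ⊗ A ⟶ T.obj B) :
    T.bindWith (v ≫ T.η.app A) n = lift (𝟙 X) v ≫ n := by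
  have h : T.η.app (T.obj B) ≫ T.μ.app B = 𝟙 (T.obj B) := T.left_unit B
  rw [bindWith_eq, mapWith_unit]
  simp only [Category.assoc, h, Category.comp_id]

theorem bindWith_snd_unit {X A : C} (m : X ⟶ T.obj A) :
    T.bindWith m (snd X A ≫ T.η.app A) = m := by
  have h : T.map (T.η.app A) ≫ T.μ.app A = 𝟙 (T.obj A) := T.right_unit A
  rw [bindWith_eq, ← mapWith_map, mapWith_snd, Category.assoc, h, Category.comp_id]

end StrongMonad

namespace KleisliExp

variable {T : StrongMonad C} {Y Z : C} (E : KleisliExp T Y Z)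

theorem curry_whiskerRight_eval {X : C} (g : X ⊗ Y ⟶ T.obj Z) : E.curry g ▷ Y ≫ E.eval = g :=
  E.curry.injective (by rw [curry_natural, eval, Equiv.apply_symm_apply, Category.comp_id])

theorem lift_curry_eval {X : C} (g : X ⊗ Y ⟶ T.obj Z) (w : X ⟶ Y) :
    lift (E.curry g) w ≫ E.eval = lift (𝟙 X) w ≫ g := by
  have h : lift (E.curry g) w = lift (𝟙 X) w ≫ E.curry g ▷ Y := by simp
  rw [h, Category.assoc, curry_whiskerRight_eval]

theorem curry_eval {X : C} (f : X ⟶ E.pt) : E.curry (f ▷ Y ≫ E.eval) = f := by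
  rw [curry_natural, eval, Equiv.apply_symm_apply, Category.comp_id]

end KleisliExp

end

section

variable {Op : Type w} {C : Type u} [Category.{v} C] [CartesianMonoidalCategory C]

/-! ## Semantic operations of a model -/

theorem EffFrame.comp_hdlLift (F : EffFrame Op C) (S S' : Sig Op C) (X : C) {Y Z : C} (k : Y ⟶ Z)
    (f : ∀ o, Z ⟶ F.clauseObj S S' X o) :
    k ≫ F.hdlLift S S' X f = F.hdlLift S S' X fun o => k ≫ f o :=
  Fan.IsLimit.hom_ext (F.opProd S.dom (F.clauseObj S S' X)).isLimit _ _ fun o => by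
    change (k ≫ F.hdlLift S S' X f) ≫ F.hdlProj S S' X o = F.hdlLift S S' X _ ≫ F.hdlProj S S' X o
    rw [Category.assoc, F.hdlLift_hdlProj, F.hdlLift_hdlProj]

/-- The handler given by a family of clauses. -/
def EffFrame.hdlOf (F : EffFrame Op C) (S S' : Sig Op C) (X : C) {Z : C}
    (k : ∀ o : {o // o ∈ S.dom}, (Z ⊗ S.arg o) ⊗ (F.kexp S' (S.res o) X).pt ⟶ (F.T S').obj X) :
    Z ⟶ F.hdlObj S S' X :=
  F.hdlLift S S' X fun o => (F.kexp S' _ X).curry ((α_ _ _ _).inv ≫ k o)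

theorem EffFrame.comp_hdlOf (F : EffFrame Op C) (S S' : Sig Op C) (X : C) {Y Z : C} (f : Y ⟶ Z)
    (k : ∀ o : {o // o ∈ S.dom}, (Z ⊗ S.arg o) ⊗ (F.kexp S' (S.res o) X).pt ⟶ (F.T S').obj X) :
    f ≫ F.hdlOf S S' X k = F.hdlOf S S' X fun o => (f ▷ _) ▷ _ ≫ k o := by
  refine (F.comp_hdlLift S S' X f _).trans (congrArg (F.hdlLift S S' X) (funext fun o => ?_))
  refine (KleisliExp.curry_natural _ f _).symm.trans (congrArg _ ?_)
  simp

theorem EffFrame.hdlOf_hdlProj (F : EffFrame Op C) (S S' : Sig Op C) (X : C) {Z : C}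
    (k : ∀ o : {o // o ∈ S.dom}, (Z ⊗ S.arg o) ⊗ (F.kexp S' (S.res o) X).pt ⟶ (F.T S').obj X)
    (o : {o // o ∈ S.dom}) : F.hdlOf S S' X k ≫ F.hdlProj S S' X o =
      (F.kexp S' _ X).curry ((α_ _ _ _).inv ≫ k o) :=
  F.hdlLift_hdlProj S S' X _ o

theorem lift_id_whiskerRight {X Y A : C} (f : Y ⟶ X) (v : X ⟶ A) :
    lift (𝟙 Y) (f ≫ v) ≫ f ▷ A = f ≫ lift (𝟙 X) v := by
  simp

namespace EffModel

variable (𝓜 : EffModel Op C) (S S' : Sig Op C)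

/-- Handling of a computation with a parameter. -/
def handleWith {X A B : C} (h : X ⟶ 𝓜.hdlObj S S' B) (m : X ⟶ (𝓜.T S).obj A)
    (n : X ⊗ A ⟶ (𝓜.T S').obj B) : X ⟶ (𝓜.T S').obj B :=
  lift h ((𝓜.T S).mapWith m n) ≫ 𝓜.handle S S' B

theorem comp_handleWith {X Y A B : C} (f : Y ⟶ X) (h : X ⟶ 𝓜.hdlObj S S' B)
    (m : X ⟶ (𝓜.T S).obj A) (n : X ⊗ A ⟶ (𝓜.T S').obj B) :
    f ≫ 𝓜.handleWith S S' h m n = 𝓜.handleWith S S' (f ≫ h) (f ≫ m) (f ▷ A ≫ n) := by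
  rw [handleWith, handleWith, ← Category.assoc, comp_lift, StrongMonad.comp_mapWith]

theorem handleWith_unit {X A B : C} (h : X ⟶ 𝓜.hdlObj S S' B) (v : X ⟶ A)
    (n : X ⊗ A ⟶ (𝓜.T S').obj B) :
    𝓜.handleWith S S' h (v ≫ (𝓜.T S).η.app A) n = lift (𝟙 X) v ≫ n := by
  have : lift h (lift (𝟙 X) v ≫ n ≫ (𝓜.T S).η.app ((𝓜.T S').obj B)) =
      lift h (lift (𝟙 X) v ≫ n) ≫ 𝓜.hdlObj S S' B ◁ (𝓜.T S).η.app ((𝓜.T S').obj B) := by simp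
  rw [handleWith, StrongMonad.mapWith_unit, this, Category.assoc, 𝓜.handle_unit]
  exact lift_snd _ _

theorem handleWith_bindWith {X A B D : C} (h : X ⟶ 𝓜.hdlObj S S' D) (m : X ⟶ (𝓜.T S).obj A)
    (n : X ⊗ A ⟶ (𝓜.T S).obj B) (l : X ⊗ B ⟶ (𝓜.T S').obj D) :
    𝓜.handleWith S S' h ((𝓜.T S).bindWith m n) l =
      𝓜.handleWith S S' h m
        (𝓜.handleWith S S' (fst X A ≫ h) n (fst X A ▷ B ≫ l)) := by
  have h₁ (k : X ⟶ (𝓜.T S).obj ((𝓜.T S).obj ((𝓜.T S').obj D))) :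
      lift h (k ≫ (𝓜.T S).μ.app ((𝓜.T S').obj D)) =
      lift h k ≫ 𝓜.hdlObj S S' D ◁ (𝓜.T S).μ.app ((𝓜.T S').obj D) := by simp
  rw [handleWith, StrongMonad.mapWith_bindWith, StrongMonad.bindWith_eq, h₁, Category.assoc,
    𝓜.handle_mult, ← Category.assoc, comp_lift, lift_fst, StrongMonad.lift_mapWith_st,
    ← Category.assoc, lift_whiskerLeft, StrongMonad.mapWith_map]
  rfl

theorem lift_mixedOp {X B : C} (o : {o // o ∈ S.dom}) (v : X ⟶ S.arg o)
    (n : X ⊗ S.res o ⟶ (𝓜.T S').obj B) :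
    lift v ((𝓜.kexp S' (S.res o) B).curry n) ≫ 𝓜.mixedOp S S' B o =
      (𝓜.T S).mapWith (v ≫ 𝓜.op S o) n := by
  have h : lift ((𝓜.kexp S' (S.res o) B).curry n) (v ≫ 𝓜.op S o) =
      lift (𝟙 X) (v ≫ 𝓜.op S o) ≫ (𝓜.kexp S' (S.res o) B).curry n ▷ _ := by simp
  rw [EffFrame.mixedOp, ← Category.assoc, lift_whiskerRight, ← Category.assoc, comp_lift, lift_snd,
    lift_fst, h, Category.assoc, ← Category.assoc (_ ▷ _), StrongMonad.whiskerRight_st,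
    Category.assoc, ← Functor.map_comp, KleisliExp.curry_whiskerRight_eval]
  rfl

theorem handleWith_op {X B : C} (o : {o // o ∈ S.dom})
    (k : ∀ o : {o // o ∈ S.dom}, (X ⊗ S.arg o) ⊗ (𝓜.kexp S' (S.res o) B).pt ⟶ (𝓜.T S').obj B)
    (v : X ⟶ S.arg o) (n : X ⊗ S.res o ⟶ (𝓜.T S').obj B) :
    𝓜.handleWith S S' (𝓜.hdlOf S S' B k) (v ≫ 𝓜.op S o) n =
      lift (lift (𝟙 X) v) ((𝓜.kexp S' (S.res o) B).curry n) ≫ k o := by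
  have h₁ (h : X ⟶ 𝓜.hdlObj S S' B) (a) : lift h (a ≫ 𝓜.mixedOp S S' B o) =
      lift h a ≫ 𝓜.hdlObj S S' B ◁ 𝓜.mixedOp S S' B o := by simp
  have h₂ (a : X ⟶ S.arg o ⊗ (𝓜.kexp S' (S.res o) B).pt) :
      lift (𝓜.hdlOf S S' B k) a ≫ 𝓜.hdlProj S S' B o ▷ _ =
      lift ((𝓜.kexp S' _ B).curry ((α_ _ _ _).inv ≫ k o)) a := by
    rw [lift_whiskerRight, EffFrame.hdlOf_hdlProj]
    rfl
  have h₃ : lift (𝟙 X) (lift v ((𝓜.kexp S' (S.res o) B).curry n)) ≫ (α_ _ _ _).inv =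
      lift (lift (𝟙 X) v) ((𝓜.kexp S' (S.res o) B).curry n) := by
    ext <;> simp
  rw [handleWith, ← lift_mixedOp, h₁, Category.assoc, 𝓜.handle_op]
  refine (Category.assoc _ _ _).symm.trans ((congrArg (· ≫ _) (h₂ _)).trans ?_)
  refine (KleisliExp.lift_curry_eval _ _ _).trans ?_
  rw [← Category.assoc, h₃]

end EffModel

namespace EffPlusModel

variable (𝓜 : EffPlusModel Op C)

section

variable (S : Sig Op C) {X Y Z W : C}

theorem inl_copair (f : Z ⊗ X ⟶ (𝓜.T S).obj W) (g : Z ⊗ Y ⟶ (𝓜.T S).obj W) :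
    Z ◁ 𝓜.inl X Y ≫ 𝓜.copair S f g = f :=
  ((𝓜.isDistribKleisliCoprod S X Y).2 Z W f g).choose_spec.1.1

theorem inr_copair (f : Z ⊗ X ⟶ (𝓜.T S).obj W) (g : Z ⊗ Y ⟶ (𝓜.T S).obj W) :
    Z ◁ 𝓜.inr X Y ≫ 𝓜.copair S f g = g :=
  ((𝓜.isDistribKleisliCoprod S X Y).2 Z W f g).choose_spec.1.2

theorem copair_comp (h : Z ⊗ 𝓜.sum X Y ⟶ (𝓜.T S).obj W) :
    𝓜.copair S (Z ◁ 𝓜.inl X Y ≫ h) (Z ◁ 𝓜.inr X Y ≫ h) = h :=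
  (((𝓜.isDistribKleisliCoprod S X Y).2 Z W _ _).choose_spec.2 h ⟨rfl, rfl⟩).symm

theorem whiskerRight_copair {Z' : C} (k : Z' ⟶ Z) (f : Z ⊗ X ⟶ (𝓜.T S).obj W)
    (g : Z ⊗ Y ⟶ (𝓜.T S).obj W) :
    k ▷ 𝓜.sum X Y ≫ 𝓜.copair S f g = 𝓜.copair S (k ▷ X ≫ f) (k ▷ Y ≫ g) := by
  rw [← 𝓜.copair_comp S (k ▷ 𝓜.sum X Y ≫ 𝓜.copair S f g), whisker_exchange_assoc,
    whisker_exchange_assoc, inl_copair, inr_copair]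

end

/-! ## Interpretation of compound terms -/

variable {Γ Δ : Ctx Op}

theorem val_var {A : VTy Op} (x : Var Γ A) : 𝓜.val (.var x) = 𝓜.var x := by
  simp only [val]

theorem val_lam {A : VTy Op} {D : CTy Op} (M : Comp (A :: Γ) D) :
    𝓜.val (.lam M) = (𝓜.kexp (𝓜.sig D.sig) (𝓜.ty A) (𝓜.ty D.val)).curry (𝓜.comp M) := by
  simp only [val]; rfl

theorem val_tuple {n : ℕ} {A : Fin n → VTy Op} (V : ∀ i, Val Γ (A i)) :
    𝓜.val (.tuple V) =
      Fan.IsLimit.lift (𝓜.tup fun i => 𝓜.ty (A i)).isLimit fun i => 𝓜.val (V i) := by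
  simp only [val]; rfl

theorem val_proj {n : ℕ} {A : Fin n → VTy Op} (i : Fin n) (V : Val Γ (.prod A)) :
    𝓜.val (.proj i V) = 𝓜.val V ≫ Fan.proj (𝓜.tup fun i => 𝓜.ty (A i)).cone i := by
  simp only [val]

theorem val_inl {A B : VTy Op} (V : Val Γ A) :
    𝓜.val (.inl (B := B) V) = 𝓜.val V ≫ 𝓜.inl (𝓜.ty A) (𝓜.ty B) := by
  simp only [val]; rfl

theorem val_inr {A B : VTy Op} (V : Val Γ B) :
    𝓜.val (.inr (A := A) V) = 𝓜.val V ≫ 𝓜.inr (𝓜.ty A) (𝓜.ty B) := by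
  simp only [val]; rfl

theorem comp_app {A : VTy Op} {D : CTy Op} (V : Val Γ (A.fn D)) (W : Val Γ A) :
    𝓜.comp (.app V W) =
      lift (Y := 𝓜.ty A) (𝓜.val V) (𝓜.val W) ≫
        (𝓜.kexp (𝓜.sig D.sig) (𝓜.ty A) (𝓜.ty D.val)).eval := by
  simp only [comp]; rfl

theorem comp_ret {A : VTy Op} {S : Sig Op (VTy Op)} (V : Val Γ A) :
    𝓜.comp (.ret (S := S) V) = 𝓜.val V ≫ (𝓜.T (𝓜.sig S)).η.app (𝓜.ty A) := by
  simp only [comp]; rfl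

theorem comp_letin {A B : VTy Op} {S : Sig Op (VTy Op)} (M : Comp Γ ⟨A, S⟩)
    (N : Comp (A :: Γ) ⟨B, S⟩) :
    𝓜.comp (.letin M N) = (𝓜.T (𝓜.sig S)).bindWith (X := 𝓜.ctx Γ) (A := 𝓜.ty A) (B := 𝓜.ty B)
      (𝓜.comp M) (𝓜.comp N) := by
  simp only [comp]; rfl

theorem comp_op {S : Sig Op (VTy Op)} (o : {o // o ∈ S.dom}) (V : Val Γ (S.arg o)) :
    𝓜.comp (.op o V) = 𝓜.val V ≫ 𝓜.op (𝓜.sig S) o := by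
  simp only [comp]; rfl

theorem hdl_eq {S : Sig Op (VTy Op)} {D : CTy Op} (H : Hdl Γ S D) :
    𝓜.hdl H = 𝓜.hdlOf (𝓜.sig S) (𝓜.sig D.sig) (𝓜.ty D.val) (Z := 𝓜.ctx Γ)
      fun o => 𝓜.comp (H o) := rfl

theorem comp_handle {A : VTy Op} {S : Sig Op (VTy Op)} {D : CTy Op} (M : Comp Γ ⟨A, S⟩)
    (H : Hdl Γ S D) (N : Comp (A :: Γ) D) :
    𝓜.comp (.handle M H N) = 𝓜.handleWith (𝓜.sig S) (𝓜.sig D.sig) (X := 𝓜.ctx Γ)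
      (A := 𝓜.ty A) (B := 𝓜.ty D.val) (𝓜.hdl H) (𝓜.comp M) (𝓜.comp N) := by
  simp only [comp]; rfl

theorem comp_case {A B : VTy Op} {D : CTy Op} (V : Val Γ (.sum A B)) (M : Comp (A :: Γ) D)
    (N : Comp (B :: Γ) D) :
    𝓜.comp (.case V M N) = lift (Y := 𝓜.sum (𝓜.ty A) (𝓜.ty B)) (𝟙 (𝓜.ctx Γ)) (𝓜.val V) ≫
      𝓜.copair (𝓜.sig D.sig) (Z := 𝓜.ctx Γ) (W := 𝓜.ty D.val) (𝓜.comp M) (𝓜.comp N) := by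
  simp only [comp]; rfl

/-! ## Interpretation of renamed and substituted terms -/

section Naturality

variable {A B : VTy Op} {D : CTy Op} {S : Sig Op (VTy Op)} (f : 𝓜.ctx Δ ⟶ 𝓜.ctx Γ)

/-- Extension of a morphism between contexts by a variable. -/
def under (B : VTy Op) : 𝓜.ctx (B :: Δ) ⟶ 𝓜.ctx (B :: Γ) := f ▷ 𝓜.ty B

theorem lam_natural {M : Comp (A :: Γ) D} {M' : Comp (A :: Δ) D}
    (h : 𝓜.comp M' = 𝓜.under f A ≫ 𝓜.comp M) : 𝓜.val (.lam M') = f ≫ 𝓜.val (.lam M) := by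
  rw [val_lam, val_lam, h]
  exact KleisliExp.curry_natural _ f _

theorem tuple_natural {n : ℕ} {A : Fin n → VTy Op} {V : ∀ i, Val Γ (A i)}
    {V' : ∀ i, Val Δ (A i)} (h : ∀ i, 𝓜.val (V' i) = f ≫ 𝓜.val (V i)) :
    𝓜.val (.tuple V') = f ≫ 𝓜.val (.tuple V) := by
  rw [val_tuple, val_tuple]
  refine Fan.IsLimit.hom_ext (𝓜.tup fun i => 𝓜.ty (A i)).isLimit _ _ fun i => ?_
  refine (Fan.IsLimit.fac _ _ i).trans ((h i).trans (.trans ?_ (Category.assoc _ _ _).symm))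
  exact congrArg (f ≫ ·)
    (Fan.IsLimit.fac (𝓜.tup fun i => 𝓜.ty (A i)).isLimit (fun i => 𝓜.val (V i)) i).symm

theorem proj_natural {n : ℕ} {A : Fin n → VTy Op} (i : Fin n) {V : Val Γ (.prod A)}
    {V' : Val Δ (.prod A)} (h : 𝓜.val V' = f ≫ 𝓜.val V) :
    𝓜.val (.proj i V') = f ≫ 𝓜.val (.proj i V) := by
  rw [val_proj, val_proj, h]
  exact Category.assoc _ _ _

theorem inl_natural {V : Val Γ A} {V' : Val Δ A} (h : 𝓜.val V' = f ≫ 𝓜.val V) :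
    𝓜.val (.inl (B := B) V') = f ≫ 𝓜.val (.inl V) := by
  rw [val_inl, val_inl, h]
  exact Category.assoc _ _ _

theorem inr_natural {V : Val Γ B} {V' : Val Δ B} (h : 𝓜.val V' = f ≫ 𝓜.val V) :
    𝓜.val (.inr (A := A) V') = f ≫ 𝓜.val (.inr V) := by
  rw [val_inr, val_inr, h]
  exact Category.assoc _ _ _

theorem app_natural {V : Val Γ (A.fn D)} {V' : Val Δ (A.fn D)} {W : Val Γ A} {W' : Val Δ A}
    (h : 𝓜.val V' = f ≫ 𝓜.val V) (h' : 𝓜.val W' = f ≫ 𝓜.val W) :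
    𝓜.comp (.app V' W') = f ≫ 𝓜.comp (.app V W) := by
  rw [comp_app, comp_app, h, h']
  exact .trans (congrArg (· ≫ _) (comp_lift _ _ _).symm) (Category.assoc _ _ _)

theorem ret_natural {V : Val Γ A} {V' : Val Δ A} (h : 𝓜.val V' = f ≫ 𝓜.val V) :
    𝓜.comp (.ret (S := S) V') = f ≫ 𝓜.comp (.ret V) := by
  rw [comp_ret, comp_ret, h]
  exact Category.assoc _ _ _

theorem letin_natural {M : Comp Γ ⟨A, S⟩} {M' : Comp Δ ⟨A, S⟩} {N : Comp (A :: Γ) ⟨B, S⟩}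
    {N' : Comp (A :: Δ) ⟨B, S⟩} (h : 𝓜.comp M' = f ≫ 𝓜.comp M)
    (h' : 𝓜.comp N' = 𝓜.under f A ≫ 𝓜.comp N) :
    𝓜.comp (.letin M' N') = f ≫ 𝓜.comp (.letin M N) := by
  rw [comp_letin, comp_letin, h, h']
  exact (StrongMonad.comp_bindWith _ _ _ _).symm

theorem op_natural (o : {o // o ∈ S.dom}) {V : Val Γ (S.arg o)} {V' : Val Δ (S.arg o)}
    (h : 𝓜.val V' = f ≫ 𝓜.val V) : 𝓜.comp (.op o V') = f ≫ 𝓜.comp (.op o V) := by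
  rw [comp_op, comp_op, h]
  exact Category.assoc _ _ _

theorem hdl_natural {H : Hdl Γ S D} {H' : Hdl Δ S D}
    (h : ∀ o, 𝓜.comp (H' o) = 𝓜.under (𝓜.under f _) _ ≫ 𝓜.comp (H o)) :
    𝓜.hdl H' = f ≫ 𝓜.hdl H := by
  rw [hdl_eq, hdl_eq]
  refine .trans ?_ (EffFrame.comp_hdlOf _ _ _ _ f _).symm
  exact congrArg _ (funext h)

theorem handle_natural {M : Comp Γ ⟨A, S⟩} {M' : Comp Δ ⟨A, S⟩} {H : Hdl Γ S D} {H' : Hdl Δ S D}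
    {N : Comp (A :: Γ) D} {N' : Comp (A :: Δ) D} (h : 𝓜.comp M' = f ≫ 𝓜.comp M)
    (h' : ∀ o, 𝓜.comp (H' o) = 𝓜.under (𝓜.under f _) _ ≫ 𝓜.comp (H o))
    (h'' : 𝓜.comp N' = 𝓜.under f A ≫ 𝓜.comp N) :
    𝓜.comp (.handle M' H' N') = f ≫ 𝓜.comp (.handle M H N) := by
  rw [comp_handle, comp_handle, h, 𝓜.hdl_natural f h', h'']
  exact (EffModel.comp_handleWith _ _ _ _ _ _ _).symm

theorem case_natural {V : Val Γ (.sum A B)} {V' : Val Δ (.sum A B)} {M : Comp (A :: Γ) D}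
    {M' : Comp (A :: Δ) D} {N : Comp (B :: Γ) D} {N' : Comp (B :: Δ) D}
    (h : 𝓜.val V' = f ≫ 𝓜.val V) (h' : 𝓜.comp M' = 𝓜.under f A ≫ 𝓜.comp M)
    (h'' : 𝓜.comp N' = 𝓜.under f B ≫ 𝓜.comp N) :
    𝓜.comp (.case V' M' N') = f ≫ 𝓜.comp (.case V M N) := by
  rw [comp_case, comp_case, h, h', h'']
  refine (congrArg (lift _ _ ≫ ·) (𝓜.whiskerRight_copair _ f _ _).symm).trans ?_
  refine (Category.assoc _ _ _).symm.trans (.trans (congrArg (· ≫ _) ?_) (Category.assoc _ _ _))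
  exact lift_id_whiskerRight f _

end Naturality

/-- A morphism between contexts that represents a renaming. -/
def IsRen (ρ : Ren Γ Δ) (f : 𝓜.ctx Δ ⟶ 𝓜.ctx Γ) : Prop :=
  ∀ (A : VTy Op) (x : Var Γ A), 𝓜.var (ρ x) = f ≫ 𝓜.var x

/-- A morphism between contexts that represents a substitution. -/
def IsSubst (σ : Subst Γ Δ) (f : 𝓜.ctx Δ ⟶ 𝓜.ctx Γ) : Prop :=
  ∀ (A : VTy Op) (x : Var Γ A), 𝓜.val (σ x) = f ≫ 𝓜.var x

variable {𝓜}

theorem IsRen.lift {ρ : Ren Γ Δ} {f : 𝓜.ctx Δ ⟶ 𝓜.ctx Γ} (h : 𝓜.IsRen ρ f) (B : VTy Op) :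
    𝓜.IsRen (ρ.lift B) (𝓜.under f B)
  | _, .zero => (whiskerRight_snd f (𝓜.ty B)).symm
  | A, .succ x => by
    refine (congrArg (fst (𝓜.ctx Δ) (𝓜.ty B) ≫ ·) (h A x)).trans ?_
    exact (whiskerRight_fst_assoc f (𝓜.ty B) (𝓜.var x)).symm

mutual

theorem IsRen.val {Γ Δ : Ctx Op} {A : VTy Op} {ρ : Ren Γ Δ} {f : 𝓜.ctx Δ ⟶ 𝓜.ctx Γ}
    (h : 𝓜.IsRen ρ f) : (V : Val Γ A) → 𝓜.val (V.rename ρ) = f ≫ 𝓜.val V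
  | .var x => by rw [Val.rename, val_var, val_var]; exact h _ x
  | .lam M => by rw [Val.rename]; exact 𝓜.lam_natural f ((h.lift _).comp M)
  | .tuple V => by rw [Val.rename]; exact 𝓜.tuple_natural f fun i => h.val (V i)
  | .proj (A := _) i V => by rw [Val.rename]; exact 𝓜.proj_natural f i (h.val V)
  | .inl V => by rw [Val.rename]; exact 𝓜.inl_natural f (h.val V)
  | .inr V => by rw [Val.rename]; exact 𝓜.inr_natural f (h.val V)

theorem IsRen.comp {Γ Δ : Ctx Op} {D : CTy Op} {ρ : Ren Γ Δ} {f : 𝓜.ctx Δ ⟶ 𝓜.ctx Γ}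
    (h : 𝓜.IsRen ρ f) : (M : Comp Γ D) → 𝓜.comp (M.rename ρ) = f ≫ 𝓜.comp M
  | .app V W => by rw [Comp.rename]; exact 𝓜.app_natural f (h.val V) (h.val W)
  | .ret V => by rw [Comp.rename]; exact 𝓜.ret_natural f (h.val V)
  | .letin M N => by rw [Comp.rename]; exact 𝓜.letin_natural f (h.comp M) ((h.lift _).comp N)
  | .op o V => by rw [Comp.rename]; exact 𝓜.op_natural f o (h.val V)
  | .handle M H N => by
    rw [Comp.rename]
    exact 𝓜.handle_natural f (h.comp M) (fun o => ((h.lift _).lift _).comp (H o))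
      ((h.lift _).comp N)
  | .case V M N => by
    rw [Comp.rename]
    exact 𝓜.case_natural f (h.val V) ((h.lift _).comp M) ((h.lift _).comp N)

end

theorem isRen_succ (Γ : Ctx Op) (B : VTy Op) :
    𝓜.IsRen (fun _ (x : Var Γ _) => .succ x) (fst (𝓜.ctx Γ) (𝓜.ty B)) := fun _ _ => rfl

theorem val_weaken {A : VTy Op} (V : Val Γ A) (B : VTy Op) :
    𝓜.val (V.weaken B) = fst (𝓜.ctx Γ) (𝓜.ty B) ≫ 𝓜.val V := (isRen_succ Γ B).val V

theorem IsSubst.lift {σ : Subst Γ Δ} {f : 𝓜.ctx Δ ⟶ 𝓜.ctx Γ} (h : 𝓜.IsSubst σ f) (B : VTy Op) :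
    𝓜.IsSubst (σ.lift B) (𝓜.under f B)
  | _, .zero => (𝓜.val_var _).trans (whiskerRight_snd f (𝓜.ty B)).symm
  | A, .succ x => by
    refine (val_weaken _ _).trans ?_
    refine (congrArg (fst (𝓜.ctx Δ) (𝓜.ty B) ≫ ·) (h A x)).trans ?_
    exact (whiskerRight_fst_assoc f (𝓜.ty B) (𝓜.var x)).symm

mutual

theorem IsSubst.val {Γ Δ : Ctx Op} {A : VTy Op} {σ : Subst Γ Δ} {f : 𝓜.ctx Δ ⟶ 𝓜.ctx Γ}
    (h : 𝓜.IsSubst σ f) : (V : Val Γ A) → 𝓜.val (V.subst σ) = f ≫ 𝓜.val V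
  | .var x => by rw [Val.subst, val_var]; exact h _ x
  | .lam M => by rw [Val.subst]; exact 𝓜.lam_natural f ((h.lift _).comp M)
  | .tuple V => by rw [Val.subst]; exact 𝓜.tuple_natural f fun i => h.val (V i)
  | .proj (A := _) i V => by rw [Val.subst]; exact 𝓜.proj_natural f i (h.val V)
  | .inl V => by rw [Val.subst]; exact 𝓜.inl_natural f (h.val V)
  | .inr V => by rw [Val.subst]; exact 𝓜.inr_natural f (h.val V)

theorem IsSubst.comp {Γ Δ : Ctx Op} {D : CTy Op} {σ : Subst Γ Δ} {f : 𝓜.ctx Δ ⟶ 𝓜.ctx Γ}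
    (h : 𝓜.IsSubst σ f) : (M : Comp Γ D) → 𝓜.comp (M.subst σ) = f ≫ 𝓜.comp M
  | .app V W => by rw [Comp.subst]; exact 𝓜.app_natural f (h.val V) (h.val W)
  | .ret V => by rw [Comp.subst]; exact 𝓜.ret_natural f (h.val V)
  | .letin M N => by rw [Comp.subst]; exact 𝓜.letin_natural f (h.comp M) ((h.lift _).comp N)
  | .op o V => by rw [Comp.subst]; exact 𝓜.op_natural f o (h.val V)
  | .handle M H N => by
    rw [Comp.subst]
    exact 𝓜.handle_natural f (h.comp M) (fun o => ((h.lift _).lift _).comp (H o))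
      ((h.lift _).comp N)
  | .case V M N => by
    rw [Comp.subst]
    exact 𝓜.case_natural f (h.val V) ((h.lift _).comp M) ((h.lift _).comp N)

end

theorem isSubst_id (Γ : Ctx Op) : 𝓜.IsSubst (Subst.id Γ) (𝟙 (𝓜.ctx Γ)) :=
  fun _ x => (𝓜.val_var x).trans (Category.id_comp _).symm

theorem IsSubst.cons {σ : Subst Γ Δ} {f : 𝓜.ctx Δ ⟶ 𝓜.ctx Γ} (h : 𝓜.IsSubst σ f) {B : VTy Op}
    (V : Val Δ B) : 𝓜.IsSubst (σ.cons V) (CartesianMonoidalCategory.lift f (𝓜.val V))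
  | _, .zero => (lift_snd f (𝓜.val V)).symm
  | A, .succ x => (h A x).trans (lift_fst_assoc f (𝓜.val V) (𝓜.var x)).symm

variable (𝓜)

theorem comp_inst {A : VTy Op} {D : CTy Op} (M : Comp (A :: Γ) D) (V : Val Γ A) :
    𝓜.comp (M.inst V) = CartesianMonoidalCategory.lift (𝟙 (𝓜.ctx Γ)) (𝓜.val V) ≫ 𝓜.comp M :=
  ((isSubst_id Γ).cons V).comp M

theorem comp_inst₂ {A B : VTy Op} {D : CTy Op} (M : Comp (B :: A :: Γ) D) (V : Val Γ A)
    (W : Val Γ B) : 𝓜.comp (M.inst₂ V W) =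
      CartesianMonoidalCategory.lift
        (CartesianMonoidalCategory.lift (𝟙 (𝓜.ctx Γ)) (𝓜.val V)) (𝓜.val W) ≫ 𝓜.comp M :=
  (((isSubst_id Γ).cons V).cons W).comp M

theorem comp_weakenUnder {A : VTy Op} {D : CTy Op} (M : Comp (A :: Γ) D) (B : VTy Op) :
    𝓜.comp (M.weakenUnder B) = fst (𝓜.ctx Γ) (𝓜.ty B) ▷ 𝓜.ty A ≫ 𝓜.comp M :=
  ((isRen_succ Γ B).lift A).comp M

theorem hdl_weaken {S : Sig Op (VTy Op)} {D : CTy Op} (H : Hdl Γ S D) (B : VTy Op) :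
    𝓜.hdl (H.weaken B) = fst (𝓜.ctx Γ) (𝓜.ty B) ≫ 𝓜.hdl H :=
  𝓜.hdl_natural _ fun o => (((isRen_succ Γ B).lift _).lift _).comp (H o)

theorem comp_replace {A B : VTy Op} {D : CTy Op} (M : Comp (A :: Γ) D) (V : Val (B :: Γ) A) :
    𝓜.comp (M.replace V) =
      CartesianMonoidalCategory.lift (fst (𝓜.ctx Γ) (𝓜.ty B)) (𝓜.val V) ≫ 𝓜.comp M := by
  have h : 𝓜.IsSubst (fun _ (x : Var Γ _) => .var (.succ x)) (fst (𝓜.ctx Γ) (𝓜.ty B)) :=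
    fun _ _ => 𝓜.val_var _
  exact (h.cons V).comp M

end EffPlusModel

end

section

variable {Op : Type w} {C : Type u} [Category.{v} C] [CartesianMonoidalCategory C]

/-! ## Soundness -/

namespace EffPlusModel

variable (𝓜 : EffPlusModel Op C)

section Laws

variable {Γ : Ctx Op} {A B : VTy Op} {D : CTy Op} {S : Sig Op (VTy Op)}

theorem val_lam_eta (V : Val Γ (A.fn D)) :
    𝓜.val V = 𝓜.val (.lam (.app (V.weaken A) (.var .zero))) := by
  rw [val_lam, comp_app, val_weaken, val_var]
  have h (X Y Z : C) (f : X ⟶ Z) : f ▷ Y = lift (fst X Y ≫ f) (snd X Y) := by ext <;> simp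
  let K := 𝓜.kexp (𝓜.sig D.sig) (𝓜.ty A) (𝓜.ty D.val)
  refine (KleisliExp.curry_eval K (𝓜.val V)).symm.trans ?_
  exact congrArg K.curry (congrArg (· ≫ K.eval) (h _ _ _ _))

theorem val_prod_beta {n : ℕ} {A : Fin n → VTy Op} (V : ∀ i, Val Γ (A i)) (i : Fin n) :
    𝓜.val (.proj i (.tuple V)) = 𝓜.val (V i) := by
  rw [val_proj, val_tuple]
  exact Fan.IsLimit.fac (𝓜.tup fun i => 𝓜.ty (A i)).isLimit (fun i => 𝓜.val (V i)) i

theorem val_prod_eta {n : ℕ} {A : Fin n → VTy Op} (V : Val Γ (.prod A)) :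
    𝓜.val V = 𝓜.val (.tuple fun i => .proj i V) := by
  rw [val_tuple]
  refine Fan.IsLimit.hom_ext (𝓜.tup fun i => 𝓜.ty (A i)).isLimit _ _ fun i => ?_
  refine .trans ?_ (Fan.IsLimit.fac (𝓜.tup fun i => 𝓜.ty (A i)).isLimit _ i).symm
  exact (𝓜.val_proj i V).symm

theorem comp_lam_beta (M : Comp (A :: Γ) D) (V : Val Γ A) :
    𝓜.comp (.app (.lam M) V) = 𝓜.comp (M.inst V) := by
  rw [comp_app, val_lam, comp_inst]
  exact KleisliExp.lift_curry_eval _ _ _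

theorem comp_ret_let (V : Val Γ A) (M : Comp (A :: Γ) ⟨B, S⟩) :
    𝓜.comp (.letin (.ret V) M) = 𝓜.comp (M.inst V) := by
  rw [comp_letin, comp_ret, comp_inst]
  exact StrongMonad.bindWith_unit _ _ _

theorem comp_let_ret (M : Comp Γ ⟨A, S⟩) :
    𝓜.comp (.letin M (.ret (.var .zero))) = 𝓜.comp M := by
  rw [comp_letin, comp_ret, val_var]
  exact StrongMonad.bindWith_snd_unit _ _

theorem comp_let_let {A₁ A₂ A₃ : VTy Op} (M : Comp Γ ⟨A₁, S⟩) (N : Comp (A₁ :: Γ) ⟨A₂, S⟩)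
    (L : Comp (A₂ :: Γ) ⟨A₃, S⟩) :
    𝓜.comp (.letin (.letin M N) L) = 𝓜.comp (.letin M (.letin N (L.weakenUnder A₁))) := by
  rw [comp_letin, comp_letin, comp_letin, comp_letin, comp_weakenUnder]
  exact StrongMonad.bindWith_bindWith _ _ _ _

theorem comp_handle_ret (V : Val Γ A) (H : Hdl Γ S D) (M : Comp (A :: Γ) D) :
    𝓜.comp (.handle (.ret V) H M) = 𝓜.comp (M.inst V) := by
  rw [comp_handle, comp_ret, comp_inst]
  exact EffModel.handleWith_unit _ _ _ _ _ _

theorem comp_handle_let (L : Comp Γ ⟨A, S⟩) (M : Comp (A :: Γ) ⟨B, S⟩) (H : Hdl Γ S D)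
    (N : Comp (B :: Γ) D) :
    𝓜.comp (.handle (.letin L M) H N) =
      𝓜.comp (.handle L H (.handle M (Hdl.weaken H A) (N.weakenUnder A))) := by
  rw [comp_handle, comp_letin, comp_handle, comp_handle, hdl_weaken, comp_weakenUnder]
  exact EffModel.handleWith_bindWith _ _ _ _ _ _ _

theorem comp_handle_op (o : {o // o ∈ S.dom}) (V : Val Γ (S.arg o)) (H : Hdl Γ S D)
    (M : Comp (S.res o :: Γ) D) :
    𝓜.comp (.handle (.op o V) H M) = 𝓜.comp ((H o).inst₂ V (.lam M)) := by
  rw [comp_handle, comp_op, comp_inst₂, val_lam, hdl_eq]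
  exact EffModel.handleWith_op _ _ _ _ _ _ _

theorem comp_case_inl (V : Val Γ A) (M : Comp (A :: Γ) D) (N : Comp (B :: Γ) D) :
    𝓜.comp (.case (.inl V) M N) = 𝓜.comp (M.inst V) := by
  rw [comp_case, val_inl, comp_inst]
  refine (congrArg (· ≫ _) (lift_whiskerLeft _ _ _).symm).trans ((Category.assoc _ _ _).trans ?_)
  exact congrArg (_ ≫ ·) (𝓜.inl_copair _ _ _)

theorem comp_case_inr (V : Val Γ B) (M : Comp (A :: Γ) D) (N : Comp (B :: Γ) D) :
    𝓜.comp (.case (.inr V) M N) = 𝓜.comp (N.inst V) := by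
  rw [comp_case, val_inr, comp_inst]
  refine (congrArg (· ≫ _) (lift_whiskerLeft _ _ _).symm).trans ((Category.assoc _ _ _).trans ?_)
  exact congrArg (_ ≫ ·) (𝓜.inr_copair _ _ _)

theorem comp_case_eta (V : Val Γ (.sum A B)) (M : Comp (.sum A B :: Γ) D) :
    𝓜.comp (.case V (M.replace (.inl (.var .zero))) (M.replace (.inr (.var .zero)))) =
      𝓜.comp (M.inst V) := by
  have h (X Y Z : C) (f : Y ⟶ Z) : lift (fst X Y) (snd X Y ≫ f) = X ◁ f := by
    ext <;> simp
  rw [comp_case, comp_inst, comp_replace, comp_replace, val_inl, val_inr, val_var, val_var]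
  refine congrArg (_ ≫ ·) (.trans ?_ (𝓜.copair_comp _ _))
  exact congrArg₂ (𝓜.copair _) (congrArg (· ≫ _) (h _ _ _ _)) (congrArg (· ≫ _) (h _ _ _ _))

end Laws

mutual

theorem val_eq {Γ : Ctx Op} {A : VTy Op} {V W : Val Γ A} : ValEq V W → 𝓜.val V = 𝓜.val W
  | .refl _ => rfl
  | .symm h => (val_eq h).symm
  | .trans h h' => (val_eq h).trans (val_eq h')
  | .lam_congr h => by rw [val_lam, val_lam, comp_eq h]
  | .tuple_congr h => by rw [val_tuple, val_tuple, funext fun i => val_eq (h i)]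
  | .proj_congr (A := _) i h => by rw [val_proj, val_proj, val_eq h]
  | .inl_congr h => by rw [val_inl, val_inl, val_eq h]
  | .inr_congr h => by rw [val_inr, val_inr, val_eq h]
  | .lam_eta V => 𝓜.val_lam_eta V
  | .prod_beta (A := _) V i => 𝓜.val_prod_beta V i
  | .prod_eta V => 𝓜.val_prod_eta V

theorem comp_eq {Γ : Ctx Op} {D : CTy Op} {M N : Comp Γ D} : CompEq M N → 𝓜.comp M = 𝓜.comp N
  | .refl _ => rfl
  | .symm h => (comp_eq h).symm
  | .trans h h' => (comp_eq h).trans (comp_eq h')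
  | .app_congr h h' => by rw [comp_app, comp_app, val_eq h, val_eq h']
  | .ret_congr h => by rw [comp_ret, comp_ret, val_eq h]
  | .letin_congr h h' => by rw [comp_letin, comp_letin, comp_eq h, comp_eq h']
  | .op_congr o h => by rw [comp_op, comp_op, val_eq h]
  | .handle_congr h h' h'' => by
    rw [comp_handle, comp_handle, comp_eq h, hdl_congr h', comp_eq h'']
  | .case_congr h h' h'' => by rw [comp_case, comp_case, val_eq h, comp_eq h', comp_eq h'']
  | .lam_beta M V => 𝓜.comp_lam_beta M V
  | .ret_let V M => 𝓜.comp_ret_let V M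
  | .let_ret M => 𝓜.comp_let_ret M
  | .let_let M N L => 𝓜.comp_let_let M N L
  | .handle_ret V H M => 𝓜.comp_handle_ret V H M
  | .handle_let L M H N => 𝓜.comp_handle_let L M H N
  | .handle_op o V H M => 𝓜.comp_handle_op o V H M
  | .case_inl V M N => 𝓜.comp_case_inl V M N
  | .case_inr V M N => 𝓜.comp_case_inr V M N
  | .case_eta V M => 𝓜.comp_case_eta V M

theorem hdl_congr {Γ : Ctx Op} {S : Sig Op (VTy Op)} {D : CTy Op} {H H' : Hdl Γ S D} :
    HdlEq H H' → 𝓜.hdl H = 𝓜.hdl H'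
  | .refl _ => rfl
  | .symm h => (hdl_congr h).symm
  | .trans h h' => (hdl_congr h).trans (hdl_congr h')
  | .congr h => by rw [hdl_eq, hdl_eq]; exact congrArg _ (funext fun o => comp_eq (h o))

end

end EffPlusModel

end

end LambdaEff

theorem mainTheorem9 (Op : Type w) :
    -- soundness
    (∀ (C : Type u) [Category.{v} C] [CartesianMonoidalCategory C]
        (𝓜 : LambdaEff.EffPlusModel Op C) (Γ : LambdaEff.Ctx Op),
      (∀ (A : LambdaEff.VTy Op) (V W : LambdaEff.Val Γ A),
        LambdaEff.ValEq V W → 𝓜.val V = 𝓜.val W) ∧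
      (∀ (D : LambdaEff.CTy Op) (M N : LambdaEff.Comp Γ D),
        LambdaEff.CompEq M N → 𝓜.comp M = 𝓜.comp N) ∧
      (∀ (S : LambdaEff.Sig Op (LambdaEff.VTy Op)) (D : LambdaEff.CTy Op)
        (H H' : LambdaEff.Hdl Γ S D),
        LambdaEff.HdlEq H H' → 𝓜.hdl H = 𝓜.hdl H')) ∧
    -- completeness
    (∀ Γ : LambdaEff.Ctx Op,
      (∀ (A : LambdaEff.VTy Op) (V W : LambdaEff.Val Γ A),
        (∀ (C : Type w) [Category.{w} C] [CartesianMonoidalCategory C]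
          (𝓜 : LambdaEff.EffPlusModel Op C), 𝓜.val V = 𝓜.val W) → LambdaEff.ValEq V W) ∧
      (∀ (D : LambdaEff.CTy Op) (M N : LambdaEff.Comp Γ D),
        (∀ (C : Type w) [Category.{w} C] [CartesianMonoidalCategory C]
          (𝓜 : LambdaEff.EffPlusModel Op C), 𝓜.comp M = 𝓜.comp N) → LambdaEff.CompEq M N) ∧
      (∀ (S : LambdaEff.Sig Op (LambdaEff.VTy Op)) (D : LambdaEff.CTy Op)
        (H H' : LambdaEff.Hdl Γ S D),
        (∀ (C : Type w) [Category.{w} C] [CartesianMonoidalCategory C]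
          (𝓜 : LambdaEff.EffPlusModel Op C), 𝓜.hdl H = 𝓜.hdl H') → LambdaEff.HdlEq H H')) := by
  refine ⟨fun C _ _ 𝓜 Γ => ⟨fun _ _ _ => 𝓜.val_eq, fun _ _ _ => 𝓜.comp_eq,
    fun _ _ _ _ => 𝓜.hdl_congr⟩, fun Γ => ⟨fun _ _ _ h => ?_, fun _ _ _ h => ?_,
    fun _ _ _ _ h => .congr fun o => ?_⟩⟩
  · exact LambdaEff.TermHom.valEq_of_val_eq (h _ (LambdaEff.TermHom.plusModel Op))
  · exact LambdaEff.TermHom.compEq_of_comp_eq (h _ (LambdaEff.TermHom.plusModel Op))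
  · exact LambdaEff.TermHom.compEq_of_comp_eq
      ((LambdaEff.TermHom.plusModel Op).comp_eq_of_hdl_eq
        (h _ (LambdaEff.TermHom.plusModel Op)) o)
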